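/- Let $d\ge 0$, let $B:[0,\infty)\to[0,\infty)$ be a Bernstein function with $B(0)=0$ (continuous on $[0,\infty)$, smooth on $(0,\infty)$, $(-1)^{n-1}B^{(n)}\ge 0$ on $(0,\infty)$ for $n\ge1$), let $\omega:\mathbb R^d\to[0,\infty)$ be locally integrable, $g\in L^2(\mathbb R^d)$, $P$ a real polynomial bounded from below on $\mathbb R$, and $V\in L^1_{\mathrm{loc}}(\mathbb R^d)$ real-valued. Let $\mathcal K=\bigoplus_{n\ge0}\otimes_s^nL^2(\mathbb R^d)$ be the bosonic Fock space with vacuum $\Omega_b$ and creation and annihilation operators $a^*,a$, let $\mathcal H=L^2(\mathbb R^d)\otimes\mathcal K=L^2(\mathbb R^d;\mathcal K)$, $p=-i\nabla_x$, $H_f=\int\omega(k)a^*(k)a(k)\,dk$, $P_f=\int k\,a^*(k)a(k)\,dk$, $$\phi(x)=\tfrac1{\sqrt2}\int\big(g(k)e^{-ik\cdot x}a^*(k)+\overline{g(k)}e^{ik\cdot x}a(k)\big)dk ,$$ and let $\mathcal D_0=C_0^\infty(\mathbb R^d)\,\hat\otimes\,\mathcal F_{\mathrm{fin}}$ (algebraic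 tensor product), where $\mathcal F_{\mathrm{fin}}$ is the linear span of the vectors $a^*(f_1)\cdots a^*(f_n)\Omega_b$, $n\ge 0$, $f_j\in C_0^\infty(\mathbb R^d)$. Let $Q(\cdot)$ denote form domains, and consider the quadratic forms $$H^0=B(p^2)\otimes I+I\otimes H_f+P(\phi(x)),\qquad H^V=H^0+V\otimes I ,\qquad h=B(p^2)+V,$$ where $P(\phi(x))$ is taken on the vectors with a bounded number of bosons. Then: 1. (H.1) $\mathcal D_0$ is dense in $\mathcal H$, $\mathcal D_0\subseteq Q(H^0)\cap Q(V)$, and $H^0$ is a Hermitian form that is closable and bounded from below on $\mathcal D_0$. Moreover $H^V$ is closable and bounded from below on $\mathcal D_0$ (so that (H.1) holds in full) if and only if $h$ is closable and bounded from below on $C_0^\infty(\mathbb R^d)$. 2. (H.2) $P_f=(P_{f,1},\dots,P_{f,d})$ and $\mathbf P=(P_1,\dots,P_d)$, $P_j=\overline{p_j\otimes I+I\otimes P_{f,j}}$, are vectors of commuting self-adjoint operators, and for all $k\in\mathbb R^d$ and $\Psi,\Phi\in\mathcal D_0$ one has $e^{ik\cdot\mathbf P}\mathcal D_0=\mathcal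 D_0$ and $(e^{ik\cdot\mathbf P}\Psi|H^0e^{ik\cdot\mathbf P}\Phi)=(\Psi|H^0\Phi)$. 3. (H.3) With $K(k)=B(k^2)$, which is measurable, and $\Omega(k)=e^{-ik\cdot x}H^0e^{ik\cdot x}$ one has $\tfrac12\{\Omega(k)+\Omega(-k)-2\Omega(0)\}\le K(k)$ as forms on $\mathcal D_0$, for all $k\in\mathbb R^d$. 4. (H.4) $\mathcal D_1=C_0^\infty(\mathbb R^d)$ is a non-trivial subspace of $L^2(\mathbb R^d)$, contained in $Q(K(p))\cap Q(V)$ and invariant under complex conjugation, and $f(x)\Psi\in\mathcal D_0$ for all $f\in\mathcal D_1$, $\Psi\in\mathcal D_0$. 5. Put $$E^{0}_{\mathrm{Nel}}=\inf_{\Psi\in\mathcal D_0,\|\Psi\|=1}(\Psi|H^{0}\Psi),\quad E^{V}_{\mathrm{Nel}}=\inf_{\Psi\in\mathcal D_0,\|\Psi\|=1}(\Psi|H^{V}\Psi),\quad e_0=\inf_{f\in C_0^\infty(\mathbb R^d),\|f\|=1}(f|(B(p^2)+V)f)$$ in $[-\infty,\infty]$. Then $E^0_{\mathrm{Nel}}$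 is finite and $E^V_{\mathrm{Nel}}\le E^0_{\mathrm{Nel}}+e_0$. In particular, if $e_0<0$, then the binding energy satisfies $E^0_{\mathrm{Nel}}-E^V_{\mathrm{Nel}}\ge -e_0>0$. -/

import Mathlib

open MeasureTheory Filter Topology
open scoped ENNReal ContDiff FourierTransform InnerProductSpace ComplexConjugate

noncomputable section

namespace NelsonModel

/-! ### Hermitian forms -/

/-- A form on `H`: its form domain `dom` and the values `(Ψ | A Φ) = val Ψ Φ`, which are
meaningful for `Ψ, Φ ∈ dom`. -/
structure SForm (H : Type*) [NormedAddCommGroup H] [InnerProductSpace ℂ H] where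
  dom : Submodule ℂ H
  val : H → H → ℂ

section Forms

variable {H : Type*} [NormedAddCommGroup H] [InnerProductSpace ℂ H]

/-- Sum of forms, on the intersection of the form domains. -/
def SForm.sum (q r : SForm H) : SForm H where
  dom := q.dom ⊓ r.dom
  val Ψ Φ := q.val Ψ Φ + r.val Ψ Φ

/-- `q` is sesquilinear (linear in the second argument) and Hermitian on its form domain. -/
structure SForm.IsHermitian (q : SForm H) : Prop where
  add_right : ∀ Ψ ∈ q.dom, ∀ Φ ∈ q.dom, ∀ Φ' ∈ q.dom,
    q.val Ψ (Φ + Φ') = q.val Ψ Φ + q.val Ψ Φ'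
  smul_right : ∀ Ψ ∈ q.dom, ∀ Φ ∈ q.dom, ∀ c : ℂ, q.val Ψ (c • Φ) = c * q.val Ψ Φ
  conj_symm : ∀ Ψ ∈ q.dom, ∀ Φ ∈ q.dom, conj (q.val Φ Ψ) = q.val Ψ Φ

/-- `q` is bounded from below on `D`. -/
def SForm.BoundedBelowOn (q : SForm H) (D : Submodule ℂ H) : Prop :=
  ∃ c : ℝ, ∀ Ψ ∈ D, c * ‖Ψ‖ ^ 2 ≤ (q.val Ψ Ψ).re

/-- `q` is closable on `D`: if `Ψ n ∈ D` tends to `0` and `q[Ψ n - Ψ m] → 0`, then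
`q[Ψ n] → 0`. -/
def SForm.ClosableOn (q : SForm H) (D : Submodule ℂ H) : Prop :=
  ∀ Ψ : ℕ → H, (∀ n, Ψ n ∈ D) → Tendsto Ψ atTop (𝓝 0) →
    Tendsto (fun m : ℕ × ℕ => q.val (Ψ m.1 - Ψ m.2) (Ψ m.1 - Ψ m.2)) atTop (𝓝 0) →
    Tendsto (fun n => q.val (Ψ n) (Ψ n)) atTop (𝓝 0)

/-- `inf { (Ψ | q Ψ) : Ψ ∈ D, ‖Ψ‖ = 1 }`, as an extended real number. -/
def SForm.infOn (q : SForm H) (D : Submodule ℂ H) : EReal :=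
  ⨅ (Ψ : H) (_ : Ψ ∈ D ∧ ‖Ψ‖ = 1), (((q.val Ψ Ψ).re : ℝ) : EReal)

/-- `W k = exp(i k · A)` for the vector `A = (A 1, …, A d)` of operators: `W` is a strongly
continuous unitary representation of `ℝ^d`, and `A j` (with its exact domain) is the generator of
the one-parameter group `t ↦ W (t e_j) = exp(i t A j)`. -/
structure IsExpI {d : ℕ} (A : Fin d → (H →ₗ.[ℂ] H))
    (W : EuclideanSpace ℝ (Fin d) → (H ≃ₗᵢ[ℂ] H)) : Prop where
  map_zero : ∀ Ψ, W 0 Ψ = Ψ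
  map_add : ∀ k l Ψ, W (k + l) Ψ = W k (W l Ψ)
  continuous : ∀ Ψ, Continuous fun k => W k Ψ
  generator : ∀ j Ψ Φ, (Ψ, Φ) ∈ (A j).graph ↔
    Tendsto (fun t : ℝ => (Complex.I * (t : ℂ))⁻¹ •
      (W (t • EuclideanSpace.single j (1 : ℝ)) Ψ - Ψ)) (𝓝[≠] 0) (𝓝 Φ)

/-- A vector of (strongly) commuting self-adjoint operators. -/
def IsCommutingSelfAdjoint [CompleteSpace H] {d : ℕ} (A : Fin d → (H →ₗ.[ℂ] H)) : Prop :=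
  (∀ j, IsSelfAdjoint (A j)) ∧ ∃ W, IsExpI A W

end Forms

/-! ### The particle space `L²(ℝ^d)` and `L²(ℝ^d) ⊗ K = L²(ℝ^d; K)` -/

/-- `ℝ^d` with the Euclidean norm. -/
abbrev Sp (d : ℕ) : Type := EuclideanSpace ℝ (Fin d)

/-- `L²(ℝ^d; K)`, the Hilbert space tensor product of `L²(ℝ^d)` and `K`. -/
abbrev L2 (d : ℕ) (K : Type*) [NormedAddCommGroup K] : Type _ :=
  Lp K 2 (volume : Measure (Sp d))

section Particle

variable {d : ℕ} {K : Type*} [NormedAddCommGroup K] [InnerProductSpace ℂ K]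

/-- The vector `f ⊗ ψ`, i.e. `x ↦ f x • ψ`. -/
def tensor (f : L2 d ℂ) (ψ : K) : L2 d K :=
  (ContinuousLinearMap.toSpanSingleton ℂ ψ).compLp f

/-- The algebraic tensor product of two subspaces. -/
def algTensor (D : Submodule ℂ (L2 d ℂ)) (F : Submodule ℂ K) : Submodule ℂ (L2 d K) :=
  Submodule.span ℂ {Ψ | ∃ f ∈ D, ∃ ψ ∈ F, Ψ = tensor f ψ}

/-- `C_0^∞(ℝ^d)` as a subspace of `L²(ℝ^d)`. -/
def testFunctions (d : ℕ) : Submodule ℂ (L2 d ℂ) where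
  carrier := {f | ∃ u : Sp d → ℂ, ContDiff ℝ ∞ u ∧ HasCompactSupport u ∧ f =ᵐ[volume] u}
  zero_mem' := ⟨0, contDiff_const, HasCompactSupport.zero, Lp.coeFn_zero _ _ _⟩
  add_mem' := by
    rintro f g ⟨u, hu, hu', hf⟩ ⟨v, hv, hv', hg⟩
    exact ⟨u + v, hu.add hv, hu'.add hv', (Lp.coeFn_add f g).trans (hf.add hg)⟩
  smul_mem' := by
    rintro c f ⟨u, hu, hu', hf⟩
    exact ⟨c • u, contDiff_const.smul hu, hu'.smul_left (f := fun _ => c),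
      (Lp.coeFn_smul c f).trans (hf.const_smul c)⟩

theorem memLp_phase (k : Sp d) (Ψ : L2 d K) :
    MemLp (fun x => Complex.exp (Complex.I * (⟪k, x⟫_ℝ : ℂ)) • Ψ x) 2 volume := by
  refine (Lp.memLp Ψ).of_le (AEStronglyMeasurable.smul ?_ (Lp.aestronglyMeasurable Ψ)) ?_
  · exact Continuous.aestronglyMeasurable (by fun_prop)
  · refine Eventually.of_forall fun x => ?_
    rw [norm_smul, mul_comm Complex.I, Complex.norm_exp_ofReal_mul_I, one_mul]

/-- Multiplication by `exp(i k · x)`. -/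
def phase (k : Sp d) (Ψ : L2 d K) : L2 d K := (memLp_phase k Ψ).toLp _

/-- The form domain `Dom(|m|^{1/2})` of multiplication by the real function `m`. -/
def mulDom (m : Sp d → ℝ) : Submodule ℂ (L2 d K) where
  carrier := {Ψ | MemLp (fun x => ((√|m x| : ℝ) : ℂ) • Ψ x) 2 volume}
  zero_mem' := by
    refine (MemLp.zero (p := 2) (μ := volume) (ε := K)).ae_eq ?_
    filter_upwards [Lp.coeFn_zero K 2 (volume : Measure (Sp d))] with x hx
    rw [hx, Pi.zero_apply, smul_zero]
  add_mem' := by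
    intro Ψ Φ hΨ hΦ
    refine (MemLp.add hΨ hΦ).ae_eq ?_
    filter_upwards [Lp.coeFn_add Ψ Φ] with x hx
    rw [hx, Pi.add_apply, Pi.add_apply, smul_add]
  smul_mem' := by
    intro c Ψ hΨ
    refine (MemLp.const_smul hΨ c).ae_eq ?_
    filter_upwards [Lp.coeFn_smul c Ψ] with x hx
    simp only [Pi.smul_apply, hx]
    rw [smul_comm]

/-- The form of multiplication by the real function `m(x)` on `L²(ℝ^d; K)`. -/
def mulForm (m : Sp d → ℝ) : SForm (L2 d K) where
  dom := mulDom m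
  val Ψ Φ := ∫ x, (m x : ℂ) * ⟪Ψ x, Φ x⟫_ℂ

/-- The form of `m(p) ⊗ I` on `L²(ℝ^d; K)`, where `p = -i∇`. The Fourier transform used is
`f̂(ξ) = ∫ exp(-2πi ξ · x) f(x) dx`, which turns `p` into multiplication by `2πξ`. -/
def momentumForm [CompleteSpace K] (m : Sp d → ℝ) : SForm (L2 d K) where
  dom := (mulDom fun ξ => m ((2 * Real.pi) • ξ)).comap
    (Lp.fourierTransformₗᵢ (Sp d) K).toLinearEquiv.toLinearMap
  val Ψ Φ := (mulForm fun ξ => m ((2 * Real.pi) • ξ)).val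
    (Lp.fourierTransformₗᵢ (Sp d) K Ψ) (Lp.fourierTransformₗᵢ (Sp d) K Φ)

/-- The momentum operator `p_j = -i ∂/∂x_j` on `L²(ℝ^d)`, with domain
`{f : ξ_j f̂ ∈ L²}`. -/
def momentum (j : Fin d) : L2 d ℂ →ₗ.[ℂ] L2 d ℂ :=
  Submodule.toLinearPMap
    { carrier := {fg | (Lp.fourierTransformₗᵢ (Sp d) ℂ fg.2 : Sp d → ℂ) =ᵐ[volume]
        fun ξ => ((2 * Real.pi * ξ j : ℝ) : ℂ) * Lp.fourierTransformₗᵢ (Sp d) ℂ fg.1 ξ}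
      zero_mem' := by
        simp only [Set.mem_ofPred_eq, Prod.fst_zero, Prod.snd_zero, _root_.map_zero]
        filter_upwards [Lp.coeFn_zero ℂ 2 (volume : Measure (Sp d))] with x hx
        rw [hx, Pi.zero_apply, mul_zero]
      add_mem' := by
        rintro ⟨f, g⟩ ⟨f', g'⟩ h h'
        simp only [Set.mem_ofPred_eq, Prod.mk_add_mk, _root_.map_add] at h h' ⊢
        filter_upwards [h, h', Lp.coeFn_add (Lp.fourierTransformₗᵢ (Sp d) ℂ f)
          (Lp.fourierTransformₗᵢ (Sp d) ℂ f'), Lp.coeFn_add (Lp.fourierTransformₗᵢ (Sp d) ℂ g)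
          (Lp.fourierTransformₗᵢ (Sp d) ℂ g')] with x h1 h2 h3 h4
        rw [h3, h4, Pi.add_apply, Pi.add_apply, h1, h2, mul_add]
      smul_mem' := by
        rintro c ⟨f, g⟩ h
        simp only [Set.mem_ofPred_eq, Prod.smul_mk, _root_.map_smul] at h ⊢
        filter_upwards [h, Lp.coeFn_smul c (Lp.fourierTransformₗᵢ (Sp d) ℂ f),
          Lp.coeFn_smul c (Lp.fourierTransformₗᵢ (Sp d) ℂ g)] with x h1 h3 h4
        rw [h3, h4, Pi.smul_apply, Pi.smul_apply, h1, smul_eq_mul, smul_eq_mul, mul_left_comm] }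

/-- `A ⊗ I + I ⊗ C` on the algebraic tensor product of the domains of `A` and `C`. -/
def tensorSum (A : L2 d ℂ →ₗ.[ℂ] L2 d ℂ) (C : K →ₗ.[ℂ] K) : L2 d K →ₗ.[ℂ] L2 d K :=
  Submodule.toLinearPMap (Submodule.span ℂ
    {ΨΦ | ∃ (f : A.domain) (ψ : C.domain),
      ΨΦ = (tensor (f : L2 d ℂ) (ψ : K), tensor (A f) (ψ : K) + tensor (f : L2 d ℂ) (C ψ))})

/-- The total momentum `P_j`, the closure of `p_j ⊗ I + I ⊗ Pf_j`. -/
def totalMomentum (Pf : Fin d → (K →ₗ.[ℂ] K)) (j : Fin d) : L2 d K →ₗ.[ℂ] L2 d K :=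
  (tensorSum (momentum j) (Pf j)).closure

/-! ### The hypotheses (H.1)–(H.4) for `H^V = H^0 + V` on `L²(ℝ^d; K)` -/

/-- (H.1): the quadratic forms `H^0` and `H^V = H^0 + V` are defined on the dense subspace `D₀`,
and are closable and bounded from below on `D₀`. -/
structure HypH1 (H0 : SForm (L2 d K)) (V : Sp d → ℝ) (D₀ : Submodule ℂ (L2 d K)) : Prop where
  hermitian : H0.IsHermitian
  dense : Dense (D₀ : Set (L2 d K))
  le_dom : D₀ ≤ H0.dom
  le_domV : D₀ ≤ (mulForm V : SForm (L2 d K)).dom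
  closable : H0.ClosableOn D₀
  bddBelow : H0.BoundedBelowOn D₀
  closableV : (H0.sum (mulForm V)).ClosableOn D₀
  bddBelowV : (H0.sum (mulForm V)).BoundedBelowOn D₀

/-- (H.2): `Pf` is a vector of commuting self-adjoint operators and `H^0` commutes with the total
momentum `P`, in the sense that `exp(i k · P) D₀ = D₀` and
`(exp(i k · P) Ψ | H^0 exp(i k · P) Φ) = (Ψ | H^0 Φ)`. -/
def HypH2 [CompleteSpace K] (H0 : SForm (L2 d K)) (D₀ : Submodule ℂ (L2 d K))
    (Pf : Fin d → (K →ₗ.[ℂ] K)) : Prop :=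
  IsCommutingSelfAdjoint Pf ∧
  IsCommutingSelfAdjoint (totalMomentum Pf) ∧
  ∀ W : Sp d → (L2 d K ≃ₗᵢ[ℂ] L2 d K), IsExpI (totalMomentum Pf) W → ∀ k : Sp d,
    (W k '' (D₀ : Set (L2 d K)) = D₀) ∧
    ∀ Ψ ∈ D₀, ∀ Φ ∈ D₀, H0.val (W k Ψ) (W k Φ) = H0.val Ψ Φ

/-- (H.3): `½ {Ω(k) + Ω(-k) - 2 Ω(0)} ≤ Kf(k)` on `D₀`, where
`Ω(k) = exp(-i k · x) H^0 exp(i k · x)`. -/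
def HypH3 (H0 : SForm (L2 d K)) (D₀ : Submodule ℂ (L2 d K)) (Kf : Sp d → ℝ) : Prop :=
  Measurable Kf ∧ ∀ k : Sp d, ∀ Ψ ∈ D₀, phase k Ψ ∈ H0.dom ∧
    (1 / 2 : ℝ) * ((H0.val (phase k Ψ) (phase k Ψ)).re + (H0.val (phase (-k) Ψ) (phase (-k) Ψ)).re
      - 2 * (H0.val (phase 0 Ψ) (phase 0 Ψ)).re) ≤ Kf k * ‖Ψ‖ ^ 2

/-- (H.4): `D₁ ⊆ Q(Kf(p)) ∩ Q(V)` is a non-trivial subspace of `L²(ℝ^d)`, invariant under complex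
conjugation, whose elements multiply `D₀` into itself. -/
structure HypH4 (V Kf : Sp d → ℝ) (D₀ : Submodule ℂ (L2 d K)) (D₁ : Submodule ℂ (L2 d ℂ)) :
    Prop where
  nontrivial : D₁ ≠ ⊥
  le_domK : D₁ ≤ (momentumForm Kf : SForm (L2 d ℂ)).dom
  le_domV : D₁ ≤ (mulForm V : SForm (L2 d ℂ)).dom
  mul_mem : ∀ f ∈ D₁, ∀ Ψ ∈ D₀, ∃ Θ ∈ D₀, Θ =ᵐ[volume] fun x => f x • Ψ x
  conj_mem : ∀ f ∈ D₁, ∃ g ∈ D₁, g =ᵐ[volume] fun x => conj (f x)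

end Particle

/-! ### The bosonic Fock space over `L²(ℝ^d)` -/

/-- `L²((ℝ^d)^n)`, i.e. the `n`-fold tensor power of `L²(ℝ^d)`. -/
abbrev L2n (d n : ℕ) : Type := Lp ℂ 2 (volume : Measure (Fin n → Sp d))

theorem measurePreserving_perm (d n : ℕ) (σ : Equiv.Perm (Fin n)) :
    MeasurePreserving (fun k : Fin n → Sp d => k ∘ σ) volume volume := by
  have h := volume_measurePreserving_piCongrLeft (fun _ : Fin n => Sp d) σ.symm
  convert h using 1
  funext k i
  have := MeasurableEquiv.piCongrLeft_apply_apply σ.symm (β := fun _ => Sp d) k (σ i)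
  simpa using this.symm

/-- The symmetric functions in `L²((ℝ^d)^n)`: the `n`-fold symmetric tensor power of `L²(ℝ^d)`. -/
def symL2 (d n : ℕ) : Submodule ℂ (L2n d n) :=
  ⨅ σ : Equiv.Perm (Fin n), LinearMap.eqLocus
    (Lp.compMeasurePreservingₗ ℂ (fun k : Fin n → Sp d => k ∘ σ) (measurePreserving_perm d n σ))
    LinearMap.id

instance symL2_complete (d n : ℕ) : CompleteSpace (symL2 d n) := by
  have h : IsClosed (symL2 d n : Set (L2n d n)) := by
    rw [symL2, Submodule.coe_iInf]
    refine isClosed_iInter fun σ => isClosed_eq ?_ continuous_id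
    exact (Lp.isometry_compMeasurePreserving (measurePreserving_perm d n σ)).continuous
  exact h.completeSpace_coe

/-- The bosonic Fock space `⨁_n ⊗_s^n L²(ℝ^d)`. -/
abbrev Fock (d : ℕ) : Type := lp (fun n => symL2 d n) 2

/-- All sequences `(ψ^(n))_n` with `ψ^(n) ∈ ⊗_s^n L²(ℝ^d)`, without a norm condition. -/
abbrev FockSeq (d : ℕ) : Type := ∀ n, symL2 d n

/-- The function `(k_0, …, k_n) ↦ h(k_0) ψ(k_1, …, k_n)`. -/
def tensorFun {d n : ℕ} (h : L2 d ℂ) (ψ : L2n d n) (k : Fin (n + 1) → Sp d) : ℂ :=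
  h (k 0) * ψ (fun i => k i.succ)

theorem measurePreserving_split (d n : ℕ) :
    MeasurePreserving (fun k : Fin (n + 1) → Sp d => (k 0, fun i : Fin n => k i.succ))
      volume (volume.prod volume) := by
  have h := volume_preserving_piFinSuccAbove (fun _ : Fin (n + 1) => Sp d) 0
  exact h

theorem eLpNorm_tensorFun {d n : ℕ} (h : L2 d ℂ) (ψ : L2n d n) :
    eLpNorm (tensorFun h ψ) 2 volume = eLpNorm h 2 volume * eLpNorm ψ 2 volume := by
  have hm : AEStronglyMeasurable (fun z : Sp d × (Fin n → Sp d) => h z.1 * ψ z.2)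
      (volume.prod volume) :=
    (Lp.aestronglyMeasurable h).comp_fst.mul (Lp.aestronglyMeasurable ψ).comp_snd
  have e : tensorFun h ψ = (fun z : Sp d × (Fin n → Sp d) => h z.1 * ψ z.2) ∘
      (fun k : Fin (n + 1) → Sp d => (k 0, fun i : Fin n => k i.succ)) := rfl
  rw [e, eLpNorm_comp_measurePreserving hm (measurePreserving_split d n)]
  simp only [eLpNorm_eq_lintegral_rpow_enorm_toReal (p := 2) (by norm_num) (by norm_num), enorm_mul,
    ENNReal.toReal_ofNat]
  rw [← ENNReal.mul_rpow_of_nonneg _ _ (by norm_num)]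
  congr 1
  simp only [ENNReal.mul_rpow_of_nonneg _ _ (zero_le_two : (0 : ℝ) ≤ 2)]
  exact lintegral_prod_mul ((Lp.aestronglyMeasurable h).enorm.pow_const 2)
    ((Lp.aestronglyMeasurable ψ).enorm.pow_const 2)

theorem memLp_tensorFun {d n : ℕ} (h : L2 d ℂ) (ψ : L2n d n) :
    MemLp (tensorFun h ψ) 2 volume := by
  refine ⟨?_, ?_⟩
  · have hm : AEStronglyMeasurable (fun z : Sp d × (Fin n → Sp d) => h z.1 * ψ z.2)
        (volume.prod volume) :=
      (Lp.aestronglyMeasurable h).comp_fst.mul (Lp.aestronglyMeasurable ψ).comp_snd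
    exact hm.comp_measurePreserving (measurePreserving_split d n)
  · rw [eLpNorm_tensorFun]
    exact ENNReal.mul_lt_top (Lp.memLp h).2 (Lp.memLp ψ).2

theorem quasi_tail (d n : ℕ) : Measure.QuasiMeasurePreserving
    (fun (k : Fin (n + 1) → Sp d) (i : Fin n) => k i.succ) volume volume :=
  Measure.quasiMeasurePreserving_snd.comp (measurePreserving_split d n).quasiMeasurePreserving

/-- The bounded operator `ψ ↦ h ⊗ ψ` from `L²((ℝ^d)^n)` to `L²((ℝ^d)^(n+1))`. -/
def tensorL {d : ℕ} (n : ℕ) (h : L2 d ℂ) : L2n d n →L[ℂ] L2n d (n + 1) :=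
  LinearMap.mkContinuous
    { toFun := fun ψ => (memLp_tensorFun h ψ).toLp _
      map_add' := by
        intro ψ φ
        rw [← MemLp.toLp_add]
        refine MemLp.toLp_congr _ _ ?_
        filter_upwards [(quasi_tail d n).ae (Lp.coeFn_add ψ φ)] with k hk
        simp only [tensorFun, Pi.add_apply, hk, mul_add]
      map_smul' := by
        intro c ψ
        rw [RingHom.id_apply, ← MemLp.toLp_const_smul]
        refine MemLp.toLp_congr _ _ ?_
        filter_upwards [(quasi_tail d n).ae (Lp.coeFn_smul c ψ)] with k hk
        simp only [tensorFun, Pi.smul_apply, hk, smul_eq_mul, mul_left_comm] }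
    ‖h‖ (by
      intro ψ
      change ‖(memLp_tensorFun h ψ).toLp _‖ ≤ _
      rw [Lp.norm_toLp, eLpNorm_tensorFun, ENNReal.toReal_mul, Lp.norm_def, Lp.norm_def])

/-- The creation operator `a*(h)` from the `n`-particle to the `(n+1)`-particle sector:
`a*(h) ψ = √(n+1) S(h ⊗ ψ)`, where `S` is the orthogonal projection onto symmetric functions. -/
def createN {d : ℕ} (n : ℕ) (h : L2 d ℂ) : symL2 d n →L[ℂ] symL2 d (n + 1) :=
  ((√((n : ℝ) + 1) : ℝ) : ℂ) •
    ((symL2 d (n + 1)).orthogonalProjectionOnto ∘L tensorL n h ∘L (symL2 d n).subtypeL)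

/-- The creation operator `a*(h)`, acting on sequences. -/
def create {d : ℕ} (h : L2 d ℂ) : Module.End ℂ (FockSeq d) where
  toFun ψ n := match n with
    | 0 => 0
    | n + 1 => createN n h (ψ n)
  map_add' ψ φ := by
    funext n
    cases n <;> simp
  map_smul' c ψ := by
    funext n
    cases n <;> simp

/-- The annihilation operator `a(h)`, acting on sequences; from the `(n+1)`-particle to the
`n`-particle sector it is the adjoint of `a*(h)`. -/
def annihilate {d : ℕ} (h : L2 d ℂ) : Module.End ℂ (FockSeq d) where
  toFun ψ n := ContinuousLinearMap.adjoint (createN n h) (ψ (n + 1))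
  map_add' ψ φ := by
    funext n
    simp
  map_smul' c ψ := by
    funext n
    simp

theorem volume_fin_zero (d : ℕ) : IsFiniteMeasure (volume : Measure (Fin 0 → Sp d)) := by
  rw [volume_pi, Measure.pi_of_empty]
  infer_instance

/-- The vacuum in the `0`-particle sector, the constant function `1`. -/
def vacuumZero (d : ℕ) : symL2 d 0 :=
  ⟨(haveI := volume_fin_zero d; memLp_const (1 : ℂ) :
      MemLp (fun _ : Fin 0 → Sp d => (1 : ℂ)) 2 volume).toLp _, by
    rw [symL2, Submodule.mem_iInf]
    intro σ
    rfl⟩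

/-- The vacuum `Ω = (1, 0, 0, …)`. -/
def vacuum (d : ℕ) : FockSeq d := Pi.single 0 (vacuumZero d)

/-- The span of the vectors `a*(f_1) ⋯ a*(f_n) Ω`, `n ≥ 0`, with `f_j ∈ C_0^∞(ℝ^d)`. -/
def fockFin (d : ℕ) : Submodule ℂ (Fock d) :=
  (Submodule.span ℂ {ψ : FockSeq d | ∃ fs : List (L2 d ℂ), (∀ f ∈ fs, f ∈ testFunctions d) ∧
    ψ = (fs.map create).prod (vacuum d)}).comap
    ({ toFun := fun ψ n => ψ n
       map_add' := fun _ _ => rfl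
       map_smul' := fun _ _ => rfl } : Fock d →ₗ[ℂ] FockSeq d)

/-- The operator on Fock space acting on the `n`-particle sector as multiplication by the real
function `m n (k_1, …, k_n)`, with maximal domain. -/
def sectorMul {d : ℕ} (m : ∀ n, (Fin n → Sp d) → ℝ) : Fock d →ₗ.[ℂ] Fock d :=
  Submodule.toLinearPMap
    { carrier := {ψφ | ∀ n, ((ψφ.2 n : L2n d n) : (Fin n → Sp d) → ℂ) =ᵐ[volume]
        fun k => (m n k : ℂ) * (ψφ.1 n : L2n d n) k}
      zero_mem' := by
        intro n
        filter_upwards [Lp.coeFn_zero ℂ 2 (volume : Measure (Fin n → Sp d))] with k hk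
        change (0 : L2n d n) k = (m n k : ℂ) * (0 : L2n d n) k
        rw [hk, Pi.zero_apply, mul_zero]
      add_mem' := by
        rintro ⟨ψ, φ⟩ ⟨ψ', φ'⟩ h h' n
        filter_upwards [h n, h' n, Lp.coeFn_add (ψ n : L2n d n) (ψ' n),
          Lp.coeFn_add (φ n : L2n d n) (φ' n)] with k h1 h2 h3 h4
        change ((φ n : L2n d n) + φ' n) k = (m n k : ℂ) * ((ψ n : L2n d n) + ψ' n) k
        rw [h3, h4, Pi.add_apply, Pi.add_apply, h1, h2, mul_add]
      smul_mem' := by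
        rintro c ⟨ψ, φ⟩ h n
        filter_upwards [h n, Lp.coeFn_smul c (ψ n : L2n d n),
          Lp.coeFn_smul c (φ n : L2n d n)] with k h1 h3 h4
        change (c • (φ n : L2n d n)) k = (m n k : ℂ) * (c • (ψ n : L2n d n)) k
        rw [h3, h4, Pi.smul_apply, Pi.smul_apply, h1, smul_eq_mul, smul_eq_mul, mul_left_comm] }

/-- The field momentum `Pf_j = ∫ k_j a*(k) a(k) dk`: multiplication by the sum of the `j`-th
components of the momenta in each sector. -/
def fieldMomentum {d : ℕ} (j : Fin d) : Fock d →ₗ.[ℂ] Fock d :=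
  sectorMul fun n k => ∑ i : Fin n, k i j

/-- The form of `I ⊗ H_f` on `L²(ℝ^d; Fock)`, where `H_f = ∫ disp(k) a*(k) a(k) dk` acts on the
`n`-particle sector as multiplication by `disp(k_1) + ⋯ + disp(k_n)`. The form domain is the domain of
`I ⊗ H_f^{1/2}`. -/
def freeFieldForm {d : ℕ} (disp : Sp d → ℝ) : SForm (L2 d (Fock d)) where
  dom :=
    { carrier := {Ψ | ∃ Θ : L2 d (Fock d), ∀ᵐ x,
        (Ψ x, Θ x) ∈ (sectorMul fun n k => √(∑ i : Fin n, disp (k i))).graph}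
      zero_mem' := by
        refine ⟨0, ?_⟩
        filter_upwards [Lp.coeFn_zero (Fock d) 2 (volume : Measure (Sp d))] with x hx
        rw [hx]
        exact Submodule.zero_mem _
      add_mem' := by
        rintro Ψ Φ ⟨Θ, h⟩ ⟨Θ', h'⟩
        refine ⟨Θ + Θ', ?_⟩
        filter_upwards [h, h', Lp.coeFn_add Ψ Φ, Lp.coeFn_add Θ Θ'] with x h1 h2 h3 h4
        rw [h3, h4]
        exact Submodule.add_mem _ h1 h2
      smul_mem' := by
        rintro c Ψ ⟨Θ, h⟩
        refine ⟨c • Θ, ?_⟩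
        filter_upwards [h, Lp.coeFn_smul c Ψ, Lp.coeFn_smul c Θ] with x h1 h3 h4
        rw [h3, h4]
        exact Submodule.smul_mem _ c h1 }
  val Ψ Φ := ∫ x, ∑' n : ℕ, ∫ k : Fin n → Sp d, ((∑ i : Fin n, disp (k i) : ℝ) : ℂ) *
    (conj ((Ψ x n : L2n d n) k) * (Φ x n : L2n d n) k)

/-- The field operator `φ(x) = 2^{-1/2} ∫ (g(k) e^{-ik·x} a*(k) + conj(g(k)) e^{ik·x} a(k)) dk
= 2^{-1/2} (a*(g_x) + a(g_x))` with `g_x(k) = e^{-ik·x} g(k)`. -/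
def fieldOp {d : ℕ} (g : L2 d ℂ) (x : Sp d) : Module.End ℂ (FockSeq d) :=
  ((√2 : ℝ) : ℂ)⁻¹ • (create (phase (-x) g) + annihilate (phase (-x) g))

/-- The form of `P(φ(x))`, with `P` a real polynomial, on the vectors in `L²(ℝ^d; Fock)` with a
bounded number of particles. (On these vectors the sum over `n` is finite.) -/
def interactionForm {d : ℕ} (P : Polynomial ℝ) (g : L2 d ℂ) : SForm (L2 d (Fock d)) where
  dom :=
    { carrier := {Ψ | ∃ N : ℕ, ∀ᵐ x, ∀ n, N < n → Ψ x n = 0}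
      zero_mem' := by
        refine ⟨0, ?_⟩
        filter_upwards [Lp.coeFn_zero (Fock d) 2 (volume : Measure (Sp d))] with x hx n _
        rw [hx]
        rfl
      add_mem' := by
        rintro Ψ Φ ⟨N, h⟩ ⟨N', h'⟩
        refine ⟨max N N', ?_⟩
        filter_upwards [h, h', Lp.coeFn_add Ψ Φ] with x h1 h2 h3 n hn
        rw [h3]
        change Ψ x n + Φ x n = 0
        rw [h1 n (lt_of_le_of_lt (le_max_left _ _) hn),
          h2 n (lt_of_le_of_lt (le_max_right _ _) hn), add_zero]
      smul_mem' := by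
        rintro c Ψ ⟨N, h⟩
        refine ⟨N, ?_⟩
        filter_upwards [h, Lp.coeFn_smul c Ψ] with x h1 h3 n hn
        rw [h3]
        change c • Ψ x n = 0
        rw [h1 n hn, smul_zero] }
  val Ψ Φ := ∫ x, ∑' n : ℕ,
    ⟪Ψ x n, Polynomial.aeval (fieldOp g x) (P.map (algebraMap ℝ ℂ)) (fun l => Φ x l) n⟫_ℂ

/-! ### Nelson type Hamiltonians -/

/-- `B : [0, ∞) → [0, ∞)` is a Bernstein function with `B(0) = 0`: continuous on `[0, ∞)`, smooth
on `(0, ∞)`, and `(-1)^(n-1) B^(n) ≥ 0` on `(0, ∞)` for `n ≥ 1`. -/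
structure IsBernstein (B : ℝ → ℝ) : Prop where
  nonneg : ∀ u, 0 ≤ u → 0 ≤ B u
  zero : B 0 = 0
  continuousOn : ContinuousOn B (Set.Ici 0)
  contDiffOn : ContDiffOn ℝ ∞ B (Set.Ioi 0)
  deriv_sign : ∀ n : ℕ, ∀ u, 0 < u → 0 ≤ (-1 : ℝ) ^ n * iteratedDeriv (n + 1) B u

/-- The form of `H^0 = B(p²) ⊗ I + I ⊗ H_f + P(φ(x))`. -/
def nelsonForm {d : ℕ} (B : ℝ → ℝ) (disp : Sp d → ℝ) (P : Polynomial ℝ) (g : L2 d ℂ) :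
    SForm (L2 d (Fock d)) :=
  ((momentumForm fun k => B (‖k‖ ^ 2)).sum (freeFieldForm disp)).sum (interactionForm P g)

/-- `D₀`, the algebraic tensor product of `C_0^∞(ℝ^d)` and `fockFin d`. -/
def nelsonCore (d : ℕ) : Submodule ℂ (L2 d (Fock d)) := algTensor (testFunctions d) (fockFin d)

/-- The form of the particle Hamiltonian `h = B(p²) + V` on `L²(ℝ^d)`. -/
def particleForm {d : ℕ} (B : ℝ → ℝ) (V : Sp d → ℝ) : SForm (L2 d ℂ) :=
  (momentumForm fun k => B (‖k‖ ^ 2)).sum (mulForm V)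

end NelsonModel

end

open NelsonModel

noncomputable section

namespace NelsonModel

/-! ### Bernstein functions -/

namespace IsBernstein

variable {B : ℝ → ℝ}

/-! The whole argument rests on one inequality for the symbol. A Bernstein function with `B 0 = 0`
is concave and subadditive, so the parallelogram law gives `B(|p+k|²) + B(|p-k|²) ≤ 2 B(|p|²) + 2
B(|k|²)` (`norm_sq_add_sub_le`). Conjugation by `e^{ik·x}` affects only the kinetic term, where it
shifts `p` by `k`, so integrating this inequality against `|Ψ̂|²` is exactly (H.3).

Closability in (H.1) comes from writing the form as a constant plus a sum of non-negative closable
forms; such sums, even infinite ones, are closable (`qClosable_of_hasSum`). A polynomial bounded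
below is a constant plus two squares, and the form of `p(φ(x))²` is the sum over `n` of the forms
`‖(p(φ)Ψ)^(n)‖²`, each of which is bounded. `H_f` is handled through its square root, and `h ⊗ I`
through the expansion of `Ψ` in an orthonormal basis of Fock space, which turns it into a sum of
copies of `h`. Conversely, on product vectors `f ⊗ Ω` with the vacuum, `H^V` equals `h` plus a
constant multiple of `‖f‖²`, so any closability or lower bound of `H^V` passes to `h`
(`particleForm_of_hypH1`).

For (H.2), the group of the total momentum is translation in `x` combined with the second quantized
phase `e^{ik·P_f}`. Its generator is identified by a core argument: an invariant dense subspace of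
the domain is a core (`genGraph_le_closure`), so the closure of `p_j ⊗ I + I ⊗ P_{f,j}` is the full
generator and is self-adjoint. The field satisfies `e^{ik·P_f} φ(x+k) = φ(x) e^{ik·P_f}`, which
makes the interaction translation invariant.

For the binding inequality, take the trial vectors `e^{iy·P} (f(x-y) Ψ(x))` and average over `y`.
Invariance of `H^0` removes the translation there, whereas the potential becomes `V(x-y)`, attached
to `f(x-y)`. By Fubini the averages of the norm, of `H_f`, of `P(φ(x))` and of `V` factorize; the
kinetic average is `∫∫ B(|p+q|²) |f̂(q)|² |Ψ̂(p)|²` by Plancherel. Adding the same estimate for the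
complex conjugate of `f` replaces `q` by `-q`, and the inequality for `B` closes the argument
(`mul_norm_sq_le_nelsonForm_add_particleForm`). No minimizers are needed. -/

theorem concaveOn (hB : IsBernstein B) : ConcaveOn ℝ (Set.Ici 0) B := by
  have h1 : DifferentiableOn ℝ B (Set.Ioi 0) := hB.contDiffOn.differentiableOn (by simp)
  have h2 : DifferentiableOn ℝ (deriv B) (Set.Ioi 0) :=
    ((contDiffOn_infty_iff_deriv_of_isOpen isOpen_Ioi).1 hB.contDiffOn).2.differentiableOn (by simp)
  refine concaveOn_of_deriv2_nonpos (convex_Ici 0) hB.continuousOn ?_ ?_ ?_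
  · rwa [interior_Ici]
  · rwa [interior_Ici]
  · intro x hx
    rw [interior_Ici] at hx
    have := hB.deriv_sign 1 x hx
    rw [iteratedDeriv_eq_iterate] at this
    simpa using this

theorem combo_le (hB : IsBernstein B) {x y a b : ℝ} (hx : 0 ≤ x) (hy : 0 ≤ y) (ha : 0 ≤ a)
    (hb : 0 ≤ b) (hab : a + b = 1) : a * B x + b * B y ≤ B (a * x + b * y) := by
  simpa using hB.concaveOn.2 hx hy ha hb hab

/-- Concavity together with `B 0 = 0` makes `w ↦ B w / w` nonincreasing, so each of `u` and `v`
carries at least its proportional share of `B (u + v)`. -/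
theorem add_le (hB : IsBernstein B) {u v : ℝ} (hu : 0 ≤ u) (hv : 0 ≤ v) :
    B (u + v) ≤ B u + B v := by
  rcases eq_or_lt_of_le (add_nonneg hu hv) with h | h
  · have h1 : u = 0 := by linarith
    have h2 : v = 0 := by linarith
    simp [h1, h2, hB.zero]
  have key : ∀ w, 0 ≤ w → w ≤ u + v → w / (u + v) * B (u + v) ≤ B w := by
    intro w hw hw'
    have := hB.combo_le (x := u + v) h.le (y := 0) le_rfl (a := w / (u + v))
      (b := 1 - w / (u + v)) (by positivity) (by rw [sub_nonneg, div_le_one h]; exact hw') (by ring)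
    simp only [hB.zero, mul_zero, add_zero] at this
    rwa [div_mul_cancel₀ _ h.ne'] at this
  have h1 := key u hu (by linarith)
  have h2 := key v hv (by linarith)
  have h3 : u / (u + v) * B (u + v) + v / (u + v) * B (u + v) = B (u + v) := by
    field_simp
  linarith

theorem mono_half (hB : IsBernstein B) {u v : ℝ} (hu : 0 ≤ u) (hv : 0 ≤ v) :
    B u + B v ≤ 2 * B ((u + v) / 2) := by
  have := hB.combo_le (x := u) hu (y := v) hv (a := 1 / 2) (b := 1 / 2) (by norm_num)
    (by norm_num) (by norm_num)
  rw [show 1 / 2 * u + 1 / 2 * v = (u + v) / 2 by ring] at this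
  linarith

/-- The mean of `‖p + k‖²` and `‖p - k‖²` is `‖p‖² + ‖k‖²`. Midpoint concavity evaluates `B` at that
mean, and subadditivity splits it. This is the inequality behind (H.3) and the binding estimate. -/
theorem norm_sq_add_sub_le (hB : IsBernstein B) {E : Type*} [NormedAddCommGroup E]
    [InnerProductSpace ℝ E] (p k : E) :
    B (‖p + k‖ ^ 2) + B (‖p - k‖ ^ 2) ≤ 2 * (B (‖p‖ ^ 2) + B (‖k‖ ^ 2)) := by
  have h := hB.mono_half (sq_nonneg ‖p + k‖) (sq_nonneg ‖p - k‖)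
  have h' := parallelogram_law_with_norm ℝ p k
  rw [show (‖p + k‖ ^ 2 + ‖p - k‖ ^ 2) / 2 = ‖p‖ ^ 2 + ‖k‖ ^ 2 by nlinarith] at h
  have := hB.add_le (sq_nonneg ‖p‖) (sq_nonneg ‖k‖)
  linarith

/-- On `[0, 1]` continuity bounds `B` by its maximum; beyond `1`, concavity against the origin gives
`B u ≤ u * B 1`. Linear growth puts test functions in the form domain of `B(p²)`. -/
theorem exists_linear_bound (hB : IsBernstein B) :
    ∃ C : ℝ, 0 ≤ C ∧ ∀ u, 0 ≤ u → B u ≤ C * (1 + u) := by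
  obtain ⟨z, hz, hmax⟩ := isCompact_Icc.exists_isMaxOn (s := Set.Icc (0 : ℝ) 1) ⟨0, by simp⟩
    (hB.continuousOn.mono Set.Icc_subset_Ici_self)
  have hz0 : 0 ≤ B z := hB.nonneg z hz.1
  refine ⟨B z, hz0, fun u hu => ?_⟩
  rcases le_total u 1 with h | h
  · have : B u ≤ B z := hmax (a := u) ⟨hu, h⟩
    nlinarith
  · have := hB.combo_le (x := u) hu (y := 0) le_rfl (a := u⁻¹)
      (b := 1 - u⁻¹) (by positivity) (by rw [sub_nonneg]; exact inv_le_one_of_one_le₀ h) (by ring)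
    simp only [hB.zero, mul_zero, add_zero] at this
    rw [inv_mul_cancel₀ (by positivity)] at this
    have h1 : B 1 ≤ B z := hmax (a := 1) ⟨zero_le_one, le_rfl⟩
    have h2 : B u = u * (u⁻¹ * B u) := by field_simp
    rw [h2]
    nlinarith

theorem continuous_norm_sq (hB : IsBernstein B) {E : Type*} [NormedAddCommGroup E] :
    Continuous fun k : E => B (‖k‖ ^ 2) :=
  hB.continuousOn.comp_continuous (by fun_prop) fun k => sq_nonneg ‖k‖

end IsBernstein

/-! ### Non-negative real polynomials are sums of two squares -/

/-- Strong induction on the degree: split off a quadratic factor that is itself a sum of two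
squares, with non-negative cofactor. Sums of two squares are closed under products. -/
theorem exists_sq_add_sq (n : ℕ) : ∀ p : Polynomial ℝ, p.natDegree ≤ n → (∀ t, 0 ≤ p.eval t) →
    ∃ q r : Polynomial ℝ, p = q ^ 2 + r ^ 2 := by
  induction n using Nat.strong_induction_on with
  | _ n ih =>
  intro p hpn hp
  by_cases hd : p.natDegree = 0
  · obtain ⟨c, rfl⟩ := Polynomial.natDegree_eq_zero.1 hd
    have hc : 0 ≤ c := by simpa using hp 0
    refine ⟨Polynomial.C √c, 0, ?_⟩
    rw [← Polynomial.C_pow, Real.sq_sqrt hc]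
    simp
  have hp0 : p ≠ 0 := fun h => hd (by simp [h])
  -- a nonnegative quadratic factor `m = q₁² + r₁²` with cofactor nonnegative
  suffices h : ∃ m s q₁ r₁ : Polynomial ℝ, p = m * s ∧ m = q₁ ^ 2 + r₁ ^ 2 ∧ 0 < m.natDegree ∧
      ∀ t, 0 ≤ s.eval t by
    obtain ⟨m, s, q₁, r₁, hms, hm, hdeg, hs⟩ := h
    have hm0 : m ≠ 0 := fun h => hp0 (by simp [hms, h])
    have hs0 : s ≠ 0 := fun h => hp0 (by simp [hms, h])
    have hdd : p.natDegree = m.natDegree + s.natDegree := by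
      rw [hms, Polynomial.natDegree_mul hm0 hs0]
    obtain ⟨q, r, hqr⟩ := ih s.natDegree (by omega) s le_rfl hs
    -- The Brahmagupta–Fibonacci identity.
    exact ⟨q₁ * q - r₁ * r, q₁ * r + r₁ * q, by rw [hms, hm, hqr]; ring⟩
  -- Dividing by `(t - a)²` gives the sign of the cofactor only for `t ≠ a`; continuity supplies the
  -- missing point.
  have hdense : ∀ (a : ℝ) (s : Polynomial ℝ), (∀ t, t ≠ a → 0 ≤ s.eval t) → ∀ t, 0 ≤ s.eval t := by
    intro a s h t
    have hc : IsClosed {t | 0 ≤ s.eval t} := isClosed_le continuous_const s.continuous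
    have : closure ({a}ᶜ : Set ℝ) ⊆ {t | 0 ≤ s.eval t} := hc.closure_subset_iff.2 fun t ht => h t ht
    exact this ((dense_compl_singleton a) t)
  by_cases hr : ∃ a, p.IsRoot a
  · obtain ⟨a, ha⟩ := hr
    obtain ⟨p₁, hp₁⟩ := Polynomial.dvd_iff_isRoot.2 ha
    -- A real root of a non-negative polynomial has even multiplicity: the quotient by `t - a` is
    -- non-negative to the right of `a` and non-positive to the left, hence vanishes at `a`.
    have h1 : p₁.IsRoot a := by
      have e : ∀ t, p.eval t = (t - a) * p₁.eval t := fun t => by rw [hp₁]; simp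
      have hge : 0 ≤ p₁.eval a := by
        refine ge_of_tendsto (p₁.continuous.continuousWithinAt (s := Set.Ioi a) (x := a)) ?_
        filter_upwards [self_mem_nhdsWithin] with t ht
        have := hp t
        rw [e] at this
        exact nonneg_of_mul_nonneg_right this (sub_pos.2 ht)
      have hle : p₁.eval a ≤ 0 := by
        refine le_of_tendsto (p₁.continuous.continuousWithinAt (s := Set.Iio a) (x := a)) ?_
        filter_upwards [self_mem_nhdsWithin] with t ht
        have := hp t
        rw [e] at this
        have ht' : t - a < 0 := sub_neg.2 ht
        by_contra hcon
        push Not at hcon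
        nlinarith
      exact le_antisymm hle hge
    obtain ⟨s, hs⟩ := Polynomial.dvd_iff_isRoot.2 h1
    refine ⟨(Polynomial.X - Polynomial.C a) ^ 2, s, Polynomial.X - Polynomial.C a, 0,
      by rw [hp₁, hs]; ring, by ring, by rw [Polynomial.natDegree_pow]; simp, ?_⟩
    refine hdense a s fun t ht => ?_
    have := hp t
    rw [hp₁, hs] at this
    simp only [Polynomial.eval_mul, Polynomial.eval_sub, Polynomial.eval_X, Polynomial.eval_C] at this
    have ht' : 0 < (t - a) * (t - a) := mul_self_pos.2 (sub_ne_zero.2 ht)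
    rw [← mul_assoc] at this
    exact nonneg_of_mul_nonneg_right this ht'
  · push Not at hr
    have hdeg : 0 < (p.map (algebraMap ℝ ℂ)).degree := by
      rw [Polynomial.degree_map]
      exact Polynomial.natDegree_pos_iff_degree_pos.1 (Nat.pos_of_ne_zero hd)
    obtain ⟨z, hz⟩ := Complex.exists_root hdeg
    have hz' : Polynomial.aeval z p = 0 := by
      rw [Polynomial.aeval_def, ← Polynomial.eval_map]
      exact hz
    have him : z.im ≠ 0 := by
      intro h0
      have hzr : z = ((z.re : ℝ) : ℂ) := Complex.ext (by simp) (by simp [h0])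
      apply hr z.re
      rw [hzr, show ((z.re : ℝ) : ℂ) = algebraMap ℝ ℂ z.re from rfl,
        Polynomial.aeval_algebraMap_apply] at hz'
      simpa using hz'
    -- The root and its conjugate together give the real quadratic factor `(X - re z)² + (im z)²`.
    obtain ⟨s, hs⟩ := Polynomial.quadratic_dvd_of_aeval_eq_zero_im_ne_zero p hz' him
    have hmeq : Polynomial.X ^ 2 - Polynomial.C (2 * z.re) * Polynomial.X + Polynomial.C (‖z‖ ^ 2)
        = (Polynomial.X - Polynomial.C z.re) ^ 2 + (Polynomial.C z.im) ^ 2 := by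
      rw [Complex.sq_norm, Complex.normSq_apply]
      simp only [map_add, map_mul]
      rw [show (Polynomial.C 2 : Polynomial ℝ) = 2 from rfl]
      ring
    refine ⟨_, s, Polynomial.X - Polynomial.C z.re, Polynomial.C z.im, hs, hmeq, ?_, ?_⟩
    · rw [hmeq]
      have h1 : ((Polynomial.X - Polynomial.C z.re) ^ 2 + (Polynomial.C z.im) ^ 2 :
        Polynomial ℝ).natDegree = 2 := by
        rw [← Polynomial.C_pow, Polynomial.natDegree_add_C, Polynomial.natDegree_pow]
        simp
      omega
    · intro t
      have := hp t
      rw [hs, hmeq] at this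
      simp only [Polynomial.eval_mul, Polynomial.eval_add, Polynomial.eval_pow,
        Polynomial.eval_sub, Polynomial.eval_X, Polynomial.eval_C] at this
      exact nonneg_of_mul_nonneg_right this (by positivity)

theorem exists_eq_C_add_sq_add_sq (P : Polynomial ℝ) (c : ℝ) (hc : ∀ t : ℝ, c ≤ P.eval t) :
    ∃ q r : Polynomial ℝ, P = Polynomial.C c + (q ^ 2 + r ^ 2) := by
  obtain ⟨q, r, h⟩ := exists_sq_add_sq _ (P - Polynomial.C c) le_rfl (by simpa using hc)
  exact ⟨q, r, by rw [← h]; ring⟩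

/-! ### Closability of sums of quadratic forms -/

section QClosable

variable {H : Type*} [NormedAddCommGroup H] [InnerProductSpace ℂ H]

/-- Closability of a real quadratic form on `D`. -/
def QClosable (D : Submodule ℂ H) (q : H → ℝ) : Prop :=
  ∀ Ψ : ℕ → H, (∀ n, Ψ n ∈ D) → Tendsto Ψ atTop (𝓝 0) →
    Tendsto (fun m : ℕ × ℕ => q (Ψ m.1 - Ψ m.2)) atTop (𝓝 0) →
    Tendsto (fun n => q (Ψ n)) atTop (𝓝 0)

theorem tendsto_sub_pair {H : Type*} [NormedAddCommGroup H] {Ψ : ℕ → H} (h : Tendsto Ψ atTop (𝓝 0)) :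
    Tendsto (fun m : ℕ × ℕ => Ψ m.1 - Ψ m.2) atTop (𝓝 0) := by
  rw [← prod_atTop_atTop_eq]
  simpa using (h.comp tendsto_fst).sub (h.comp tendsto_snd)

/-- Along a null sequence the terms `c * ‖Ψ‖ ^ 2` tend to zero, so a shift by a constant is
invisible to closability. This also replaces complex form values by a real quadratic form. -/
theorem SForm.closableOn_iff {q : SForm H} {D : Submodule ℂ H} {r : H → ℝ} {c : ℝ}
    (h : ∀ Ψ ∈ D, q.val Ψ Ψ = ((r Ψ + c * ‖Ψ‖ ^ 2 : ℝ) : ℂ)) :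
    q.ClosableOn D ↔ QClosable D r := by
  refine forall_congr' fun Ψ => forall_congr' fun hΨ => forall_congr' fun h0 => ?_
  have e1 : Tendsto (fun m : ℕ × ℕ => c * ‖Ψ m.1 - Ψ m.2‖ ^ 2) atTop (𝓝 0) := by
    have := (((tendsto_sub_pair h0).norm).pow 2).const_mul c
    simpa using this
  have e2 : Tendsto (fun m : ℕ => c * ‖Ψ m‖ ^ 2) atTop (𝓝 0) := by
    have := ((h0.norm).pow 2).const_mul c
    simpa using this
  have f1 : (fun m : ℕ × ℕ => q.val (Ψ m.1 - Ψ m.2) (Ψ m.1 - Ψ m.2)) =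
      fun m => ((r (Ψ m.1 - Ψ m.2) + c * ‖Ψ m.1 - Ψ m.2‖ ^ 2 : ℝ) : ℂ) :=
    funext fun m => h _ (D.sub_mem (hΨ _) (hΨ _))
  have f2 : (fun m => q.val (Ψ m) (Ψ m)) = fun m => ((r (Ψ m) + c * ‖Ψ m‖ ^ 2 : ℝ) : ℂ) :=
    funext fun m => h _ (hΨ _)
  rw [f1, f2]
  have key : ∀ {ι : Type} {l : Filter ι} (a b : ι → ℝ), Tendsto b l (𝓝 0) →
      (Tendsto (fun i => ((a i + b i : ℝ) : ℂ)) l (𝓝 0) ↔ Tendsto a l (𝓝 0)) := by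
    intro ι l a b hb
    rw [← Complex.ofReal_zero, tendsto_ofReal_iff]
    constructor
    · intro h
      simpa using h.sub hb
    · intro h
      simpa using h.add hb
  rw [key _ _ e1, key _ _ e2]

/-- Each summand is dominated by the total, hence tends to zero along the sequence; a Fatou type
argument on finite partial sums then controls the total. `hpar` stands in for the triangle
inequality of `√(qe e)`. -/
theorem qClosable_of_hasSum {ι : Type*} {D : Submodule ℂ H} {q : H → ℝ} {qe : ι → H → ℝ}
    (hsum : ∀ Ψ ∈ D, HasSum (fun e => qe e Ψ) (q Ψ)) (hnn : ∀ e, ∀ Ψ ∈ D, 0 ≤ qe e Ψ)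
    (hpar : ∀ e, ∀ u ∈ D, ∀ v ∈ D, qe e u ≤ 2 * qe e (u - v) + 2 * qe e v)
    (hcl : ∀ e, QClosable D (qe e)) : QClosable D q := by
  intro Ψ hΨ h0 hC
  have hq : ∀ u ∈ D, 0 ≤ q u := fun u hu => (hsum u hu).nonneg fun e => hnn e u hu
  have hle : ∀ e, ∀ u ∈ D, qe e u ≤ q u := fun e u hu =>
    le_hasSum (hsum u hu) e fun e' _ => hnn e' u hu
  have he : ∀ e, Tendsto (fun n => qe e (Ψ n)) atTop (𝓝 0) := fun e =>
    hcl e Ψ hΨ h0 (squeeze_zero (fun m => hnn e _ (D.sub_mem (hΨ _) (hΨ _)))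
      (fun m => hle e _ (D.sub_mem (hΨ _) (hΨ _))) hC)
  rw [Metric.tendsto_atTop]
  intro ε hε
  rw [Metric.tendsto_atTop] at hC
  obtain ⟨⟨N₁, N₂⟩, hN⟩ := hC (ε / 4) (by positivity)
  refine ⟨max N₁ N₂, fun n hn => ?_⟩
  rw [Real.dist_0_eq_abs, abs_of_nonneg (hq _ (hΨ n))]
  have hfin : q (Ψ n) ≤ ε / 2 := by
    refine hasSum_le_of_sum_le (hsum _ (hΨ n)) fun s => ?_
    -- With `n` and the finite set `s` fixed, let `m → ∞`: the terms at `Ψ m` disappear, and only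
    -- twice the energy of `Ψ n - Ψ m`, at most `ε / 4`, remains.
    have hlim : Tendsto (fun m => 2 * (ε / 4) + 2 * ∑ e ∈ s, qe e (Ψ m)) atTop
        (𝓝 (2 * (ε / 4) + 2 * ∑ e ∈ s, 0)) :=
      (((tendsto_finsetSum s fun e _ => he e).const_mul 2).const_add _)
    have : ∑ e ∈ s, qe e (Ψ n) ≤ 2 * (ε / 4) + 2 * ∑ e ∈ s, (0 : ℝ) := by
      refine ge_of_tendsto hlim ?_
      filter_upwards [eventually_ge_atTop (max N₁ N₂)] with m hm
      have h1 := hN (n, m) ⟨(le_max_left _ _).trans hn, (le_max_right _ _).trans hm⟩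
      have hD := D.sub_mem (hΨ n) (hΨ m)
      rw [Real.dist_0_eq_abs, abs_of_nonneg (hq _ hD)] at h1
      have h2 : ∑ e ∈ s, qe e (Ψ n - Ψ m) ≤ q (Ψ n - Ψ m) :=
        sum_le_hasSum s (fun e _ => hnn e _ hD) (hsum _ hD)
      calc ∑ e ∈ s, qe e (Ψ n) ≤ ∑ e ∈ s, (2 * qe e (Ψ n - Ψ m) + 2 * qe e (Ψ m)) :=
            Finset.sum_le_sum fun e _ => hpar e _ (hΨ n) _ (hΨ m)
        _ = 2 * ∑ e ∈ s, qe e (Ψ n - Ψ m) + 2 * ∑ e ∈ s, qe e (Ψ m) := by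
            rw [Finset.sum_add_distrib, Finset.mul_sum, Finset.mul_sum]
        _ ≤ _ := by linarith
    simpa [show (2 : ℝ) * (ε / 4) = ε / 2 by ring] using this
  linarith

end QClosable

/-! ### One-parameter unitary groups and their generators -/

section Groups

variable {H : Type*} [NormedAddCommGroup H] [InnerProductSpace ℂ H]

/-- A strongly continuous one-parameter unitary group. -/
structure IsUnitaryGroup (U : ℝ → (H ≃ₗᵢ[ℂ] H)) : Prop where
  map_zero : ∀ Ψ, U 0 Ψ = Ψ
  map_add : ∀ s t Ψ, U (s + t) Ψ = U s (U t Ψ)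
  continuous : ∀ Ψ, Continuous fun t => U t Ψ

/-- `Φ = G Ψ`, where `U t = exp(i t G)`. -/
def GenRel (U : ℝ → (H ≃ₗᵢ[ℂ] H)) (Ψ Φ : H) : Prop :=
  HasDerivAt (fun t => U t Ψ) (Complex.I • Φ) 0

/-- The two normalizations of the difference quotient differ by the factor `-i`; this connects
`GenRel` with the generator clause of `IsExpI`. -/
theorem IsUnitaryGroup.genRel_iff {U : ℝ → (H ≃ₗᵢ[ℂ] H)} (hU : IsUnitaryGroup U) (Ψ Φ : H) :
    GenRel U Ψ Φ ↔ Tendsto (fun t : ℝ => (Complex.I * (t : ℂ))⁻¹ • (U t Ψ - Ψ)) (𝓝[≠] 0) (𝓝 Φ) := by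
  rw [GenRel, hasDerivAt_iff_tendsto_slope_zero]
  simp only [zero_add, hU.map_zero]
  have e : ∀ t : ℝ, (Complex.I * (t : ℂ))⁻¹ • (U t Ψ - Ψ) =
      (-Complex.I) • (t⁻¹ • (U t Ψ - Ψ)) := by
    intro t
    rw [mul_inv, Complex.inv_I, mul_smul, ← Complex.ofReal_inv, Complex.coe_smul]
  simp only [e]
  constructor
  · intro h
    have := h.const_smul (-Complex.I)
    rwa [smul_smul, neg_mul, Complex.I_mul_I, neg_neg, one_smul] at this
  · intro h
    have := h.const_smul Complex.I
    simpa [smul_smul] using this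

/-- The graph of the generator. -/
def genGraph (U : ℝ → (H ≃ₗᵢ[ℂ] H)) : Submodule ℂ (H × H) where
  carrier := {x | GenRel U x.1 x.2}
  zero_mem' := by
    simp only [Set.mem_ofPred_eq, GenRel, Prod.fst_zero, _root_.map_zero, Prod.snd_zero, smul_zero]
    exact hasDerivAt_const _ _
  add_mem' := by
    intro x y hx hy
    simp only [Set.mem_ofPred_eq, GenRel, Prod.fst_add, _root_.map_add, Prod.snd_add, smul_add]
    exact hx.add hy
  smul_mem' := by
    intro c x hx
    simp only [Set.mem_ofPred_eq, GenRel, Prod.smul_fst, _root_.map_smul, Prod.smul_snd]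
    rw [smul_comm]
    exact hx.const_smul c

theorem mem_genGraph {U : ℝ → (H ≃ₗᵢ[ℂ] H)} {Ψ Φ : H} : (Ψ, Φ) ∈ genGraph U ↔ GenRel U Ψ Φ :=
  Iff.rfl

theorem hasDerivAt_inner {f g : ℝ → H} {f' g' : H} {t : ℝ} (hf : HasDerivAt f f' t)
    (hg : HasDerivAt g g' t) :
    HasDerivAt (fun t => ⟪f t, g t⟫_ℂ) (⟪f t, g'⟫_ℂ + ⟪f', g t⟫_ℂ) t :=
  HasDerivAt.inner ℂ hf hg

namespace IsUnitaryGroup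

variable {U : ℝ → (H ≃ₗᵢ[ℂ] H)}

theorem neg_apply (hU : IsUnitaryGroup U) (t : ℝ) (Ψ : H) : U (-t) Ψ = (U t).symm Ψ := by
  rw [LinearIsometryEquiv.eq_symm_apply, ← hU.map_add, add_neg_cancel, hU.map_zero]

theorem inner_neg (hU : IsUnitaryGroup U) (t : ℝ) (Ψ Φ : H) :
    ⟪Ψ, U (-t) Φ⟫_ℂ = ⟪U t Ψ, Φ⟫_ℂ := by
  rw [← (U t).inner_map_map Ψ, hU.neg_apply, LinearIsometryEquiv.apply_symm_apply]

theorem hasDerivAt (hU : IsUnitaryGroup U) {Ψ Φ : H} (h : GenRel U Ψ Φ) (t : ℝ) :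
    HasDerivAt (fun s => U s Ψ) (Complex.I • U t Φ) t := by
  have e : (fun s => U s Ψ) = fun s => U t (U (s - t) Ψ) := by
    funext s
    rw [← hU.map_add, add_sub_cancel]
  have h1 : HasDerivAt (fun s => U (s - t) Ψ) (Complex.I • Φ) t := by
    have h0 : HasDerivAt (fun t => U t Ψ) (Complex.I • Φ) (t - t) := by rw [sub_self]; exact h
    exact HasDerivAt.comp_sub_const t t h0
  have h2 := ((U t).toContinuousLinearEquiv : H →L[ℂ] H).restrictScalars ℝ |>.hasFDerivAt
    |>.comp_hasDerivAt t h1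
  rw [e]
  refine h2.congr_deriv ?_
  change U t (Complex.I • Φ) = _
  rw [_root_.map_smul]

theorem genRel_apply (hU : IsUnitaryGroup U) {Ψ Φ : H} (h : GenRel U Ψ Φ) (t : ℝ) :
    GenRel U (U t Ψ) (U t Φ) := by
  have h1 := hU.hasDerivAt h t
  have e : (fun s => U s (U t Ψ)) = fun s => U (s + t) Ψ := by
    funext s
    rw [← hU.map_add]
  rw [GenRel, e]
  refine HasDerivAt.comp_add_const (f := fun s => U s Ψ) 0 t ?_
  rwa [zero_add]

/-- By unitarity `⟪U t Ψ, U t Ψ'⟫` does not depend on `t`; its derivative at `0` is the asserted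
symmetry times `i`. -/
theorem symm (hU : IsUnitaryGroup U) {Ψ Φ Ψ' Φ' : H} (h : GenRel U Ψ Φ) (h' : GenRel U Ψ' Φ') :
    ⟪Φ, Ψ'⟫_ℂ = ⟪Ψ, Φ'⟫_ℂ := by
  have h1 := hasDerivAt_inner h h'
  simp only [LinearIsometryEquiv.inner_map_map, hU.map_zero] at h1
  have h2 := h1.unique (hasDerivAt_const _ _)
  rw [inner_smul_left, inner_smul_right, Complex.conj_I] at h2
  have h3 : Complex.I * (⟪Ψ, Φ'⟫_ℂ - ⟪Φ, Ψ'⟫_ℂ) = 0 := by linear_combination h2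
  rcases mul_eq_zero.1 h3 with h4 | h4
  · exact absurd h4 Complex.I_ne_zero
  · exact (sub_eq_zero.1 h4).symm

/-- A pair in the adjoint of the restriction of the generator to an invariant dense subspace lies
in the graph of the generator. -/
theorem genRel_of_weak [CompleteSpace H] (hU : IsUnitaryGroup U) {D : Set H} (hD : Dense D)
    (hinv : ∀ t, ∀ ψ ∈ D, U t ψ ∈ D) (hdiff : ∀ ψ ∈ D, ∃ φ, GenRel U ψ φ) {χ η : H}
    (h : ∀ ψ ∈ D, ∀ φ, GenRel U ψ φ → ⟪η, ψ⟫_ℂ = ⟪χ, φ⟫_ℂ) : GenRel U χ η := by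
  -- `R` is the curve that `U t χ` must be if its derivative is `i U t η`. Against `ψ ∈ D`, both `⟪U
  -- t χ, ψ⟫ = ⟪χ, U (-t) ψ⟫` and `⟪R t, ψ⟫` have derivative `⟪i U t η, ψ⟫` (here invariance of `D`
  -- lets the weak relation be applied to `U (-t) ψ`), and they agree at `t = 0`.
  set R : ℝ → H := fun t => χ + ∫ s in (0 : ℝ)..t, Complex.I • U s η with hR
  have hcont : Continuous fun s => Complex.I • U s η := (hU.continuous η).const_smul Complex.I
  have hRd : ∀ t, HasDerivAt R (Complex.I • U t η) t := fun t =>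
    (hcont.integral_hasStrictDerivAt 0 t).hasDerivAt.const_add χ
  have hUR : ∀ t, U t χ = R t := by
    intro t
    refine hD.eq_of_inner_left ℂ fun ψ hψ => ?_
    obtain ⟨φ, hφ⟩ := hdiff ψ hψ
    have d1 : ∀ t, HasDerivAt (fun t => ⟪χ, U (-t) ψ⟫_ℂ) ⟪Complex.I • U t η, ψ⟫_ℂ t := by
      intro t
      have a : HasDerivAt (fun t => U (-t) ψ) (-(Complex.I • U (-t) φ)) t := by
        exact (HasDerivAt.scomp t (hU.hasDerivAt hφ (-t)) (hasDerivAt_neg t)).congr_deriv (by simp)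
      refine (hasDerivAt_inner (hasDerivAt_const t χ) a).congr_deriv ?_
      rw [inner_zero_left, add_zero, inner_neg_right, inner_smul_right,
        ← h (U (-t) ψ) (hinv _ ψ hψ) (U (-t) φ) (hU.genRel_apply hφ _), hU.inner_neg,
        inner_smul_left, Complex.conj_I]
      ring
    have d2 : ∀ t, HasDerivAt (fun t => ⟪R t, ψ⟫_ℂ) ⟪Complex.I • U t η, ψ⟫_ℂ t := by
      intro t
      refine (hasDerivAt_inner (hRd t) (hasDerivAt_const t ψ)).congr_deriv ?_
      rw [inner_zero_right, zero_add]
    have d3 : ∀ t, HasDerivAt (fun t => ⟪χ, U (-t) ψ⟫_ℂ - ⟪R t, ψ⟫_ℂ) 0 t := fun t =>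
      ((d1 t).sub (d2 t)).congr_deriv (sub_self _)
    have hc := is_const_of_deriv_eq_zero (fun t => (d3 t).differentiableAt)
      (fun t => (d3 t).deriv) t 0
    have h0 : R 0 = χ := by simp [hR]
    rw [neg_zero, hU.map_zero, h0, sub_self, hU.inner_neg] at hc
    exact sub_eq_zero.1 hc
  rw [GenRel, funext hUR]
  simpa [hU.map_zero] using hRd 0

/-- A limit of points of the graph still satisfies the weak relation against `D`, which is a closed
condition, and `genRel_of_weak` returns it to the graph. -/
theorem isClosed_genGraph [CompleteSpace H] (hU : IsUnitaryGroup U) {D : Set H} (hD : Dense D)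
    (hinv : ∀ t, ∀ ψ ∈ D, U t ψ ∈ D) (hdiff : ∀ ψ ∈ D, ∃ φ, GenRel U ψ φ) :
    IsClosed (genGraph U : Set (H × H)) := by
  refine isClosed_of_closure_subset fun x hx => ?_
  refine hU.genRel_of_weak hD hinv hdiff fun ψ hψ φ hφ => ?_
  have hc : IsClosed {y : H × H | ⟪y.2, ψ⟫_ℂ = ⟪y.1, φ⟫_ℂ} :=
    isClosed_eq (by fun_prop) (by fun_prop)
  exact (hc.closure_subset_iff.2 (fun y hy => hU.symm hy hφ)) hx

/-- Symmetry gives `A ≤ A†`. Conversely, a pair in the graph of the adjoint satisfies the weak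
relation against `D`, so it lies in the graph of the generator. -/
theorem isSelfAdjoint [CompleteSpace H] (hU : IsUnitaryGroup U) {D : Set H} (hD : Dense D)
    (hinv : ∀ t, ∀ ψ ∈ D, U t ψ ∈ D) (hdiff : ∀ ψ ∈ D, ∃ φ, GenRel U ψ φ)
    {A : H →ₗ.[ℂ] H} (hA : A.graph = genGraph U) : IsSelfAdjoint A := by
  have hrel : ∀ x : A.domain, GenRel U (x : H) (A x) := fun x => by
    rw [← mem_genGraph, ← hA]
    exact A.mem_graph x
  have hdense : Dense (A.domain : Set H) := by
    refine hD.mono fun ψ hψ => ?_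
    obtain ⟨φ, hφ⟩ := hdiff ψ hψ
    rw [← mem_genGraph, ← hA] at hφ
    exact LinearPMap.mem_domain_of_mem_graph hφ
  rw [LinearPMap.isSelfAdjoint_def]
  refine le_antisymm ?_ ?_
  · rw [← LinearPMap.le_graph_iff]
    rintro ⟨χ, η⟩ hx
    rw [hA]
    refine hU.genRel_of_weak hD hinv hdiff fun ψ hψ φ hφ => ?_
    rw [← mem_genGraph, ← hA] at hφ
    obtain ⟨x, hx1, hx2⟩ := (LinearPMap.mem_graph_iff _).1 hx
    obtain ⟨y, hy1, hy2⟩ := (LinearPMap.mem_graph_iff _).1 hφ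
    simp only at hx1 hx2 hy1 hy2
    rw [← hx1, ← hx2, ← hy1, ← hy2]
    exact LinearPMap.adjoint_isFormalAdjoint hdense x y
  · refine LinearPMap.IsFormalAdjoint.le_adjoint hdense fun x y => ?_
    exact hU.symm (hrel x) (hrel y)

/-- A symmetric extension of the generator is the generator. -/
theorem graph_eq_of_symm [CompleteSpace H] (hU : IsUnitaryGroup U) {D : Set H} (hD : Dense D)
    (hinv : ∀ t, ∀ ψ ∈ D, U t ψ ∈ D) (hdiff : ∀ ψ ∈ D, ∃ φ, GenRel U ψ φ)
    {A : Submodule ℂ (H × H)} (hsymm : ∀ x ∈ A, ∀ y ∈ A, ⟪x.2, y.1⟫_ℂ = ⟪x.1, y.2⟫_ℂ)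
    (hle : genGraph U ≤ A) : A = genGraph U := by
  refine le_antisymm (fun x hx => ?_) hle
  exact hU.genRel_of_weak hD hinv hdiff fun ψ hψ φ hφ => hsymm x hx (ψ, φ) (hle hφ)

/-- An invariant dense subspace of the domain is a core of the generator. -/
theorem genGraph_le_closure [CompleteSpace H] (hU : IsUnitaryGroup U) {D : Set H} (hD : Dense D)
    (hinv : ∀ t, ∀ ψ ∈ D, U t ψ ∈ D) (hdiff : ∀ ψ ∈ D, ∃ φ, GenRel U ψ φ)
    {S : Submodule ℂ (H × H)} (hS : ∀ ψ ∈ D, ∀ φ, GenRel U ψ φ → (ψ, φ) ∈ S)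
    (hSle : S ≤ genGraph U) : (genGraph U : Set (H × H)) ⊆ closure S := by
  -- The `ℓ²` norm makes the product a Hilbert space, so that a point of the graph can be projected
  -- orthogonally onto the closure of `S`; the remainder `z` is shown to vanish.
  set e := WithLp.prodContinuousLinearEquiv 2 ℂ H H
  set S' : Submodule ℂ (WithLp 2 (H × H)) := S.comap e.toLinearMap with hS'
  set T := S'.topologicalClosure with hT
  have : CompleteSpace T := (Submodule.isClosed_topologicalClosure S').completeSpace_coe
  have hTcl : ∀ x ∈ T, e x ∈ closure (S : Set (H × H)) := by
    intro x hx
    have hx' : x ∈ closure (S' : Set (WithLp 2 (H × H))) := hx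
    have := image_closure_subset_closure_image e.continuous (Set.mem_image_of_mem e hx')
    refine closure_mono ?_ this
    rintro _ ⟨y, hy, rfl⟩
    exact hy
  have hTG : ∀ x ∈ T, e x ∈ genGraph U := fun x hx =>
    ((hU.isClosed_genGraph hD hinv hdiff).closure_subset_iff.2 hSle) (hTcl x hx)
  intro x hx
  set x' : WithLp 2 (H × H) := e.symm x with hx'
  have hex : e x' = x := e.apply_symm_apply x
  obtain ⟨y, hy, z, hz, hyz⟩ := T.exists_add_mem_mem_orthogonal x'
  have hzG : e z ∈ genGraph U := by
    have : e z = x - e y := by rw [← hex, hyz, _root_.map_add, add_sub_cancel_left]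
    rw [this]
    exact Submodule.sub_mem _ hx (hTG y hy)
  -- Write `z = (a, b)` with `b = G a`. Orthogonality to all `(ψ, G ψ)` with `ψ ∈ D` says weakly
  -- that `G b = -a`; symmetry of `G` then yields `-‖a‖² = ‖b‖²`, so both vanish.
  have hrel : GenRel U (e z).2 (-(e z).1) := by
    refine hU.genRel_of_weak hD hinv hdiff fun ψ hψ φ hφ => ?_
    have hmem : e.symm (ψ, φ) ∈ T := by
      refine Submodule.le_topologicalClosure S' ?_
      change e (e.symm (ψ, φ)) ∈ S
      rw [e.apply_symm_apply]
      exact hS ψ hψ φ hφ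
    have h0 := Submodule.inner_left_of_mem_orthogonal hmem hz
    rw [WithLp.prod_inner_apply] at h0
    have h0' : ⟪(e z).1, ψ⟫_ℂ + ⟪(e z).2, φ⟫_ℂ = 0 := h0
    rw [inner_neg_left]
    linear_combination -h0'
  have hs := hU.symm hrel hzG
  simp only [inner_neg_left, inner_self_eq_norm_sq_to_K] at hs
  have hs' : ‖(e z).2‖ ^ 2 + ‖(e z).1‖ ^ 2 = 0 := by
    have : (((‖(e z).2‖ ^ 2 + ‖(e z).1‖ ^ 2 : ℝ)) : ℂ) = 0 := by
      push_cast
      simp only [Complex.coe_algebraMap] at hs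
      linear_combination -hs
    exact_mod_cast this
  have h1 : (e z).1 = 0 := by
    have : ‖(e z).1‖ ^ 2 = 0 := by nlinarith [sq_nonneg ‖(e z).1‖, sq_nonneg ‖(e z).2‖]
    simpa using this
  have h2 : (e z).2 = 0 := by
    have : ‖(e z).2‖ ^ 2 = 0 := by nlinarith [sq_nonneg ‖(e z).1‖, sq_nonneg ‖(e z).2‖]
    simpa using this
  have hz0 : e z = 0 := Prod.ext h1 h2
  rw [← hex, hyz, _root_.map_add, hz0, add_zero]
  exact hTcl y hy

/-- For `ψ`, `ψ'` in the common domain, `⟪U t ψ, U' t ψ'⟫` has zero derivative by symmetry of the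
generator, so `U' (-t) (U t ψ) = ψ`; density extends this. -/
theorem eq_of_genRel_iff {U' : ℝ → (H ≃ₗᵢ[ℂ] H)} (hU : IsUnitaryGroup U) (hU' : IsUnitaryGroup U')
    (h : ∀ Ψ Φ, GenRel U Ψ Φ ↔ GenRel U' Ψ Φ) (hd : Dense {Ψ | ∃ Φ, GenRel U Ψ Φ}) (t : ℝ) (Ψ : H) :
    U t Ψ = U' t Ψ := by
  have key : ∀ ψ φ ψ' φ', GenRel U ψ φ → GenRel U ψ' φ' → ∀ t, ⟪U t ψ, U' t ψ'⟫_ℂ = ⟪ψ, ψ'⟫_ℂ := by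
    intro ψ φ ψ' φ' h1 h2 t
    have d : ∀ t, HasDerivAt (fun t => ⟪U t ψ, U' t ψ'⟫_ℂ) 0 t := by
      intro t
      refine (hasDerivAt_inner (hU.hasDerivAt h1 t)
        (hU'.hasDerivAt ((h _ _).1 h2) t)).congr_deriv ?_
      have hs := hU.symm (hU.genRel_apply h1 t) ((h _ _).2 (hU'.genRel_apply ((h _ _).1 h2) t))
      rw [inner_smul_left, inner_smul_right, hs, Complex.conj_I]
      ring
    have := is_const_of_deriv_eq_zero (fun t => (d t).differentiableAt) (fun t => (d t).deriv) t 0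
    simpa [hU.map_zero, hU'.map_zero] using this
  have hdom : ∀ ψ ∈ {Ψ | ∃ Φ, GenRel U Ψ Φ}, U t ψ = U' t ψ := by
    rintro ψ ⟨φ, hφ⟩
    have e : U' (-t) (U t ψ) = ψ := by
      refine hd.eq_of_inner_left ℂ fun ψ' hψ' => ?_
      obtain ⟨φ', hφ'⟩ := hψ'
      rw [← inner_conj_symm, hU'.inner_neg, inner_conj_symm, key _ _ _ _ hφ hφ' t]
    rw [hU'.neg_apply] at e
    rw [← e, LinearIsometryEquiv.apply_symm_apply, e]
  have := Continuous.ext_on hd (U t).continuous (U' t).continuous hdom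
  exact congrFun this Ψ

end IsUnitaryGroup

/-! ### Vectors of commuting self-adjoint operators -/

variable {d : ℕ}

/-- A strongly continuous unitary representation of `ℝ^d`. -/
structure IsUnitaryRep (W : EuclideanSpace ℝ (Fin d) → (H ≃ₗᵢ[ℂ] H)) : Prop where
  map_zero : ∀ Ψ, W 0 Ψ = Ψ
  map_add : ∀ k l Ψ, W (k + l) Ψ = W k (W l Ψ)
  continuous : ∀ Ψ, Continuous fun k => W k Ψ

/-- The restriction of a representation of `ℝ^d` to the `j`-th coordinate axis. -/
def axis (W : EuclideanSpace ℝ (Fin d) → (H ≃ₗᵢ[ℂ] H)) (j : Fin d) (t : ℝ) : H ≃ₗᵢ[ℂ] H :=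
  W (t • EuclideanSpace.single j (1 : ℝ))

theorem IsUnitaryRep.axis {W : EuclideanSpace ℝ (Fin d) → (H ≃ₗᵢ[ℂ] H)} (hW : IsUnitaryRep W)
    (j : Fin d) : IsUnitaryGroup (axis W j) where
  map_zero Ψ := by rw [NelsonModel.axis, zero_smul, hW.map_zero]
  map_add s t Ψ := by simp only [NelsonModel.axis, add_smul, hW.map_add]
  continuous Ψ := (hW.continuous Ψ).comp (by fun_prop)

theorem isExpI_iff {A : Fin d → (H →ₗ.[ℂ] H)} {W : EuclideanSpace ℝ (Fin d) → (H ≃ₗᵢ[ℂ] H)} :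
    IsExpI A W ↔ IsUnitaryRep W ∧ ∀ j, (A j).graph = genGraph (axis W j) := by
  constructor
  · intro h
    have hW : IsUnitaryRep W := ⟨h.map_zero, h.map_add, h.continuous⟩
    refine ⟨hW, fun j => ?_⟩
    ext ⟨Ψ, Φ⟩
    rw [h.generator, mem_genGraph, (hW.axis j).genRel_iff]
    rfl
  · rintro ⟨hW, h⟩
    refine ⟨hW.map_zero, hW.map_add, hW.continuous, fun j Ψ Φ => ?_⟩
    rw [h, mem_genGraph, (hW.axis j).genRel_iff]
    rfl

/-- The generators fix the representation on each coordinate axis, and the group law fixes it on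
sums of vectors along the axes. -/
theorem eq_of_isExpI {A : Fin d → (H →ₗ.[ℂ] H)}
    {W W' : EuclideanSpace ℝ (Fin d) → (H ≃ₗᵢ[ℂ] H)} (hW : IsExpI A W) (hW' : IsExpI A W')
    (hA : ∀ j, Dense ((A j).domain : Set H)) (k : EuclideanSpace ℝ (Fin d)) (Ψ : H) :
    W k Ψ = W' k Ψ := by
  obtain ⟨h1, h2⟩ := isExpI_iff.1 hW
  obtain ⟨h1', h2'⟩ := isExpI_iff.1 hW'
  have hax : ∀ (j : Fin d) (t : ℝ) (Ψ : H), W (t • EuclideanSpace.single j (1 : ℝ)) Ψ =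
      W' (t • EuclideanSpace.single j (1 : ℝ)) Ψ := by
    intro j
    refine IsUnitaryGroup.eq_of_genRel_iff (U := NelsonModel.axis W j) (U' := NelsonModel.axis W' j)
      (h1.axis j) (h1'.axis j) (fun Ψ Φ => ?_) ?_
    · rw [← mem_genGraph, ← mem_genGraph, ← h2, ← h2']
    · refine (hA j).mono fun Ψ hΨ => ?_
      obtain ⟨Φ, hΦ⟩ := LinearPMap.mem_domain_iff.1 hΨ
      exact ⟨Φ, by rwa [← mem_genGraph, ← h2]⟩
  have hs : ∀ (s : Finset (Fin d)) Ψ, W (∑ j ∈ s, k j • (EuclideanSpace.single j (1 : ℝ) : EuclideanSpace ℝ (Fin d))) Ψ =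
      W' (∑ j ∈ s, k j • (EuclideanSpace.single j (1 : ℝ) : EuclideanSpace ℝ (Fin d))) Ψ := by
    intro s
    classical
    induction s using Finset.induction_on with
    | empty => intro Ψ; simp [h1.map_zero, h1'.map_zero]
    | insert j s hj ih =>
      intro Ψ
      rw [Finset.sum_insert hj, h1.map_add, h1'.map_add, ih, hax]
  have hk : k = ∑ j, k j • (EuclideanSpace.single j (1 : ℝ) : EuclideanSpace ℝ (Fin d)) := by
    ext i
    simp [Finset.sum_apply, Pi.single_apply]
  rw [hk]
  exact hs _ Ψ

end Groups

/-! ### Multiplication operators on `L²` -/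

section Multiplication

variable {α : Type*} [MeasurableSpace α] {μ : Measure α}
variable {K : Type*} [NormedAddCommGroup K] [InnerProductSpace ℂ K]

/-- Dominated convergence for `‖φ i - f‖²`. The explicit representatives `φ i` allow pointwise
limits along a continuous parameter, where the exceptional null sets of the `F i` could not be
united. -/
theorem tendsto_L2_of_dominated {K : Type*} [NormedAddCommGroup K] {ι : Type*} {l : Filter ι} [l.IsCountablyGenerated]
    {F : ι → Lp K 2 μ} {f : Lp K 2 μ} {φ : ι → α → K} {G : α → ℝ} (hφ : ∀ i, F i =ᵐ[μ] φ i)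
    (hG : MemLp G 2 μ) (hb : ∀ᶠ i in l, ∀ᵐ a ∂μ, ‖φ i a - f a‖ ≤ G a)
    (hlim : ∀ᵐ a ∂μ, Tendsto (fun i => φ i a) l (𝓝 (f a))) : Tendsto F l (𝓝 f) := by
  rw [Lp.tendsto_Lp_iff_tendsto_eLpNorm']
  have e : ∀ i, eLpNorm (⇑(F i) - ⇑f) 2 μ = (∫⁻ a, ‖φ i a - f a‖ₑ ^ (2 : ℝ) ∂μ) ^ (1 / 2 : ℝ) := by
    intro i
    rw [eLpNorm_congr_ae ((hφ i).sub (EventuallyEq.refl _ _)),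
      eLpNorm_eq_lintegral_rpow_enorm_toReal (by norm_num) (by norm_num)]
    simp
  simp only [e]
  have hG' : ∫⁻ a, ‖G a‖ₑ ^ (2 : ℝ) ∂μ ≠ ⊤ := by
    have := lintegral_rpow_enorm_lt_top_of_eLpNorm_lt_top (p := 2) (by norm_num) (by norm_num) hG.2
    simpa using this.ne
  have key : Tendsto (fun i => ∫⁻ a, ‖φ i a - f a‖ₑ ^ (2 : ℝ) ∂μ) l (𝓝 (∫⁻ _, 0 ∂μ)) := by
    refine tendsto_lintegral_filter_of_dominated_convergence' (fun a => ‖G a‖ₑ ^ (2 : ℝ)) ?_ ?_ hG' ?_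
    · refine Eventually.of_forall fun i => ?_
      have : AEStronglyMeasurable (fun a => φ i a - f a) μ :=
        ((Lp.aestronglyMeasurable (F i)).congr (hφ i)).sub (Lp.aestronglyMeasurable f)
      exact this.enorm.pow_const 2
    · filter_upwards [hb] with i hi
      filter_upwards [hi] with a ha
      gcongr
      exact enorm_le_iff_norm_le.2 (ha.trans (le_abs_self _))
    · filter_upwards [hlim] with a ha
      have h1 : Tendsto (fun i => ‖φ i a - f a‖ₑ) l (𝓝 0) := by
        have := (ha.sub_const (f a)).enorm
        simpa using this
      have h2 := (ENNReal.continuous_rpow_const (y := (2 : ℝ))).tendsto 0 |>.comp h1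
      simpa [Function.comp_def] using h2
  have h2 := (ENNReal.continuous_rpow_const (y := (1 / 2 : ℝ))).tendsto _ |>.comp key
  simpa [Function.comp_def] using h2

/-- `L²` convergence along a filter implies almost everywhere convergence along a sequence. -/
theorem exists_seq_tendsto_ae {K : Type*} [NormedAddCommGroup K] {ι : Type*} {l : Filter ι} [l.NeBot] [l.IsCountablyGenerated]
    {F : ι → Lp K 2 μ} {f : Lp K 2 μ} (h : Tendsto F l (𝓝 f)) :
    ∃ ns : ℕ → ι, Tendsto ns atTop l ∧ ∀ᵐ a ∂μ, Tendsto (fun i => F (ns i) a) atTop (𝓝 (f a)) :=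
  (tendstoInMeasure_of_tendsto_Lp h).exists_seq_tendsto_ae'

theorem norm_exp_I_mul (t : ℝ) : ‖Complex.exp (Complex.I * (t : ℂ))‖ = 1 := by
  rw [mul_comm, Complex.norm_exp_ofReal_mul_I]

theorem memLp_expMul {θ : α → ℝ} (hθ : Measurable θ) (f : Lp K 2 μ) :
    MemLp (fun a => Complex.exp (Complex.I * (θ a : ℂ)) • f a) 2 μ := by
  refine (Lp.memLp f).of_le (AEStronglyMeasurable.smul ?_ (Lp.aestronglyMeasurable f)) ?_
  · exact Measurable.aestronglyMeasurable (by fun_prop)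
  · refine Eventually.of_forall fun x => ?_
    rw [norm_smul, norm_exp_I_mul, one_mul]

/-- Multiplication by `exp(i θ)`. -/
def expMul (θ : α → ℝ) (hθ : Measurable θ) : Lp K 2 μ ≃ₗᵢ[ℂ] Lp K 2 μ where
  toFun f := (memLp_expMul hθ f).toLp _
  invFun f := (memLp_expMul hθ.neg f).toLp _
  map_add' f g := by
    rw [← MemLp.toLp_add]
    refine MemLp.toLp_congr _ _ ?_
    filter_upwards [Lp.coeFn_add f g] with a ha
    simp only [ha, Pi.add_apply, smul_add]
  map_smul' c f := by
    rw [RingHom.id_apply, ← MemLp.toLp_const_smul]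
    refine MemLp.toLp_congr _ _ ?_
    filter_upwards [Lp.coeFn_smul c f] with a ha
    simp only [ha, Pi.smul_apply]
    rw [smul_comm]
  left_inv f := by
    refine Lp.ext ?_
    filter_upwards [MemLp.coeFn_toLp (memLp_expMul hθ.neg ((memLp_expMul hθ f).toLp _)),
      MemLp.coeFn_toLp (memLp_expMul hθ f)] with a h1 h2
    rw [h1, h2, smul_smul, ← Complex.exp_add]
    simp
  right_inv f := by
    refine Lp.ext ?_
    filter_upwards [MemLp.coeFn_toLp (memLp_expMul hθ ((memLp_expMul hθ.neg f).toLp _)),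
      MemLp.coeFn_toLp (memLp_expMul hθ.neg f)] with a h1 h2
    rw [h1, h2, smul_smul, ← Complex.exp_add]
    simp
  norm_map' f := by
    change ‖(memLp_expMul hθ f).toLp _‖ = ‖f‖
    rw [Lp.norm_toLp, Lp.norm_def]
    congr 1
    refine eLpNorm_congr_norm_ae (Eventually.of_forall fun a => ?_)
    rw [norm_smul, norm_exp_I_mul, one_mul]

theorem coeFn_expMul {θ : α → ℝ} (hθ : Measurable θ) (f : Lp K 2 μ) :
    expMul θ hθ f =ᵐ[μ] fun a => Complex.exp (Complex.I * (θ a : ℂ)) • f a :=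
  MemLp.coeFn_toLp (memLp_expMul hθ f)

theorem expMul_zero (f : Lp K 2 μ) {θ : α → ℝ} (hθ : Measurable θ) (h0 : ∀ a, θ a = 0) :
    expMul θ hθ f = f := by
  refine Lp.ext ?_
  filter_upwards [coeFn_expMul hθ f] with a ha
  rw [ha, h0]
  simp

theorem expMul_expMul (f : Lp K 2 μ) {θ θ' θ'' : α → ℝ} (hθ : Measurable θ) (hθ' : Measurable θ')
    (hθ'' : Measurable θ'') (h : ∀ a, θ'' a = θ a + θ' a) :
    expMul θ'' hθ'' f = expMul θ hθ (expMul θ' hθ' f) := by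
  refine Lp.ext ?_
  filter_upwards [coeFn_expMul hθ (expMul θ' hθ' f), coeFn_expMul hθ' f,
    coeFn_expMul hθ'' f] with a h1 h2 h3
  rw [h1, h2, h3, smul_smul, ← Complex.exp_add, h a]
  push_cast
  rw [mul_add]

theorem continuous_expMul {X : Type*} [TopologicalSpace X] [FirstCountableTopology X]
    {θ : X → α → ℝ} (hθ : ∀ x, Measurable (θ x)) (hc : ∀ a, Continuous fun x => θ x a)
    (f : Lp K 2 μ) : Continuous fun x => expMul (θ x) (hθ x) f := by
  rw [continuous_iff_continuousAt]
  intro x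
  refine tendsto_L2_of_dominated (φ := fun y a => Complex.exp (Complex.I * (θ y a : ℂ)) • f a)
    (G := fun a => 2 * ‖f a‖) (fun y => coeFn_expMul (hθ y) f) ((Lp.memLp f).norm.const_mul 2) ?_ ?_
  · refine Eventually.of_forall fun y => ?_
    filter_upwards [coeFn_expMul (hθ x) f] with a ha
    rw [ha]
    refine (norm_sub_le _ _).trans ?_
    rw [norm_smul, norm_smul, norm_exp_I_mul, norm_exp_I_mul]
    linarith
  · filter_upwards [coeFn_expMul (hθ x) f] with a ha
    rw [ha]
    have := hc a
    exact Continuous.tendsto (by fun_prop) x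

/-- `t ↦ exp(i t m) f` is differentiable in `L²` at `0` exactly when `m f` is in `L²`. -/
theorem hasDerivAt_expMul_iff {m : α → ℝ} {θ : ℝ → α → ℝ} (hθ : ∀ t, Measurable (θ t))
    (hm : ∀ t a, θ t a = t * m a) (f h : Lp K 2 μ) :
    HasDerivAt (fun t : ℝ => expMul (θ t) (hθ t) f) (Complex.I • h) 0 ↔
      h =ᵐ[μ] fun a => (m a : ℂ) • f a := by
  have h0 : expMul (θ 0) (hθ 0) f = f := expMul_zero f _ fun a => by rw [hm, zero_mul]
  have hslope : ∀ t : ℝ, (t⁻¹ • (expMul (θ t) (hθ t) f - f) : Lp K 2 μ) =ᵐ[μ]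
      fun a => (((t : ℂ)⁻¹) * (Complex.exp (Complex.I * (t * m a : ℝ)) - 1)) • f a := by
    intro t
    filter_upwards [Lp.coeFn_smul (t⁻¹) (expMul (θ t) (hθ t) f - f),
      Lp.coeFn_sub (expMul (θ t) (hθ t) f) f, coeFn_expMul (hθ t) f] with a h1 h2 h3
    rw [h1, Pi.smul_apply, h2, Pi.sub_apply, h3, hm, mul_smul, sub_smul, one_smul,
      ← Complex.ofReal_inv, Complex.coe_smul]
  have hlim : ∀ a, Tendsto (fun t : ℝ => (((t : ℂ)⁻¹) *
      (Complex.exp (Complex.I * (t * m a : ℝ)) - 1)) • f a) (𝓝[≠] 0)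
      (𝓝 ((Complex.I * (m a : ℂ)) • f a)) := by
    intro a
    have d : HasDerivAt (fun t : ℝ => Complex.exp (Complex.I * (t * m a : ℝ)))
        (Complex.I * (m a : ℂ)) 0 := by
      have d1 : HasDerivAt (fun t : ℝ => Complex.I * ((t * m a : ℝ) : ℂ)) (Complex.I * (m a : ℂ)) 0 := by
        have := ((hasDerivAt_id (0 : ℝ)).mul_const (m a)).ofReal_comp.const_mul Complex.I
        simpa using this
      simpa using d1.cexp
    have := hasDerivAt_iff_tendsto_slope_zero.1 d
    refine Tendsto.smul_const ?_ (f a)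
    simpa [Complex.real_smul] using this
  rw [hasDerivAt_iff_tendsto_slope_zero]
  simp only [zero_add, h0]
  constructor
  · intro ht
    -- Along a subsequence the `L²` limit is an almost everywhere limit, which must equal the
    -- pointwise derivative `i m f`.
    obtain ⟨ns, hns, hae⟩ := exists_seq_tendsto_ae ht
    have hall := ae_all_iff.2 fun i => hslope (ns i)
    filter_upwards [hae, hall, Lp.coeFn_smul Complex.I h] with a h1 h2 h3
    have h4 := (hlim a).comp hns
    have h5 : Tendsto (fun i => ((ns i)⁻¹ • (expMul (θ (ns i)) (hθ (ns i)) f - f) : Lp K 2 μ) a)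
        atTop (𝓝 ((Complex.I * (m a : ℂ)) • f a)) := by
      refine h4.congr fun i => ?_
      rw [h2 i]
      rfl
    have h6 := tendsto_nhds_unique h1 h5
    rw [h3, Pi.smul_apply, mul_smul] at h6
    exact smul_right_injective K Complex.I_ne_zero h6
  · intro hh
    -- Since `|e^{itm} - 1| ≤ |t m|`, the quotient is bounded by `|m| ‖f‖ = ‖h‖`; its limit
    -- contributes the second `‖h‖`.
    refine tendsto_L2_of_dominated (G := fun a => 2 * ‖h a‖) hslope ((Lp.memLp h).norm.const_mul 2)
      ?_ ?_
    · filter_upwards [self_mem_nhdsWithin] with t ht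
      filter_upwards [hh, Lp.coeFn_smul Complex.I h] with a h1 h2
      have ht0 : t ≠ 0 := ht
      refine (norm_sub_le _ _).trans ?_
      rw [h2, Pi.smul_apply, norm_smul Complex.I, Complex.norm_I, one_mul, two_mul]
      gcongr
      rw [norm_smul, norm_mul, h1, norm_smul]
      gcongr
      have := Real.norm_exp_I_mul_ofReal_sub_one_le (x := t * m a)
      rw [norm_inv, Complex.norm_real, Complex.norm_real]
      calc ‖t‖⁻¹ * ‖Complex.exp (Complex.I * (t * m a : ℝ)) - 1‖ ≤ ‖t‖⁻¹ * ‖t * m a‖ := by gcongr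
        _ = ‖m a‖ := by
          rw [norm_mul, ← mul_assoc, inv_mul_cancel₀ (by simpa using ht0), one_mul]
    · filter_upwards [hh, Lp.coeFn_smul Complex.I h] with a h1 h2
      rw [h2, Pi.smul_apply, h1, smul_smul]
      exact hlim a

end Multiplication

/-! ### The particle space -/

section Particle

variable {d : ℕ} {K : Type*} [NormedAddCommGroup K] [InnerProductSpace ℂ K]
variable {K' : Type*} [NormedAddCommGroup K'] [InnerProductSpace ℂ K']

theorem coeFn_tensor (f : L2 d ℂ) (ψ : K) : tensor f ψ =ᵐ[volume] fun x => f x • ψ := by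
  filter_upwards [(ContinuousLinearMap.toSpanSingleton ℂ ψ).coeFn_compLp f] with x hx
  rw [tensor, hx]
  simp

/-- The tensor product as a continuous bilinear map. -/
def tensorB : K →L[ℂ] L2 d ℂ →L[ℂ] L2 d K :=
  (ContinuousLinearMap.lsmul ℂ ℂ).flip.compLpL₂ 2 volume

theorem tensorB_apply (f : L2 d ℂ) (ψ : K) : tensorB ψ f = tensor f ψ := by
  refine Lp.ext ?_
  filter_upwards [coeFn_tensor f ψ,
    ((ContinuousLinearMap.lsmul ℂ ℂ).flip ψ : ℂ →L[ℂ] K).coeFn_compLp f] with x h1 h2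
  rw [h1, tensorB, ContinuousLinearMap.compLpL₂_apply_apply, h2]
  simp

theorem tensor_smul_left (c : ℂ) (f : L2 d ℂ) (ψ : K) : tensor (c • f) ψ = c • tensor f ψ := by
  simp only [← tensorB_apply, _root_.map_smul]

theorem tensor_smul_right (c : ℂ) (f : L2 d ℂ) (ψ : K) : tensor f (c • ψ) = c • tensor f ψ := by
  simp only [← tensorB_apply, _root_.map_smul, smul_apply]

theorem inner_tensor (f g : L2 d ℂ) (ψ φ : K) :
    ⟪tensor f ψ, tensor g φ⟫_ℂ = ⟪f, g⟫_ℂ * ⟪ψ, φ⟫_ℂ := by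
  rw [L2.inner_def, L2.inner_def, ← integral_mul_const]
  refine integral_congr_ae ?_
  filter_upwards [coeFn_tensor f ψ, coeFn_tensor g φ] with x h1 h2
  rw [h1, h2, inner_smul_left, inner_smul_right, ← mul_assoc, RCLike.inner_apply]
  ring

theorem tensor_mem_algTensor {D : Submodule ℂ (L2 d ℂ)} {F : Submodule ℂ K} {f : L2 d ℂ} {ψ : K}
    (hf : f ∈ D) (hψ : ψ ∈ F) : tensor f ψ ∈ algTensor D F :=
  Submodule.subset_span ⟨f, hf, ψ, hψ, rfl⟩

theorem dense_testFunctions : Dense (testFunctions d : Set (L2 d ℂ)) := by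
  intro f
  refine (mem_closure_iff_nhds_basis Metric.nhds_basis_closedBall).2 fun ε hε => ?_
  obtain ⟨g, hg₁, hg₂, hg₃⟩ := MemLp.exist_eLpNorm_sub_le (p := 2) (by norm_num) (by norm_num)
    (Lp.memLp f) hε
  have hm : MemLp g 2 (volume : Measure (Sp d)) := hg₂.continuous.memLp_of_hasCompactSupport hg₁
  refine ⟨hm.toLp g, ⟨g, hg₂, hg₁, hm.coeFn_toLp⟩, ?_⟩
  rw [Metric.mem_closedBall', Lp.dist_def,
    eLpNorm_congr_ae ((EventuallyEq.refl _ (f : Sp d → ℂ)).sub hm.coeFn_toLp)]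
  exact ENNReal.toReal_le_of_le_ofReal hε.le hg₃

/-- Joint continuity of the tensor product puts every `f ⊗ ψ` in the closure. Vector-valued
indicator functions are of this form, and they generate `L²(ℝ^d; K)`. -/
theorem dense_algTensor {D : Submodule ℂ (L2 d ℂ)} {F : Submodule ℂ K}
    (hD : Dense (D : Set (L2 d ℂ))) (hF : Dense (F : Set K)) :
    Dense (algTensor D F : Set (L2 d K)) := by
  have h1 : ∀ (f : L2 d ℂ) (ψ : K), tensor f ψ ∈ (algTensor D F).topologicalClosure := by
    intro f ψ
    have hc : Continuous fun p : L2 d ℂ × K => tensor p.1 p.2 := by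
      simp only [← tensorB_apply]
      fun_prop
    have hd := (hD.prod hF) (f, ψ)
    have := image_closure_subset_closure_image hc (Set.mem_image_of_mem _ hd)
    refine closure_mono ?_ this
    rintro _ ⟨⟨f, ψ⟩, ⟨hf, hψ⟩, rfl⟩
    exact tensor_mem_algTensor hf hψ
  intro Ψ
  refine Lp.induction (p := 2) (by norm_num) (motive := fun Ψ => Ψ ∈ (algTensor D F).topologicalClosure)
    ?_ ?_ ?_ Ψ
  · intro c s hs hμs
    convert h1 (indicatorConstLp 2 hs hμs.ne 1) c using 1
    rw [Lp.simpleFunc.coe_indicatorConst]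
    refine Lp.ext ?_
    filter_upwards [indicatorConstLp_coeFn (p := 2) (hs := hs) (hμs := hμs.ne) (c := c),
      coeFn_tensor (indicatorConstLp 2 hs hμs.ne 1) c,
      indicatorConstLp_coeFn (p := 2) (hs := hs) (hμs := hμs.ne) (c := (1 : ℂ))] with x h1 h2 h3
    rw [h1, h2, h3]
    by_cases hx : x ∈ s <;> simp [hx]
  · intro f g hf hg _ h1 h2
    exact Submodule.add_mem _ h1 h2
  · exact (algTensor D F).isClosed_topologicalClosure

/-- Used to check the identities for the vector-valued Fourier transform on products with a test
function. -/
theorem continuous_ext_tensor {X : Type*} [TopologicalSpace X] [T2Space X] [AddCommMonoid X]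
    [Module ℂ X] {A B : L2 d K →ₗ[ℂ] X} (hA : Continuous A) (hB : Continuous B)
    (h : ∀ f ∈ testFunctions d, ∀ ψ : K, A (tensor f ψ) = B (tensor f ψ)) (Ψ : L2 d K) :
    A Ψ = B Ψ := by
  have hd : Dense (algTensor (testFunctions d) (⊤ : Submodule ℂ K) : Set (L2 d K)) :=
    dense_algTensor dense_testFunctions (by simp)
  refine congrFun (Continuous.ext_on hd hA hB fun Φ hΦ => ?_) Ψ
  refine Submodule.span_induction ?_ ?_ ?_ ?_ hΦ
  · rintro _ ⟨f, hf, ψ, -, rfl⟩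
    exact h f hf ψ
  · simp
  · intro x y _ _ hx hy
    simp [hx, hy]
  · intro c x _ hx
    simp [hx]

/-! #### Fibre operators, translations, phases -/

theorem compLp_tensor (T : K →L[ℂ] K') (f : L2 d ℂ) (ψ : K) :
    T.compLp (tensor f ψ) = tensor f (T ψ) := by
  refine Lp.ext ?_
  filter_upwards [T.coeFn_compLp (tensor f ψ), coeFn_tensor f ψ, coeFn_tensor f (T ψ)] with x h1 h2 h3
  rw [h1, h2, h3, _root_.map_smul]

/-- The operator `I ⊗ T`, for `T` unitary. -/
def liftU (T : K ≃ₗᵢ[ℂ] K) : L2 d K ≃ₗᵢ[ℂ] L2 d K where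
  toLinearEquiv := LinearEquiv.ofLinearMap
    ((T.toContinuousLinearEquiv : K →L[ℂ] K).compLpₗ 2 volume)
    ((T.symm.toContinuousLinearEquiv : K →L[ℂ] K).compLpₗ 2 volume)
    (by
      ext1 Ψ
      refine Lp.ext ?_
      filter_upwards [(T.toContinuousLinearEquiv : K →L[ℂ] K).coeFn_compLp
        ((T.symm.toContinuousLinearEquiv : K →L[ℂ] K).compLp Ψ),
        (T.symm.toContinuousLinearEquiv : K →L[ℂ] K).coeFn_compLp Ψ] with x h1 h2
      refine h1.trans ?_
      rw [h2]
      simp)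
    (by
      ext1 Ψ
      refine Lp.ext ?_
      filter_upwards [(T.symm.toContinuousLinearEquiv : K →L[ℂ] K).coeFn_compLp
        ((T.toContinuousLinearEquiv : K →L[ℂ] K).compLp Ψ),
        (T.toContinuousLinearEquiv : K →L[ℂ] K).coeFn_compLp Ψ] with x h1 h2
      refine h1.trans ?_
      rw [h2]
      simp)
  norm_map' Ψ := by
    change ‖(T.toContinuousLinearEquiv : K →L[ℂ] K).compLp Ψ‖ = ‖Ψ‖
    rw [Lp.norm_def, Lp.norm_def]
    congr 1
    refine eLpNorm_congr_norm_ae ?_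
    filter_upwards [(T.toContinuousLinearEquiv : K →L[ℂ] K).coeFn_compLp Ψ] with x hx
    rw [hx]
    exact T.norm_map _

theorem liftU_eq (T : K ≃ₗᵢ[ℂ] K) (Ψ : L2 d K) :
    liftU T Ψ = (T.toContinuousLinearEquiv : K →L[ℂ] K).compLp Ψ := rfl

theorem coeFn_liftU (T : K ≃ₗᵢ[ℂ] K) (Ψ : L2 d K) : liftU T Ψ =ᵐ[volume] fun x => T (Ψ x) :=
  (T.toContinuousLinearEquiv : K →L[ℂ] K).coeFn_compLp Ψ

theorem liftU_tensor (T : K ≃ₗᵢ[ℂ] K) (f : L2 d ℂ) (ψ : K) :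
    liftU T (tensor f ψ) = tensor f (T ψ) := by
  rw [liftU_eq, compLp_tensor]
  rfl

theorem measurePreserving_shift (k : Sp d) :
    MeasurePreserving (fun x : Sp d => x + k) volume volume :=
  measurePreserving_add_right volume k

/-- The translation `Ψ ↦ Ψ(· + k)`. -/
def shift (k : Sp d) : L2 d K ≃ₗᵢ[ℂ] L2 d K where
  toLinearEquiv := LinearEquiv.ofLinearMap
    (Lp.compMeasurePreservingₗ ℂ _ (measurePreserving_shift k))
    (Lp.compMeasurePreservingₗ ℂ _ (measurePreserving_shift (-k)))
    (by
      ext1 Ψ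
      refine Lp.ext ?_
      have h1 := Lp.coeFn_compMeasurePreserving Ψ (measurePreserving_shift (-k))
      filter_upwards [Lp.coeFn_compMeasurePreserving
        (Lp.compMeasurePreserving _ (measurePreserving_shift (-k)) Ψ) (measurePreserving_shift k),
        (measurePreserving_shift k).quasiMeasurePreserving.ae h1] with x h2 h3
      refine h2.trans ?_
      rw [Function.comp_apply, h3]
      simp)
    (by
      ext1 Ψ
      refine Lp.ext ?_
      have h1 := Lp.coeFn_compMeasurePreserving Ψ (measurePreserving_shift k)
      filter_upwards [Lp.coeFn_compMeasurePreserving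
        (Lp.compMeasurePreserving _ (measurePreserving_shift k) Ψ) (measurePreserving_shift (-k)),
        (measurePreserving_shift (-k)).quasiMeasurePreserving.ae h1] with x h2 h3
      refine h2.trans ?_
      rw [Function.comp_apply, h3]
      simp)
  norm_map' Ψ := Lp.norm_compMeasurePreserving Ψ (measurePreserving_shift k)

theorem coeFn_shift (k : Sp d) (Ψ : L2 d K) : shift k Ψ =ᵐ[volume] fun x => Ψ (x + k) :=
  Lp.coeFn_compMeasurePreserving Ψ (measurePreserving_shift k)

theorem ae_shift {p : Sp d → Prop} (k : Sp d) (h : ∀ᵐ x, p x) : ∀ᵐ x, p (x + k) :=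
  (measurePreserving_shift k).quasiMeasurePreserving.ae h

theorem shift_zero (Ψ : L2 d K) : shift 0 Ψ = Ψ := by
  refine Lp.ext ?_
  filter_upwards [coeFn_shift 0 Ψ] with x hx
  rw [hx, add_zero]

theorem shift_add (k l : Sp d) (Ψ : L2 d K) : shift (k + l) Ψ = shift k (shift l Ψ) := by
  refine Lp.ext ?_
  filter_upwards [coeFn_shift (k + l) Ψ, coeFn_shift k (shift l Ψ),
    ae_shift k (coeFn_shift l Ψ)] with x h1 h2 h3
  rw [h1, h2, h3, add_assoc]

theorem continuous_shift (Ψ : L2 d K) : Continuous fun k => shift k Ψ := by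
  have hg : Continuous fun k : Sp d => (⟨fun x => x + k, by fun_prop⟩ : C(Sp d, Sp d)) :=
    ContinuousMap.continuous_of_continuous_uncurry _ (by
      simp only [Function.uncurry_def, ContinuousMap.coe_mk]
      fun_prop)
  exact Continuous.compMeasurePreservingLp (continuous_const (y := Ψ)) hg
    (fun k => measurePreserving_shift k) (by norm_num)

theorem shift_tensor (k : Sp d) (f : L2 d ℂ) (ψ : K) :
    shift k (tensor f ψ) = tensor (shift k f) ψ := by
  refine Lp.ext ?_
  filter_upwards [coeFn_shift k (tensor f ψ), ae_shift k (coeFn_tensor f ψ),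
    coeFn_tensor (shift k f) ψ, coeFn_shift k f] with x h1 h2 h3 h4
  rw [h1, h2, h3, h4]

theorem shift_liftU (k : Sp d) (T : K ≃ₗᵢ[ℂ] K) (Ψ : L2 d K) :
    shift k (liftU T Ψ) = liftU T (shift k Ψ) := by
  refine Lp.ext ?_
  filter_upwards [coeFn_shift k (liftU T Ψ), ae_shift k (coeFn_liftU T Ψ),
    coeFn_liftU T (shift k Ψ), coeFn_shift k Ψ] with x h1 h2 h3 h4
  rw [h1, h2, h3, h4]

theorem shift_mem_testFunctions (k : Sp d) {f : L2 d ℂ} (hf : f ∈ testFunctions d) :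
    shift k f ∈ testFunctions d := by
  obtain ⟨u, hu, hu', hfu⟩ := hf
  refine ⟨fun x => u (x + k), hu.comp (by fun_prop),
    hu'.comp_homeomorph (Homeomorph.addRight k), ?_⟩
  filter_upwards [coeFn_shift k f, ae_shift k hfu] with x h1 h2
  rw [h1, h2]

theorem phase_eq (k : Sp d) (Ψ : L2 d K) :
    phase k Ψ = expMul (fun x => ⟪k, x⟫_ℝ) (by fun_prop) Ψ := rfl

theorem coeFn_phase (k : Sp d) (Ψ : L2 d K) :
    phase k Ψ =ᵐ[volume] fun x => Complex.exp (Complex.I * (⟪k, x⟫_ℝ : ℂ)) • Ψ x :=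
  MemLp.coeFn_toLp (memLp_phase k Ψ)

theorem phase_add (k l : Sp d) (Ψ : L2 d K) : phase (k + l) Ψ = phase k (phase l Ψ) :=
  expMul_expMul Ψ (by fun_prop) (by fun_prop) (by fun_prop) fun x => inner_add_left _ _ _

theorem phase_zero (Ψ : L2 d K) : phase 0 Ψ = Ψ :=
  expMul_zero Ψ (by fun_prop) fun x => inner_zero_left _

theorem continuous_phase (Ψ : L2 d K) : Continuous fun k => phase k Ψ :=
  continuous_expMul (θ := fun (k : Sp d) x => ⟪k, x⟫_ℝ) (fun _ => by fun_prop) (fun _ => by fun_prop) Ψ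

theorem norm_phase (k : Sp d) (Ψ : L2 d K) : ‖phase k Ψ‖ = ‖Ψ‖ :=
  (expMul (fun x => ⟪k, x⟫_ℝ) (by fun_prop)).norm_map Ψ

theorem phase_tensor (k : Sp d) (f : L2 d ℂ) (ψ : K) :
    phase k (tensor f ψ) = tensor (phase k f) ψ := by
  refine Lp.ext ?_
  filter_upwards [coeFn_phase k (tensor f ψ), coeFn_tensor f ψ,
    coeFn_tensor (phase k f) ψ, coeFn_phase k f] with x h1 h2 h3 h4
  rw [h1, h2, h3, h4, smul_smul, smul_eq_mul]

theorem phase_mem_testFunctions (k : Sp d) {f : L2 d ℂ} (hf : f ∈ testFunctions d) :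
    phase k f ∈ testFunctions d := by
  obtain ⟨u, hu, hu', hfu⟩ := hf
  refine ⟨fun x => Complex.exp (Complex.I * (⟪k, x⟫_ℝ : ℂ)) * u x, ?_, hu'.mul_left, ?_⟩
  · refine ContDiff.mul (ContDiff.cexp (contDiff_const.mul ?_)) hu
    exact Complex.ofRealCLM.contDiff.comp (contDiff_const.inner ℝ contDiff_id)
  · filter_upwards [coeFn_phase k f, hfu] with x h1 h2
    rw [h1, h2, smul_eq_mul]

/-- Test functions are dense, and `L²` is nonzero because the unit ball has positive finite volume,
also for `d = 0`. -/
theorem testFunctions_ne_bot : testFunctions d ≠ ⊥ := by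
  intro h
  have hd := dense_testFunctions (d := d)
  rw [h, Submodule.bot_coe, dense_iff_closure_eq, closure_singleton] at hd
  have hb : MeasurableSet (Metric.ball (0 : Sp d) 1) := measurableSet_ball
  have hb' : volume (Metric.ball (0 : Sp d) 1) ≠ ⊤ := measure_ball_lt_top.ne
  have h0 : indicatorConstLp 2 hb hb' (1 : ℂ) = 0 := by
    have : indicatorConstLp 2 hb hb' (1 : ℂ) ∈ (Set.univ : Set (L2 d ℂ)) := trivial
    rw [← hd] at this
    exact this
  have h1 := congrArg norm h0
  rw [norm_indicatorConstLp (by norm_num) (by norm_num), norm_zero, norm_one, one_mul] at h1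
  have hpos : 0 < volume.real (Metric.ball (0 : Sp d) 1) :=
    ENNReal.toReal_pos (Metric.measure_ball_pos volume 0 one_pos).ne' hb'
  exact (Real.rpow_pos_of_pos hpos _).ne' h1

end Particle

/-! ### The Fourier transform on the particle space -/

section Fourier

variable {d : ℕ}

theorem eq_toLp_of_contDiff {K : Type*} [NormedAddCommGroup K] [InnerProductSpace ℂ K]
    {f : L2 d K} {u : Sp d → K} (hu : ContDiff ℝ ∞ u)
    (hc : HasCompactSupport u) (hf : f =ᵐ[volume] u) : f = (hc.toSchwartzMap hu).toLp 2 := by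
  refine Lp.ext ?_
  filter_upwards [hf, (hc.toSchwartzMap hu).coeFn_toLp 2 volume] with x h1 h2
  rw [h1, h2]
  rfl

theorem isUnitaryRep_shift {K : Type*} [NormedAddCommGroup K] [InnerProductSpace ℂ K] :
    IsUnitaryRep (shift : Sp d → (L2 d K ≃ₗᵢ[ℂ] L2 d K)) :=
  ⟨shift_zero, shift_add, continuous_shift⟩

variable {K : Type*} [NormedAddCommGroup K] [InnerProductSpace ℂ K] [CompleteSpace K]
variable {K' : Type*} [NormedAddCommGroup K'] [InnerProductSpace ℂ K'] [CompleteSpace K']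

/-- The Fourier transform on `L²(ℝ^d; K)`. -/
abbrev FT : L2 d K ≃ₗᵢ[ℂ] L2 d K := Lp.fourierTransformₗᵢ (Sp d) K

theorem coeFn_FT_schwartz (f : SchwartzMap (Sp d) K) :
    FT (f.toLp 2) =ᵐ[volume] 𝓕 (f : Sp d → K) := by
  have h : FT (f.toLp 2) = (𝓕 f).toLp 2 := SchwartzMap.toLp_fourier_eq f
  rw [h]
  filter_upwards [(𝓕 f).coeFn_toLp 2 volume] with x hx
  rw [hx, SchwartzMap.fourier_coe]

theorem coeFn_FT {f : L2 d K} {u : Sp d → K} (hu : ContDiff ℝ ∞ u)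
    (hc : HasCompactSupport u) (hf : f =ᵐ[volume] u) : FT f =ᵐ[volume] 𝓕 u := by
  rw [eq_toLp_of_contDiff hu hc hf]
  exact coeFn_FT_schwartz _

/-- For a test function the transform is an integral and the constant vector comes out of it;
density and continuity do the rest. -/
theorem FT_tensor (f : L2 d ℂ) (ψ : K) : FT (tensor f ψ) = tensor (FT f) ψ := by
  have hA : Continuous fun f : L2 d ℂ => FT (tensor f ψ) := by
    simp only [← tensorB_apply]
    fun_prop
  have hB : Continuous fun f : L2 d ℂ => tensor (FT f) ψ := by
    simp only [← tensorB_apply]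
    fun_prop
  refine congrFun (Continuous.ext_on dense_testFunctions hA hB ?_) f
  rintro g ⟨u, hu, hc, hg⟩
  have hg' : tensor g ψ =ᵐ[volume] fun x => u x • ψ := by
    filter_upwards [coeFn_tensor g ψ, hg] with x h1 h2
    rw [h1, h2]
  refine Lp.ext ?_
  filter_upwards [coeFn_FT (hu.smul contDiff_const) (hc.smul_right (f' := fun _ => ψ)) hg',
    coeFn_tensor (FT g) ψ, coeFn_FT hu hc hg] with ξ h1 h2 h3
  rw [h1, h2, h3, Real.fourier_eq, Real.fourier_eq, ← integral_smul_const]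
  simp only [Circle.smul_def, smul_assoc, Pi.smul_apply']

theorem FT_compLp (T : K →L[ℂ] K') (Ψ : L2 d K) : FT (T.compLp Ψ) = T.compLp (FT Ψ) := by
  refine continuous_ext_tensor
    (A := (FT : L2 d K' ≃ₗᵢ[ℂ] L2 d K').toLinearEquiv.toLinearMap ∘ₗ T.compLpₗ 2 volume)
    (B := T.compLpₗ 2 volume ∘ₗ (FT : L2 d K ≃ₗᵢ[ℂ] L2 d K).toLinearEquiv.toLinearMap) ?_ ?_ ?_ Ψ
  · exact FT.continuous.comp (T.compLpL 2 volume).continuous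
  · exact (T.compLpL 2 volume).continuous.comp FT.continuous
  · intro f _ ψ
    change FT (T.compLp (tensor f ψ)) = T.compLp (FT (tensor f ψ))
    rw [compLp_tensor, FT_tensor, FT_tensor, compLp_tensor]

theorem FT_liftU (T : K ≃ₗᵢ[ℂ] K) (Ψ : L2 d K) : FT (liftU T Ψ) = liftU T (FT Ψ) :=
  FT_compLp _ Ψ

theorem fourier_comp_add (u : Sp d → ℂ) (k ξ : Sp d) :
    𝓕 (fun x => u (x + k)) ξ =
      Complex.exp (Complex.I * (⟪(2 * Real.pi) • k, ξ⟫_ℝ : ℂ)) • 𝓕 u ξ := by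
  have h := congrFun (VectorFourier.fourierIntegral_comp_add_right Real.fourierChar volume
    (innerₗ (Sp d)) u k) ξ
  have h' : 𝓕 (fun x => u (x + k)) ξ = Real.fourierChar ⟪k, ξ⟫_ℝ • 𝓕 u ξ := h
  rw [h', Circle.smul_def, Real.fourierChar_apply, real_inner_smul_left]
  congr 2
  push_cast
  ring

theorem fourier_exp_mul {K : Type*} [NormedAddCommGroup K] [InnerProductSpace ℂ K]
    (u : Sp d → K) (k ξ : Sp d) :
    𝓕 (fun x => Complex.exp (Complex.I * (⟪k, x⟫_ℝ : ℂ)) • u x) ξ =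
      𝓕 u (ξ + -((2 * Real.pi)⁻¹ • k)) := by
  rw [Real.fourier_eq', Real.fourier_eq']
  congr 1
  funext x
  rw [smul_smul, ← Complex.exp_add]
  congr 2
  rw [inner_add_right, inner_neg_right, real_inner_smul_right, real_inner_comm k x]
  have : (Real.pi : ℂ) ≠ 0 := by exact_mod_cast Real.pi_ne_zero
  push_cast
  field_simp
  ring

/-- The factor `2π` comes from the kernel `e^{-2πi ξ·x}`, in which `p` is multiplication by `2πξ`.
-/
theorem FT_shift (k : Sp d) (Ψ : L2 d K) : FT (shift k Ψ) = phase ((2 * Real.pi) • k) (FT Ψ) := by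
  refine continuous_ext_tensor
    (A := (FT : L2 d K ≃ₗᵢ[ℂ] L2 d K).toLinearEquiv.toLinearMap ∘ₗ (shift k).toLinearEquiv.toLinearMap)
    (B := (expMul (fun x => ⟪(2 * Real.pi) • k, x⟫_ℝ) (by fun_prop)).toLinearEquiv.toLinearMap ∘ₗ
      (FT : L2 d K ≃ₗᵢ[ℂ] L2 d K).toLinearEquiv.toLinearMap) ?_ ?_ ?_ Ψ
  · exact FT.continuous.comp (shift k).continuous
  · exact (expMul (fun x : Sp d => ⟪(2 * Real.pi) • k, x⟫_ℝ) (by fun_prop)).continuous.comp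
      FT.continuous
  · intro f hf ψ
    change FT (shift k (tensor f ψ)) = phase ((2 * Real.pi) • k) (FT (tensor f ψ))
    rw [shift_tensor, FT_tensor, FT_tensor, phase_tensor]
    congr 1
    obtain ⟨u, hu, hc, hfu⟩ := hf
    have hg : shift k f =ᵐ[volume] fun x => u (x + k) := by
      filter_upwards [coeFn_shift k f, ae_shift k hfu] with x h1 h2
      rw [h1, h2]
    refine Lp.ext ?_
    filter_upwards [coeFn_FT (u := fun x => u (x + k)) (hu.comp (by fun_prop))
      (hc.comp_homeomorph (Homeomorph.addRight k)) hg, coeFn_phase ((2 * Real.pi) • k) (FT f),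
      coeFn_FT hu hc hfu] with ξ h1 h2 h3
    rw [h1, h2, h3, fourier_comp_add]

theorem FT_phase (k : Sp d) (Ψ : L2 d K) :
    FT (phase k Ψ) = shift (-((2 * Real.pi)⁻¹ • k)) (FT Ψ) := by
  refine continuous_ext_tensor
    (A := (FT : L2 d K ≃ₗᵢ[ℂ] L2 d K).toLinearEquiv.toLinearMap ∘ₗ
      (expMul (fun x => ⟪k, x⟫_ℝ) (by fun_prop)).toLinearEquiv.toLinearMap)
    (B := (shift (-((2 * Real.pi)⁻¹ • k))).toLinearEquiv.toLinearMap ∘ₗ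
      (FT : L2 d K ≃ₗᵢ[ℂ] L2 d K).toLinearEquiv.toLinearMap) ?_ ?_ ?_ Ψ
  · exact FT.continuous.comp (LinearIsometryEquiv.continuous _)
  · exact (shift _).continuous.comp FT.continuous
  · intro f hf ψ
    change FT (phase k (tensor f ψ)) = shift (-((2 * Real.pi)⁻¹ • k)) (FT (tensor f ψ))
    rw [phase_tensor, FT_tensor, FT_tensor, shift_tensor]
    congr 1
    obtain ⟨v, hv, hvc, hfv⟩ := phase_mem_testFunctions k hf
    obtain ⟨u, hu, hc, hfu⟩ := hf
    refine Lp.ext ?_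
    filter_upwards [coeFn_FT hv hvc hfv, coeFn_shift (-((2 * Real.pi)⁻¹ • k)) (FT f),
      ae_shift (-((2 * Real.pi)⁻¹ • k)) (coeFn_FT hu hc hfu)] with ξ h1 h2 h3
    rw [h1, h2, h3, ← fourier_exp_mul]
    refine Real.fourier_congr_ae ?_ ξ
    filter_upwards [hfv, coeFn_phase k f, hfu] with x h1 h2 h3
    rw [← h1, h2, h3]

/-- The Fourier transform of a test function decays faster than any power. -/
theorem memLp_FT_test {f : L2 d ℂ} (hf : f ∈ testFunctions d) :
    MemLp (fun ξ => ((1 + ‖ξ‖ ^ 2 : ℝ) : ℂ) * FT f ξ) 2 volume := by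
  obtain ⟨u, hu, hc, hfu⟩ := hf
  set g : SchwartzMap (Sp d) ℂ := 𝓕 (hc.toSchwartzMap hu) with hg
  have ht : (fun x : Sp d => (1 : ℝ) + ‖x‖ ^ 2).HasTemperateGrowth :=
    (Function.HasTemperateGrowth.const 1).add (Function.hasTemperateGrowth_norm_sq (Sp d))
  have h := (SchwartzMap.smulLeftCLM (𝕜 := ℝ) ℂ (fun x : Sp d => (1 : ℝ) + ‖x‖ ^ 2) g).memLp 2 volume
  refine h.ae_eq ?_
  filter_upwards [coeFn_FT hu hc hfu] with ξ h1
  rw [SchwartzMap.smulLeftCLM_apply_apply ht, h1, Complex.real_smul, hg, SchwartzMap.fourier_coe]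
  rfl

theorem memLp_mul_FT_test {f : L2 d ℂ} (hf : f ∈ testFunctions d) {m : Sp d → ℂ}
    (hm : AEStronglyMeasurable m volume) {C : ℝ} (hC : ∀ ξ, ‖m ξ‖ ≤ C * (1 + ‖ξ‖ ^ 2)) :
    MemLp (fun ξ => m ξ * FT f ξ) 2 volume := by
  refine ((memLp_FT_test hf).const_mul (C : ℂ)).mono (hm.mul (Lp.aestronglyMeasurable _)) ?_
  refine Eventually.of_forall fun ξ => ?_
  have h1 : (0 : ℝ) ≤ 1 + ‖ξ‖ ^ 2 := by positivity
  have hC0 : 0 ≤ C := by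
    have := (norm_nonneg _).trans (hC 0)
    simpa using this
  rw [norm_mul, norm_mul, norm_mul, Complex.norm_real, Complex.norm_real, Real.norm_of_nonneg h1,
    Real.norm_of_nonneg hC0, ← mul_assoc]
  gcongr
  exact hC ξ

/-! #### Momentum as the generator of translations -/

theorem _root_.ContinuousLinearMap.hasDerivAt_comp {H H' : Type*} [NormedAddCommGroup H]
    [InnerProductSpace ℂ H] [NormedAddCommGroup H'] [InnerProductSpace ℂ H'] (L : H →L[ℂ] H')
    {f : ℝ → H} {f' : H} {t : ℝ} (h : HasDerivAt f f' t) :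
    HasDerivAt (fun s => L (f s)) (L f') t :=
  (L.restrictScalars ℝ).hasFDerivAt.comp_hasDerivAt t h

theorem hasDerivAt_isometry_iff {H H' : Type*} [NormedAddCommGroup H]
    [InnerProductSpace ℂ H] [NormedAddCommGroup H'] [InnerProductSpace ℂ H'] (e : H ≃ₗᵢ[ℂ] H')
    {f : ℝ → H} {f' : H} {t : ℝ} :
    HasDerivAt (fun s => e (f s)) (e f') t ↔ HasDerivAt f f' t := by
  constructor
  · intro h
    have := (e.symm.toContinuousLinearEquiv : H' →L[ℂ] H).hasDerivAt_comp h
    simpa using this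
  · intro h
    exact (e.toContinuousLinearEquiv : H →L[ℂ] H').hasDerivAt_comp h

theorem mem_momentum_graph {j : Fin d} {f g : L2 d ℂ} :
    (f, g) ∈ (momentum j).graph ↔ (FT g : Sp d → ℂ) =ᵐ[volume]
      fun ξ => ((2 * Real.pi * ξ j : ℝ) : ℂ) * FT f ξ := by
  rw [momentum, Submodule.toLinearPMap_graph_eq]
  · rfl
  · rintro ⟨f, g⟩ h hf
    simp only at hf
    subst hf
    have h' : (FT g : Sp d → ℂ) =ᵐ[volume] fun ξ => ((2 * Real.pi * ξ j : ℝ) : ℂ) *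
      FT (0 : L2 d ℂ) ξ := h
    have h0 : FT g = 0 := by
      refine Lp.ext ?_
      rw [_root_.map_zero] at h'
      filter_upwards [h', Lp.coeFn_zero ℂ 2 (volume : Measure (Sp d))] with x h1 h2
      rw [h1, h2, Pi.zero_apply, mul_zero]
    simpa using h0

/-- The Fourier transform carries translations along the `j`-th axis to multiplication by `e^{2πi t
ξ_j}`, whose generator is multiplication by `2πξ_j` with its maximal domain. -/
theorem momentum_graph (j : Fin d) :
    (momentum j).graph = genGraph (axis (shift : Sp d → (L2 d ℂ ≃ₗᵢ[ℂ] L2 d ℂ)) j) := by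
  ext ⟨f, g⟩
  rw [mem_momentum_graph, mem_genGraph, GenRel, ← hasDerivAt_isometry_iff FT]
  have e : (fun t => FT (axis (shift : Sp d → (L2 d ℂ ≃ₗᵢ[ℂ] L2 d ℂ)) j t f)) = fun t : ℝ =>
      expMul (fun ξ => ⟪(2 * Real.pi) • (t • EuclideanSpace.single j (1 : ℝ) : Sp d), ξ⟫_ℝ)
        (by fun_prop) (FT f) := by
    funext t
    rw [axis, FT_shift, phase_eq]
  rw [e, _root_.map_smul]
  refine (hasDerivAt_expMul_iff (m := fun ξ : Sp d => 2 * Real.pi * ξ j)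
    (θ := fun t ξ => ⟪(2 * Real.pi) • (t • EuclideanSpace.single j (1 : ℝ) : Sp d), ξ⟫_ℝ)
    (fun t => by fun_prop) ?_ (FT f) (FT g)).symm
  · intro t ξ
    rw [real_inner_smul_left, real_inner_smul_left, EuclideanSpace.inner_single_left]
    simp only [conj_trivial, one_mul]
    ring

theorem exists_genRel_shift {f : L2 d ℂ} (hf : f ∈ testFunctions d) (j : Fin d) :
    ∃ g, GenRel (axis (shift : Sp d → (L2 d ℂ ≃ₗᵢ[ℂ] L2 d ℂ)) j) f g := by
  have hm : MemLp (fun ξ => ((2 * Real.pi * ξ j : ℝ) : ℂ) * FT f ξ) 2 volume := by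
    refine memLp_mul_FT_test hf (C := 2 * Real.pi) (Continuous.aestronglyMeasurable (by fun_prop)) ?_
    intro ξ
    rw [Complex.norm_real, norm_mul, Real.norm_of_nonneg (by positivity)]
    have h1 : ‖ξ j‖ ≤ ‖ξ‖ := PiLp.norm_apply_le ξ j
    have h2 : ‖ξ‖ ≤ 1 + ‖ξ‖ ^ 2 := by nlinarith [sq_nonneg (‖ξ‖ - 1)]
    gcongr
    exact h1.trans h2
  refine ⟨FT.symm (hm.toLp _), ?_⟩
  rw [← mem_genGraph, ← momentum_graph, mem_momentum_graph, LinearIsometryEquiv.apply_symm_apply]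
  exact hm.coeFn_toLp

end Fourier

/-! ### Symmetric functions and creation operators -/

abbrev symL2_normedAddCommGroup (d n : ℕ) : NormedAddCommGroup (symL2 d n) :=
  Submodule.normedAddCommGroup _

abbrev symL2_module (d n : ℕ) : Module ℂ (symL2 d n) := Submodule.module _

abbrev symL2_innerProductSpace (d n : ℕ) : InnerProductSpace ℂ (symL2 d n) :=
  Submodule.innerProductSpace _

abbrev symL2_mulAction (d n : ℕ) : MulAction ℂ (symL2 d n) :=
  (symL2_module d n).toDistribMulAction.toMulAction

abbrev symL2_normedSpace (d n : ℕ) : NormedSpace ℂ (symL2 d n) := InnerProductSpace.toNormedSpace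

attribute [local instance] symL2_normedAddCommGroup symL2_module symL2_innerProductSpace
  symL2_mulAction symL2_normedSpace

section Sectors

variable {d n : ℕ}

/-- The action of a permutation on `L²((ℝ^d)^n)`. -/
def permL (σ : Equiv.Perm (Fin n)) : L2n d n →ₗᵢ[ℂ] L2n d n :=
  Lp.compMeasurePreservingₗᵢ ℂ (fun k : Fin n → Sp d => k ∘ σ) (measurePreserving_perm d n σ)

theorem coeFn_permL (σ : Equiv.Perm (Fin n)) (u : L2n d n) :
    permL σ u =ᵐ[volume] fun k => u (k ∘ σ) :=
  Lp.coeFn_compMeasurePreserving u (measurePreserving_perm d n σ)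

theorem ae_perm {p : (Fin n → Sp d) → Prop} (σ : Equiv.Perm (Fin n)) (h : ∀ᵐ k, p k) :
    ∀ᵐ k : Fin n → Sp d, p (k ∘ σ) :=
  (measurePreserving_perm d n σ).quasiMeasurePreserving.ae h

theorem permL_mul (σ τ : Equiv.Perm (Fin n)) (u : L2n d n) :
    permL (σ * τ) u = permL σ (permL τ u) := by
  refine Lp.ext ?_
  filter_upwards [coeFn_permL (σ * τ) u, coeFn_permL σ (permL τ u),
    ae_perm σ (coeFn_permL τ u)] with k h1 h2 h3
  rw [h1, h2, h3]
  rfl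

theorem mem_symL2 {u : L2n d n} : u ∈ symL2 d n ↔ ∀ σ, permL σ u = u := by
  rw [symL2, Submodule.mem_iInf]
  rfl

theorem permL_coe (σ : Equiv.Perm (Fin n)) (u : symL2 d n) : permL σ (u : L2n d n) = u :=
  mem_symL2.1 u.2 σ

theorem ae_symm (u : symL2 d n) (σ : Equiv.Perm (Fin n)) :
    ∀ᵐ k, (u : L2n d n) (k ∘ σ) = (u : L2n d n) k := by
  have h := coeFn_permL σ (u : L2n d n)
  rw [permL_coe] at h
  filter_upwards [h] with k hk
  exact hk.symm

theorem mem_symL2_of_ae {u : L2n d n}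
    (h : ∀ σ : Equiv.Perm (Fin n), ∀ᵐ k, u (k ∘ σ) = u k) : u ∈ symL2 d n := by
  refine mem_symL2.2 fun σ => Lp.ext ?_
  filter_upwards [coeFn_permL σ u, h σ] with k h1 h2
  rw [h1, h2]

/-- The symmetrization of a function. -/
def symAvg (u : L2n d n) : L2n d n :=
  ((Nat.factorial n : ℂ))⁻¹ • ∑ σ : Equiv.Perm (Fin n), permL σ u

/-- The average over the permutation group is invariant because left multiplication permutes the
group, and it has the same inner product as `u` with every invariant vector; these two facts
characterize the projection. -/
theorem coe_proj_symL2 (u : L2n d n) :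
    ((symL2 d n).orthogonalProjectionOnto u : L2n d n) = symAvg u := by
  rw [Submodule.coe_orthogonalProjectionOnto_apply]
  refine Submodule.eq_starProjection_of_mem_of_inner_eq_zero ?_ ?_
  · refine mem_symL2.2 fun τ => ?_
    rw [symAvg, _root_.map_smul, map_sum]
    simp only [← permL_mul]
    congr 1
    exact Fintype.sum_equiv (Equiv.mulLeft τ) _ _ fun σ => rfl
  · intro w hw
    have h : ∀ σ : Equiv.Perm (Fin n), ⟪permL σ u, w⟫_ℂ = ⟪u, w⟫_ℂ := fun σ => by
      conv_lhs => rw [← mem_symL2.1 hw σ, LinearIsometry.inner_map_map]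
    have hn : (Nat.factorial n : ℂ) ≠ 0 := by exact_mod_cast Nat.factorial_ne_zero n
    rw [symAvg, inner_sub_left, inner_smul_left, sum_inner, Finset.sum_congr rfl fun σ _ => h σ,
      Finset.sum_const, Finset.card_univ, Fintype.card_perm, Fintype.card_fin, nsmul_eq_mul,
      map_inv₀, Complex.conj_natCast, ← mul_assoc, inv_mul_cancel₀ hn, one_mul, sub_self]

theorem coeFn_symAvg (u : L2n d n) :
    symAvg u =ᵐ[volume] fun k => ((Nat.factorial n : ℂ))⁻¹ * ∑ σ : Equiv.Perm (Fin n), u (k ∘ σ) := by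
  have h1 : ∀ s : Finset (Equiv.Perm (Fin n)), (∑ σ ∈ s, permL σ u : L2n d n) =ᵐ[volume]
      fun k => ∑ σ ∈ s, u (k ∘ σ) := by
    intro s
    classical
    induction s using Finset.induction_on with
    | empty =>
      simp only [Finset.sum_empty]
      exact Lp.coeFn_zero ℂ 2 (volume : Measure (Fin n → Sp d))
    | insert σ s hσ ih =>
      rw [Finset.sum_insert hσ]
      filter_upwards [Lp.coeFn_add (permL σ u) (∑ σ ∈ s, permL σ u), ih,
        coeFn_permL σ u] with k h1 h2 h3
      rw [h1, Pi.add_apply, h2, h3, Finset.sum_insert hσ]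
  filter_upwards [Lp.coeFn_smul ((Nat.factorial n : ℂ))⁻¹ (∑ σ : Equiv.Perm (Fin n), permL σ u),
    h1 Finset.univ] with k h2 h3
  rw [symAvg, h2, Pi.smul_apply, h3, smul_eq_mul]

theorem coeFn_tensorL (h : L2 d ℂ) (ψ : L2n d n) : tensorL n h ψ =ᵐ[volume] tensorFun h ψ :=
  MemLp.coeFn_toLp (memLp_tensorFun h ψ)

theorem coe_createN (h : L2 d ℂ) (ψ : symL2 d n) :
    (createN n h ψ : L2n d (n + 1)) = ((√((n : ℝ) + 1) : ℝ) : ℂ) • symAvg (tensorL n h ψ) := by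
  rw [← coe_proj_symL2]
  rfl

/-- The normalization constant of the creation operator. -/
def createConst (n : ℕ) : ℂ := ((√((n : ℝ) + 1) : ℝ) : ℂ) * ((Nat.factorial (n + 1) : ℂ))⁻¹

theorem coeFn_createN (h : L2 d ℂ) (ψ : symL2 d n) :
    (createN n h ψ : L2n d (n + 1)) =ᵐ[volume] fun k =>
      createConst n * ∑ σ : Equiv.Perm (Fin (n + 1)), tensorFun h (ψ : L2n d n) (k ∘ σ) := by
  have h1 : ∀ᵐ k : Fin (n + 1) → Sp d, ∀ σ : Equiv.Perm (Fin (n + 1)),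
      (tensorL n h ψ) (k ∘ σ) = tensorFun h (ψ : L2n d n) (k ∘ σ) :=
    ae_all_iff.2 fun σ => ae_perm σ (coeFn_tensorL h (ψ : L2n d n))
  rw [coe_createN]
  filter_upwards [Lp.coeFn_smul ((√((n : ℝ) + 1) : ℝ) : ℂ) (symAvg (tensorL n h ψ)),
    coeFn_symAvg (tensorL n h ψ), h1] with k h2 h3 h4
  rw [h2, Pi.smul_apply, h3, smul_eq_mul, createConst, mul_assoc]
  simp only [h4]

theorem quasi_head (d n : ℕ) : Measure.QuasiMeasurePreserving
    (fun k : Fin (n + 1) → Sp d => k 0) volume volume :=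
  Measure.quasiMeasurePreserving_fst.comp (measurePreserving_split d n).quasiMeasurePreserving

theorem tensorL_add (h h' : L2 d ℂ) (ψ : L2n d n) :
    tensorL n (h + h') ψ = tensorL n h ψ + tensorL n h' ψ := by
  refine Lp.ext ?_
  filter_upwards [coeFn_tensorL (h + h') ψ, coeFn_tensorL h ψ, coeFn_tensorL h' ψ,
    Lp.coeFn_add (tensorL n h ψ) (tensorL n h' ψ),
    (quasi_head d n).ae (Lp.coeFn_add h h')] with k h1 h2 h3 h4 h5
  rw [h1, h4, Pi.add_apply, h2, h3, tensorFun, tensorFun, tensorFun, h5, Pi.add_apply, add_mul]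

theorem tensorL_smul (c : ℂ) (h : L2 d ℂ) (ψ : L2n d n) :
    tensorL n (c • h) ψ = c • tensorL n h ψ := by
  refine Lp.ext ?_
  filter_upwards [coeFn_tensorL (c • h) ψ, coeFn_tensorL h ψ,
    Lp.coeFn_smul c (tensorL n h ψ), (quasi_head d n).ae (Lp.coeFn_smul c h)] with k h1 h2 h4 h5
  rw [h1, h4, Pi.smul_apply, h2, tensorFun, tensorFun, h5, Pi.smul_apply, smul_eq_mul, smul_eq_mul,
    mul_assoc]

theorem norm_tensorL_apply (h : L2 d ℂ) (ψ : L2n d n) : ‖tensorL n h ψ‖ = ‖h‖ * ‖ψ‖ := by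
  change ‖(memLp_tensorFun h ψ).toLp _‖ = _
  rw [Lp.norm_toLp, eLpNorm_tensorFun, ENNReal.toReal_mul, Lp.norm_def, Lp.norm_def]

theorem createN_apply (h : L2 d ℂ) (ψ : symL2 d n) :
    createN n h ψ = ((√((n : ℝ) + 1) : ℝ) : ℂ) •
      (symL2 d (n + 1)).orthogonalProjectionOnto (tensorL n h (ψ : L2n d n)) := rfl

theorem norm_createN_le (h : L2 d ℂ) : ‖createN n h‖ ≤ √((n : ℝ) + 1) * ‖h‖ := by
  refine ContinuousLinearMap.opNorm_le_bound _ (by positivity) fun ψ => ?_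
  rw [createN_apply, norm_smul, Complex.norm_real, Real.norm_of_nonneg (by positivity), mul_assoc]
  gcongr
  refine ((symL2 d (n + 1)).norm_orthogonalProjectionOnto_apply_le _).trans ?_
  rw [norm_tensorL_apply]
  rfl

/-- The creation operator as a linear function of its argument. -/
def createLin {d : ℕ} (n : ℕ) : L2 d ℂ →L[ℂ] (symL2 d n →L[ℂ] symL2 d (n + 1)) :=
  LinearMap.mkContinuous
    { toFun := fun h : L2 d ℂ => createN n h
      map_add' := by
        intro h h'
        ext1 ψ
        simp only [createN_apply, add_apply, tensorL_add, _root_.map_add, smul_add]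
      map_smul' := by
        intro c h
        ext1 ψ
        rw [RingHom.id_apply, smul_apply, createN_apply, createN_apply, tensorL_smul,
          _root_.map_smul, smul_comm] }
    (√((n : ℝ) + 1)) (fun h => norm_createN_le h)

theorem createLin_apply (h : L2 d ℂ) : createLin n h = createN n h := rfl

theorem continuous_createN : Continuous (createN n : L2 d ℂ → _) := (createLin n).continuous

/-! #### Totality of products -/

/-- Measurable rectangles form a π-system generating the product σ-algebra. On boxes of finite
measure `f` is integrable, so vanishing integrals pass from rectangles to all measurable sets; the
boxes exhaust the space. -/
theorem ae_eq_zero_of_forall_rectangle {X Y : Type*} [MeasurableSpace X] [MeasurableSpace Y]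
    {μ : Measure X} {ν : Measure Y} [SigmaFinite μ] [SigmaFinite ν] {f : X × Y → ℂ}
    (hf : MemLp f 2 (μ.prod ν))
    (h : ∀ A B, MeasurableSet A → MeasurableSet B → μ A < ⊤ → ν B < ⊤ →
      ∫ z in A ×ˢ B, f z ∂(μ.prod ν) = 0) : f =ᵐ[μ.prod ν] 0 := by
  have hInt : ∀ s, MeasurableSet s → μ.prod ν s < ⊤ → IntegrableOn f s (μ.prod ν) := by
    intro s _ hs'
    have : IsFiniteMeasure ((μ.prod ν).restrict s) := ⟨by simpa using hs'⟩
    exact (hf.restrict s).integrable (by norm_num)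
  have key : ∀ N, f =ᵐ[(μ.prod ν).restrict (spanningSets μ N ×ˢ spanningSets ν N)] 0 := by
    intro N
    set S := spanningSets μ N ×ˢ spanningSets ν N with hS
    have hSm : MeasurableSet S := (measurableSet_spanningSets μ N).prod (measurableSet_spanningSets ν N)
    have hSfin : μ.prod ν S < ⊤ := by
      rw [hS, Measure.prod_prod]
      exact ENNReal.mul_lt_top (measure_spanningSets_lt_top μ N) (measure_spanningSets_lt_top ν N)
    have hI : IntegrableOn f S (μ.prod ν) := hInt S hSm hSfin
    refine Integrable.ae_eq_zero_of_forall_setIntegral_eq_zero hI fun s hs _ => ?_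
    rw [Measure.restrict_restrict hs]
    refine MeasurableSpace.induction_on_inter
      (C := fun s _ => ∫ z in s ∩ S, f z ∂(μ.prod ν) = 0) generateFrom_prod.symm isPiSystem_prod
      ?_ ?_ ?_ ?_ s hs
    · simp
    · rintro _ ⟨A, hA, B, hB, rfl⟩
      rw [hS, Set.prod_inter_prod]
      refine h _ _ (hA.inter (measurableSet_spanningSets μ N))
        (hB.inter (measurableSet_spanningSets ν N)) ?_ ?_
      · exact (measure_mono Set.inter_subset_right).trans_lt (measure_spanningSets_lt_top μ N)
      · exact (measure_mono Set.inter_subset_right).trans_lt (measure_spanningSets_lt_top ν N)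
    · intro t ht ih
      have hSS : ∫ z in S, f z ∂(μ.prod ν) = 0 :=
        h _ _ (measurableSet_spanningSets μ N) (measurableSet_spanningSets ν N)
          (measure_spanningSets_lt_top μ N) (measure_spanningSets_lt_top ν N)
      have h1 := integral_inter_add_sdiff (s := S) ht hI
      rw [Set.inter_comm, ih, zero_add, hSS] at h1
      rw [Set.inter_comm, ← Set.sdiff_eq]
      exact h1
    · intro t hdisj ht ih
      rw [Set.iUnion_inter, integral_iUnion (fun i => (ht i).inter hSm)
        (fun i j hij => (hdisj hij).mono Set.inter_subset_left Set.inter_subset_left)]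
      · simp [ih]
      · exact hI.mono_set (Set.iUnion_subset fun i => Set.inter_subset_right)
  have hU : (⋃ N, spanningSets μ N ×ˢ spanningSets ν N) = Set.univ := by
    refine Set.eq_univ_of_forall fun z => ?_
    have h1 := monotone_spanningSets μ
    have h2 := monotone_spanningSets ν
    have h3 : z.1 ∈ ⋃ N, spanningSets μ N := by rw [iUnion_spanningSets]; trivial
    have h4 : z.2 ∈ ⋃ N, spanningSets ν N := by rw [iUnion_spanningSets]; trivial
    obtain ⟨a, ha⟩ := Set.mem_iUnion.1 h3
    obtain ⟨b, hb⟩ := Set.mem_iUnion.1 h4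
    exact Set.mem_iUnion.2 ⟨max a b, h1 (le_max_left _ _) ha, h2 (le_max_right _ _) hb⟩
  rw [← Measure.restrict_univ (μ := μ.prod ν), ← hU, EventuallyEq, ae_restrict_iUnion_iff]
  exact key

/-- Testing with products of indicator functions gives the integrals of `χ` over all rectangles of
finite measure. -/
theorem eq_zero_of_forall_tensorL {χ : L2n d (n + 1)}
    (h : ∀ (f : L2 d ℂ) (ψ : L2n d n), ⟪tensorL n f ψ, χ⟫_ℂ = 0) : χ = 0 := by
  set e := MeasurableEquiv.piFinSuccAbove (fun _ : Fin (n + 1) => Sp d) 0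
  have he : MeasurePreserving e volume (volume.prod volume) := measurePreserving_split d n
  set f : Sp d × (Fin n → Sp d) → ℂ := fun z => χ (e.symm z) with hf
  have hfe : ∀ k, f (e k) = χ k := fun k => by rw [hf]; simp
  have hfm : MemLp f 2 (volume.prod volume) := (Lp.memLp χ).comp_measurePreserving he.symm
  have hz : f =ᵐ[volume.prod volume] 0 := by
    refine ae_eq_zero_of_forall_rectangle hfm fun A B hA hB hA' hB' => ?_
    have h0 := h (indicatorConstLp 2 hA hA'.ne 1) (indicatorConstLp 2 hB hB'.ne 1)
    rw [L2.inner_def] at h0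
    have h1 : ∫ k, f (e k) * (A ×ˢ B).indicator (fun _ => (1 : ℂ)) (e k) = 0 := by
      rw [← h0]
      refine integral_congr_ae ?_
      filter_upwards [coeFn_tensorL (indicatorConstLp 2 hA hA'.ne 1 : L2 d ℂ)
        (indicatorConstLp 2 hB hB'.ne 1 : L2n d n), (quasi_head d n).ae
        (indicatorConstLp_coeFn (p := 2) (hs := hA) (hμs := hA'.ne) (c := (1 : ℂ))),
        (quasi_tail d n).ae
        (indicatorConstLp_coeFn (p := 2) (hs := hB) (hμs := hB'.ne) (c := (1 : ℂ)))] with k a1 a2 a3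
      rw [a1, tensorFun, a2, a3, hfe, RCLike.inner_apply]
      have ek : e k = (k 0, fun i => k i.succ) := rfl
      rw [ek]
      by_cases p1 : k 0 ∈ A <;> by_cases p2 : (fun i : Fin n => k i.succ) ∈ B <;> simp [p1, p2]
    rw [he.integral_comp e.measurableEmbedding
      (fun z => f z * (A ×ˢ B).indicator (fun _ => (1 : ℂ)) z)] at h1
    rw [← integral_indicator (hA.prod hB), ← h1]
    congr 1
    funext z
    by_cases hz : z ∈ A ×ˢ B <;> simp [hz]
  refine Lp.ext ?_
  filter_upwards [he.quasiMeasurePreserving.ae hz,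
    Lp.coeFn_zero ℂ 2 (volume : Measure (Fin (n + 1) → Sp d))] with k h1 h2
  rw [h2, ← hfe, h1]
  rfl

/-- The permutation of `Fin (n+1)` fixing `0` and acting as `σ` on the rest. -/
theorem tensorL_permL (f : L2 d ℂ) (ψ : L2n d n) (σ : Equiv.Perm (Fin n)) :
    ∃ τ : Equiv.Perm (Fin (n + 1)), tensorL n f (permL σ ψ) = permL τ (tensorL n f ψ) := by
  refine ⟨Equiv.Perm.decomposeFin.symm (0, σ), Lp.ext ?_⟩
  filter_upwards [coeFn_tensorL f (permL σ ψ), coeFn_permL (Equiv.Perm.decomposeFin.symm (0, σ))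
    (tensorL n f ψ), ae_perm (Equiv.Perm.decomposeFin.symm (0, σ)) (coeFn_tensorL f ψ),
    (quasi_tail d n).ae (coeFn_permL σ ψ)] with k h1 h2 h3 h4
  rw [h1, h2, h3, tensorFun, tensorFun, h4]
  have e1 : (k ∘ (Equiv.Perm.decomposeFin.symm (0, σ))) 0 = k 0 := by simp
  have e2 : (fun i : Fin n => (k ∘ (Equiv.Perm.decomposeFin.symm (0, σ))) i.succ) =
      (fun i => k i.succ) ∘ σ := by
    funext i
    simp
  rw [e1, e2]

theorem inner_createN (h : L2 d ℂ) (ψ : symL2 d n) (χ : symL2 d (n + 1)) :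
    ⟪createN n h ψ, χ⟫_ℂ =
      ((√((n : ℝ) + 1) : ℝ) : ℂ) * ⟪tensorL n h (ψ : L2n d n), (χ : L2n d (n + 1))⟫_ℂ := by
  rw [createN_apply, inner_smul_left, Complex.conj_ofReal,
    Submodule.inner_orthogonalProjectionOnto_eq_of_mem_right]

/-- Since `χ` is symmetric, `f ⊗ ψ` and `f ⊗ Sψ`, with `S` the symmetrization in the last variables,
have the same inner product with `χ`; so symmetric `ψ` suffice. -/
theorem eq_zero_of_forall_createN {χ : symL2 d (n + 1)}
    (h : ∀ (f : L2 d ℂ) (ψ : symL2 d n), ⟪createN n f ψ, χ⟫_ℂ = 0) : χ = 0 := by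
  have hs : ((√((n : ℝ) + 1) : ℝ) : ℂ) ≠ 0 := by
    have : (0 : ℝ) < √((n : ℝ) + 1) := by positivity
    exact_mod_cast this.ne'
  have h1 : (χ : L2n d (n + 1)) = 0 := by
    refine eq_zero_of_forall_tensorL fun f ψ => ?_
    have h2 := h f ((symL2 d n).orthogonalProjectionOnto ψ)
    rw [inner_createN, mul_eq_zero, or_iff_right hs, coe_proj_symL2, symAvg, _root_.map_smul,
      map_sum, inner_smul_left, sum_inner] at h2
    have h3 : ∀ σ : Equiv.Perm (Fin n), ⟪tensorL n f (permL σ ψ), (χ : L2n d (n + 1))⟫_ℂ =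
        ⟪tensorL n f ψ, (χ : L2n d (n + 1))⟫_ℂ := by
      intro σ
      obtain ⟨τ, hτ⟩ := tensorL_permL f ψ σ
      rw [hτ]
      conv_lhs => rw [← permL_coe τ χ, LinearIsometry.inner_map_map]
    have hn : (Nat.factorial n : ℂ) ≠ 0 := by exact_mod_cast Nat.factorial_ne_zero n
    rw [Finset.sum_congr rfl fun σ _ => h3 σ, Finset.sum_const, Finset.card_univ,
      Fintype.card_perm, Fintype.card_fin, nsmul_eq_mul, map_inv₀, Complex.conj_natCast,
      ← mul_assoc, inv_mul_cancel₀ hn, one_mul] at h2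
    exact h2
  exact Subtype.ext h1

end Sectors

/-! ### Second quantized translations -/

section SectorUnitary

variable {d n : ℕ}

/-- `k · (q_1 + ⋯ + q_n)`. -/
def phaseSum (n : ℕ) (k : Sp d) (q : Fin n → Sp d) : ℝ := ∑ i, ⟪k, q i⟫_ℝ

theorem measurable_phaseSum (k : Sp d) : Measurable (phaseSum n k) := by
  unfold phaseSum
  fun_prop

theorem phaseSum_perm (k : Sp d) (q : Fin n → Sp d) (σ : Equiv.Perm (Fin n)) :
    phaseSum n k (q ∘ σ) = phaseSum n k q :=
  Equiv.sum_comp σ fun i => ⟪k, q i⟫_ℝ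

theorem expMul_phaseSum_mem (k : Sp d) (u : symL2 d n) :
    expMul (phaseSum n k) (measurable_phaseSum k) (u : L2n d n) ∈ symL2 d n := by
  refine mem_symL2_of_ae fun σ => ?_
  filter_upwards [coeFn_expMul (measurable_phaseSum k) (u : L2n d n),
    ae_perm σ (coeFn_expMul (measurable_phaseSum k) (u : L2n d n)), ae_symm u σ] with q h1 h2 h3
  rw [h1, h2, phaseSum_perm, h3]

/-- `exp(i k · P_f)` on the `n`-particle sector. -/
def symU (n : ℕ) (k : Sp d) : symL2 d n ≃ₗᵢ[ℂ] symL2 d n where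
  toFun u := ⟨expMul (phaseSum n k) (measurable_phaseSum k) (u : L2n d n), expMul_phaseSum_mem k u⟩
  invFun u :=
    ⟨expMul (phaseSum n (-k)) (measurable_phaseSum (-k)) (u : L2n d n), expMul_phaseSum_mem (-k) u⟩
  map_add' u v := Subtype.ext (by simp)
  map_smul' c u := Subtype.ext (by simp)
  left_inv u := Subtype.ext (by
    change expMul _ _ (expMul _ _ (u : L2n d n)) = u
    rw [← expMul_expMul (θ'' := fun _ => 0) _ _ _ measurable_const
      (fun q => by simp [phaseSum]), expMul_zero _ _ fun _ => rfl])
  right_inv u := Subtype.ext (by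
    change expMul _ _ (expMul _ _ (u : L2n d n)) = u
    rw [← expMul_expMul (θ'' := fun _ => 0) _ _ _ measurable_const
      (fun q => by simp [phaseSum]), expMul_zero _ _ fun _ => rfl])
  norm_map' u := (expMul (phaseSum n k) (measurable_phaseSum k)).norm_map (u : L2n d n)

theorem coe_symU (k : Sp d) (u : symL2 d n) : (symU n k u : L2n d n) =
    expMul (phaseSum n k) (measurable_phaseSum k) (u : L2n d n) := rfl

theorem symU_zero (u : symL2 d n) : symU n 0 u = u :=
  Subtype.ext (expMul_zero _ _ fun q => by simp [phaseSum])

theorem symU_add (k l : Sp d) (u : symL2 d n) : symU n (k + l) u = symU n k (symU n l u) :=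
  Subtype.ext (expMul_expMul _ _ _ _ fun q => by
    simp [phaseSum, inner_add_left, Finset.sum_add_distrib])

theorem continuous_symU (u : symL2 d n) : Continuous fun k => symU n k u := by
  refine Continuous.subtype_mk (continuous_expMul _ (fun q => ?_) _) _
  unfold phaseSum
  fun_prop

theorem coeFn_symU (k : Sp d) (u : symL2 d n) : (symU n k u : L2n d n) =ᵐ[volume]
    fun q => Complex.exp (Complex.I * (phaseSum n k q : ℂ)) * (u : L2n d n) q := by
  rw [coe_symU]
  exact coeFn_expMul (measurable_phaseSum k) (u : L2n d n)

theorem tensorFun_phase (k : Sp d) (h : L2 d ℂ) (ψ : symL2 d n) :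
    ∀ᵐ q : Fin (n + 1) → Sp d, tensorFun (phase k h) (symU n k ψ : L2n d n) q =
      Complex.exp (Complex.I * (phaseSum (n + 1) k q : ℂ)) * tensorFun h (ψ : L2n d n) q := by
  filter_upwards [(quasi_head d n).ae (coeFn_phase k h),
    (quasi_tail d n).ae (coeFn_symU k ψ)] with q h1 h2
  have h3 : phaseSum (n + 1) k q = ⟪k, q 0⟫_ℝ + phaseSum n k fun i => q i.succ :=
    Fin.sum_univ_succ _
  rw [tensorFun, tensorFun, h1, h2, h3, smul_eq_mul, Complex.ofReal_add, mul_add, Complex.exp_add]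
  ring

/-- The character `e^{ik·(q_0 + ⋯ + q_n)}` is symmetric, so it commutes with symmetrization, and it
factors into the phase of the new particle and that of the old ones. -/
theorem symU_createN (k : Sp d) (h : L2 d ℂ) (ψ : symL2 d n) :
    symU (n + 1) k (createN n h ψ) = createN n (phase k h) (symU n k ψ) := by
  refine Subtype.ext (Lp.ext ?_)
  have h1 : ∀ᵐ q : Fin (n + 1) → Sp d, ∀ σ : Equiv.Perm (Fin (n + 1)),
      tensorFun (phase k h) (symU n k ψ : L2n d n) (q ∘ σ) =
      Complex.exp (Complex.I * (phaseSum (n + 1) k (q ∘ σ) : ℂ)) *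
        tensorFun h (ψ : L2n d n) (q ∘ σ) :=
    ae_all_iff.2 fun σ => ae_perm σ (tensorFun_phase k h ψ)
  filter_upwards [coeFn_symU k (createN n h ψ), coeFn_createN h ψ,
    coeFn_createN (phase k h) (symU n k ψ), h1] with q h2 h3 h4 h5
  rw [h2, h3, h4]
  simp only [h5, phaseSum_perm]
  rw [← Finset.mul_sum]
  ring

/-- The adjoint of the intertwining relation for creation, using that `symU` is unitary. -/
theorem symU_adjoint_createN (k : Sp d) (h : L2 d ℂ) (ψ : symL2 d (n + 1)) :
    symU n k (ContinuousLinearMap.adjoint (createN n h) ψ) =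
      ContinuousLinearMap.adjoint (createN n (phase k h)) (symU (n + 1) k ψ) := by
  refine ext_inner_left ℂ fun φ => ?_
  obtain ⟨φ, rfl⟩ := (symU n k).surjective φ
  rw [LinearIsometryEquiv.inner_map_map, ContinuousLinearMap.adjoint_inner_right,
    ContinuousLinearMap.adjoint_inner_right, ← symU_createN, LinearIsometryEquiv.inner_map_map]

/-- `exp(i k · P_f)` on sequences. -/
def seqU (k : Sp d) : FockSeq d →ₗ[ℂ] FockSeq d where
  toFun ψ n := symU n k (ψ n)
  map_add' ψ φ := funext fun n => by simp
  map_smul' c ψ := funext fun n => by simp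

theorem seqU_apply (k : Sp d) (ψ : FockSeq d) (n : ℕ) : seqU k ψ n = symU n k (ψ n) := rfl

theorem seqU_create (k : Sp d) (h : L2 d ℂ) (ψ : FockSeq d) :
    seqU k (create h ψ) = create (phase k h) (seqU k ψ) := by
  funext n
  cases n with
  | zero => exact (symU 0 k).map_zero
  | succ n => exact symU_createN k h (ψ n)

theorem seqU_annihilate (k : Sp d) (h : L2 d ℂ) (ψ : FockSeq d) :
    seqU k (annihilate h ψ) = annihilate (phase k h) (seqU k ψ) :=
  funext fun n => symU_adjoint_createN k h (ψ (n + 1))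

theorem seqU_vacuum (k : Sp d) : seqU k (vacuum d) = vacuum d := by
  funext n
  rw [seqU_apply]
  by_cases hn : n = 0
  · subst hn
    rw [vacuum, Pi.single_eq_same]
    exact Subtype.ext (expMul_zero _ _ fun q => by simp [phaseSum])
  · rw [vacuum, Pi.single_eq_of_ne hn, _root_.map_zero]

/-- Translation covariance of the field: the phase `e^{ik·q}` turns the coupling `e^{-i(x+k)·q} g`
into `e^{-ix·q} g`. -/
theorem seqU_fieldOp (k : Sp d) (g : L2 d ℂ) (x : Sp d) (ψ : FockSeq d) :
    seqU k (fieldOp g (x + k) ψ) = fieldOp g x (seqU k ψ) := by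
  have hp : phase k (phase (-(x + k)) g) = phase (-x) g := by
    rw [← phase_add]
    congr 1
    abel
  simp only [fieldOp, LinearMap.smul_apply, LinearMap.add_apply, _root_.map_smul, _root_.map_add,
    seqU_create, seqU_annihilate, hp]

theorem memℓp_symU (k : Sp d) (ψ : Fock d) : Memℓp (fun n => symU n k (ψ n)) 2 :=
  (lp.memℓp ψ).mono' fun n => ((symU n k).norm_map _).le

/-- `exp(i k · P_f)` on Fock space. -/
def fockU (k : Sp d) : Fock d ≃ₗᵢ[ℂ] Fock d where
  toFun ψ := ⟨fun n => symU n k (ψ n), memℓp_symU k ψ⟩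
  invFun ψ := ⟨fun n => symU n (-k) (ψ n), memℓp_symU (-k) ψ⟩
  map_add' ψ φ := lp.ext (funext fun n => (symU n k).map_add _ _)
  map_smul' c ψ := lp.ext (funext fun n => (symU n k).map_smul _ _)
  left_inv ψ := lp.ext (funext fun n => by
    change symU n (-k) (symU n k (ψ n)) = ψ n
    rw [← symU_add, neg_add_cancel, symU_zero])
  right_inv ψ := lp.ext (funext fun n => by
    change symU n k (symU n (-k) (ψ n)) = ψ n
    rw [← symU_add, add_neg_cancel, symU_zero])
  norm_map' ψ := by
    rw [lp.norm_eq_tsum_rpow (by norm_num), lp.norm_eq_tsum_rpow (by norm_num)]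
    congr 2
    funext n
    congr 1
    exact (symU n k).norm_map (ψ n)

theorem fockU_apply (k : Sp d) (ψ : Fock d) (n : ℕ) : fockU k ψ n = symU n k (ψ n) := rfl

theorem fockU_zero (ψ : Fock d) : fockU 0 ψ = ψ :=
  lp.ext (funext fun n => symU_zero (ψ n))

theorem fockU_add (k l : Sp d) (ψ : Fock d) : fockU (k + l) ψ = fockU k (fockU l ψ) :=
  lp.ext (funext fun n => symU_add k l (ψ n))

/-! ### Finite particle vectors -/

/-- The coordinates of a vector in Fock space. -/
def toSeq : Fock d →ₗ[ℂ] FockSeq d where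
  toFun ψ n := ψ n
  map_add' _ _ := rfl
  map_smul' _ _ := rfl

/-- The span of the vectors `a*(f_1) ⋯ a*(f_n) Ω` in the space of sequences. -/
def monoSpan (d : ℕ) : Submodule ℂ (FockSeq d) :=
  Submodule.span ℂ {ψ : FockSeq d | ∃ fs : List (L2 d ℂ), (∀ f ∈ fs, f ∈ testFunctions d) ∧
    ψ = (fs.map create).prod (vacuum d)}

theorem mem_fockFin {ψ : Fock d} : ψ ∈ fockFin d ↔ toSeq ψ ∈ monoSpan d := Iff.rfl

theorem vacuum_mem_monoSpan : vacuum d ∈ monoSpan d :=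
  Submodule.subset_span ⟨[], by simp, by simp⟩

theorem create_mem_monoSpan {h : L2 d ℂ} (hh : h ∈ testFunctions d) {ψ : FockSeq d}
    (hψ : ψ ∈ monoSpan d) : create h ψ ∈ monoSpan d := by
  refine Submodule.span_induction ?_ ?_ ?_ ?_ hψ
  · rintro _ ⟨fs, hfs, rfl⟩
    exact Submodule.subset_span ⟨h :: fs, List.forall_mem_cons.2 ⟨hh, hfs⟩, by simp⟩
  · rw [_root_.map_zero]
    exact Submodule.zero_mem _
  · intro x y _ _ hx hy
    rw [_root_.map_add]
    exact Submodule.add_mem _ hx hy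
  · intro c x _ hx
    rw [_root_.map_smul]
    exact Submodule.smul_mem _ c hx

/-- Induction principle for `monoSpan`. -/
theorem monoSpan_induction {p : FockSeq d → Prop} (hvac : p (vacuum d))
    (hcreate : ∀ h ∈ testFunctions d, ∀ ψ, p ψ → p (create h ψ)) (hzero : p 0)
    (hadd : ∀ ψ φ, p ψ → p φ → p (ψ + φ)) (hsmul : ∀ (c : ℂ) ψ, p ψ → p (c • ψ)) {ψ : FockSeq d}
    (hψ : ψ ∈ monoSpan d) : p ψ := by
  refine Submodule.span_induction ?_ hzero (fun x y _ _ => hadd x y) (fun c x _ => hsmul c x) hψ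
  rintro _ ⟨fs, hfs, rfl⟩
  induction fs with
  | nil => simpa using hvac
  | cons f fs ih =>
    simp only [List.map_cons, List.prod_cons, Module.End.mul_apply]
    exact hcreate f (hfs f (by simp)) _ (ih fun g hg => hfs g (by simp [hg]))

theorem seqU_mem_monoSpan (k : Sp d) {ψ : FockSeq d} (hψ : ψ ∈ monoSpan d) :
    seqU k ψ ∈ monoSpan d := by
  refine monoSpan_induction (p := fun ψ => seqU k ψ ∈ monoSpan d) ?_ ?_ ?_ ?_ ?_ hψ
  · rw [seqU_vacuum]
    exact vacuum_mem_monoSpan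
  · intro h hh ψ hψ
    rw [seqU_create]
    exact create_mem_monoSpan (phase_mem_testFunctions k hh) hψ
  · rw [_root_.map_zero]
    exact Submodule.zero_mem _
  · intro ψ φ h1 h2
    rw [_root_.map_add]
    exact Submodule.add_mem _ h1 h2
  · intro c ψ h
    rw [_root_.map_smul]
    exact Submodule.smul_mem _ c h

theorem fockU_mem_fockFin (k : Sp d) {ψ : Fock d} (hψ : ψ ∈ fockFin d) : fockU k ψ ∈ fockFin d :=
  seqU_mem_monoSpan k (mem_fockFin.1 hψ)

/-- Sequences with a bounded number of particles. -/
def FinSupp (ψ : FockSeq d) : Prop := ∃ N : ℕ, ∀ n, N < n → ψ n = 0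

theorem FinSupp.zero : FinSupp (0 : FockSeq d) := ⟨0, fun _ _ => rfl⟩

theorem FinSupp.add {ψ φ : FockSeq d} (hψ : FinSupp ψ) (hφ : FinSupp φ) : FinSupp (ψ + φ) := by
  obtain ⟨N, hN⟩ := hψ
  obtain ⟨M, hM⟩ := hφ
  refine ⟨max N M, fun n hn => ?_⟩
  rw [Pi.add_apply, hN n (lt_of_le_of_lt (le_max_left _ _) hn),
    hM n (lt_of_le_of_lt (le_max_right _ _) hn), add_zero]

theorem FinSupp.smul (c : ℂ) {ψ : FockSeq d} (hψ : FinSupp ψ) : FinSupp (c • ψ) := by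
  obtain ⟨N, hN⟩ := hψ
  exact ⟨N, fun n hn => by rw [Pi.smul_apply, hN n hn, smul_zero]⟩

theorem create_eq_zero {h : L2 d ℂ} {ψ : FockSeq d} {N : ℕ} (hN : ∀ n, N < n → ψ n = 0) :
    ∀ n, N + 1 < n → create h ψ n = 0 := by
  intro n hn
  cases n with
  | zero => rfl
  | succ n =>
    change createN n h (ψ n) = 0
    rw [hN n (by omega), _root_.map_zero]

theorem annihilate_eq_zero {h : L2 d ℂ} {ψ : FockSeq d} {N : ℕ} (hN : ∀ n, N < n → ψ n = 0) :
    ∀ n, N < n → annihilate h ψ n = 0 := by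
  intro n hn
  change ContinuousLinearMap.adjoint (createN n h) (ψ (n + 1)) = 0
  rw [hN (n + 1) (by omega), _root_.map_zero]

theorem FinSupp.create (h : L2 d ℂ) {ψ : FockSeq d} (hψ : FinSupp ψ) :
    FinSupp (create h ψ) := by
  obtain ⟨N, hN⟩ := hψ
  exact ⟨N + 1, create_eq_zero hN⟩

theorem FinSupp.vacuum : FinSupp (vacuum d) :=
  ⟨0, fun n hn => Pi.single_eq_of_ne (by omega) _⟩

theorem finSupp_of_mem {ψ : FockSeq d} (hψ : ψ ∈ monoSpan d) : FinSupp ψ :=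
  monoSpan_induction FinSupp.vacuum (fun h _ _ hψ => hψ.create h) FinSupp.zero
    (fun _ _ h1 h2 => h1.add h2) (fun c _ h => h.smul c) hψ

theorem eq_sum_single {ψ : Fock d} {N : ℕ} (hN : ∀ n, N < n → ψ n = 0) :
    ψ = ∑ n ∈ Finset.range (N + 1), lp.single 2 n (ψ n) := by
  refine lp.ext (funext fun n => ?_)
  rw [lp.coeFn_sum, Finset.sum_apply]
  by_cases hn : n ∈ Finset.range (N + 1)
  · rw [Finset.sum_eq_single n]
    · rw [lp.single_apply_self]
    · intro m _ hm
      rw [lp.single_apply_ne _ _ _ (Ne.symm hm)]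
    · exact fun h => absurd hn h
  · rw [hN n (by simpa using hn)]
    refine (Finset.sum_eq_zero fun m hm => ?_).symm
    rw [lp.single_apply_ne]
    rintro rfl
    exact hn hm

/-! ### Density of the finite particle vectors -/

/-- The `n`-particle vectors in `fockFin`. -/
def sectorFin (d n : ℕ) : Submodule ℂ (symL2 d n) :=
  (fockFin d).comap (lp.lsingle (𝕜 := ℂ) (E := fun n => symL2 d n) 2 n)

theorem mem_sectorFin {u : symL2 d n} :
    u ∈ sectorFin d n ↔ (Pi.single n u : FockSeq d) ∈ monoSpan d := by
  have : toSeq (lp.single 2 n u : Fock d) = Pi.single n u :=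
    lp.coeFn_single (E := fun n => symL2 d n) 2 n u
  rw [← this]
  rfl

theorem create_single (h : L2 d ℂ) (u : symL2 d n) :
    create h (Pi.single n u) = Pi.single (n + 1) (createN n h u) := by
  funext m
  cases m with
  | zero =>
    rw [Pi.single_eq_of_ne (by omega)]
    rfl
  | succ m =>
    change createN m h ((Pi.single n u : FockSeq d) m) = _
    by_cases hm : m = n
    · subst hm
      rw [Pi.single_eq_same, Pi.single_eq_same]
    · rw [Pi.single_eq_of_ne hm, Pi.single_eq_of_ne (by omega), _root_.map_zero]

theorem createN_mem_sectorFin {h : L2 d ℂ} (hh : h ∈ testFunctions d) {u : symL2 d n}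
    (hu : u ∈ sectorFin d n) : createN n h u ∈ sectorFin d (n + 1) := by
  rw [mem_sectorFin] at hu ⊢
  rw [← create_single]
  exact create_mem_monoSpan hh hu

theorem eq_zero_of_inner_vacuumZero {χ : symL2 d 0} (h : ⟪vacuumZero d, χ⟫_ℂ = 0) : χ = 0 := by
  have h1 : ∫ k, (χ : L2n d 0) k = 0 := by
    have h2 : ⟪(vacuumZero d : L2n d 0), (χ : L2n d 0)⟫_ℂ = 0 := h
    rw [L2.inner_def] at h2
    rw [← h2]
    refine integral_congr_ae ?_
    have hv : ((vacuumZero d : L2n d 0) : (Fin 0 → Sp d) → ℂ) =ᵐ[volume] fun _ => (1 : ℂ) :=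
      MemLp.coeFn_toLp (haveI := volume_fin_zero d; memLp_const (1 : ℂ) :
        MemLp (fun _ : Fin 0 → Sp d => (1 : ℂ)) 2 volume)
    filter_upwards [hv] with k hk
    rw [hk, RCLike.inner_apply]
    simp
  have h3 : ∀ k, (χ : L2n d 0) k = 0 := by
    intro k
    have hi : ∀ F : (Fin 0 → Sp d) → ℂ, ∫ q, F q = F k := by
      intro F
      rw [volume_pi, Measure.pi_of_empty _ k, integral_dirac]
    exact (hi _).symm.trans h1
  refine Subtype.ext (Lp.ext ?_)
  filter_upwards [Lp.coeFn_zero ℂ 2 (volume : Measure (Fin 0 → Sp d))] with k hk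
  rw [h3 k]
  exact hk.symm

/-- Induction on the particle number. A vector orthogonal to all `a*(f)ψ` with `f` a test function
and `ψ` in the dense set one level below is, by continuity, orthogonal to every `a*(f)ψ`, hence
zero. -/
theorem dense_sectorFin (n : ℕ) : Dense (sectorFin d n : Set (symL2 d n)) := by
  induction n with
  | zero =>
    rw [Submodule.dense_iff_topologicalClosure_eq_top, Submodule.topologicalClosure_eq_top_iff,
      Submodule.eq_bot_iff]
    intro χ hχ
    refine eq_zero_of_inner_vacuumZero (Submodule.inner_right_of_mem_orthogonal ?_ hχ)
    exact mem_sectorFin.2 vacuum_mem_monoSpan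
  | succ n ih =>
    rw [Submodule.dense_iff_topologicalClosure_eq_top, Submodule.topologicalClosure_eq_top_iff,
      Submodule.eq_bot_iff]
    intro χ hχ
    refine eq_zero_of_forall_createN fun f ψ => ?_
    have hc : Continuous fun p : L2 d ℂ × symL2 d n => ⟪createN n p.1 p.2, χ⟫_ℂ := by
      simp only [← createLin_apply]
      fun_prop
    have hd := (dense_testFunctions (d := d)).prod ih
    refine congrFun (Continuous.ext_on hd hc continuous_const ?_) (f, ψ)
    rintro ⟨f, ψ⟩ ⟨hf, hψ⟩
    exact Submodule.inner_right_of_mem_orthogonal (createN_mem_sectorFin hf hψ) hχ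

/-- Embedding a sector vector from `sectorFin` shows that each component of an orthogonal vector
vanishes. -/
theorem dense_fockFin : Dense (fockFin d : Set (Fock d)) := by
  rw [Submodule.dense_iff_topologicalClosure_eq_top, Submodule.topologicalClosure_eq_top_iff,
    Submodule.eq_bot_iff]
  intro φ hφ
  refine lp.ext (funext fun n => ?_)
  change φ n = 0
  refine (dense_sectorFin n).eq_zero_of_inner_left ℂ fun u hu => ?_
  have h1 : ⟪(lp.single 2 n u : Fock d), φ⟫_ℂ = 0 := Submodule.inner_right_of_mem_orthogonal hu hφ
  rw [lp.inner_single_left] at h1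
  rw [← inner_conj_symm, h1, _root_.map_zero]

theorem fockU_single (k : Sp d) (u : symL2 d n) :
    fockU k (lp.single 2 n u) = lp.single 2 n (symU n k u) := by
  refine lp.ext (funext fun m => ?_)
  rw [fockU_apply]
  by_cases hm : m = n
  · subst hm
    rw [lp.single_apply_self, lp.single_apply_self]
  · rw [lp.single_apply_ne _ _ _ hm, lp.single_apply_ne _ _ _ hm, _root_.map_zero]

/-- The embedding of the `n`-particle sector into Fock space. -/
def singleL (n : ℕ) : symL2 d n →L[ℂ] Fock d :=
  lp.singleContinuousLinearMap ℂ (fun n => symL2 d n) 2 n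

theorem singleL_apply (u : symL2 d n) : singleL n u = lp.single 2 n u := rfl

theorem continuous_single (n : ℕ) : Continuous fun u : symL2 d n => (lp.single 2 n u : Fock d) :=
  (singleL n).continuous

theorem continuous_apply_of_dense {X H : Type*} [TopologicalSpace X] [NormedAddCommGroup H]
    {U : X → H → H} (hU : ∀ x, Isometry (U x)) {D : Set H} (hD : Dense D)
    (h : ∀ ψ ∈ D, Continuous fun x => U x ψ) (ψ : H) : Continuous fun x => U x ψ :=
  (continuous_prod_of_dense_continuous_lipschitzWith (fun p : H × X => U p.2 p.1) 1 hD h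
    fun x => (hU x).lipschitz).comp (continuous_const.prodMk continuous_id)

/-- On finite particle vectors only finitely many sectors occur, each strongly continuous; isometry
extends continuity to the closure. -/
theorem continuous_fockU (ψ : Fock d) : Continuous fun k => fockU k ψ := by
  refine continuous_apply_of_dense (U := fun (k : Sp d) (ψ : Fock d) => fockU k ψ)
    (fun k => (fockU k).isometry) dense_fockFin ?_ ψ
  intro ψ hψ
  obtain ⟨N, hN⟩ := finSupp_of_mem (mem_fockFin.1 hψ)
  have e : ∀ k : Sp d, fockU k ψ =
      ∑ n ∈ Finset.range (N + 1), lp.single 2 n (symU n k (ψ n)) := by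
    intro k
    conv_lhs => rw [eq_sum_single (ψ := ψ) hN, map_sum]
    simp only [fockU_single]
  simp only [e]
  exact continuous_finsetSum _ fun n _ => (continuous_single n).comp (continuous_symU (ψ n))

theorem isUnitaryRep_fockU : IsUnitaryRep (fockU : Sp d → (Fock d ≃ₗᵢ[ℂ] Fock d)) where
  map_zero := fockU_zero
  map_add := fockU_add
  continuous := continuous_fockU

end SectorUnitary

/-! ### Multiplication operators on the sectors -/

section SectorMul

variable {d n : ℕ}

theorem mem_sectorMul_graph {m : ∀ n, (Fin n → Sp d) → ℝ} {ψ φ : Fock d} :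
    (ψ, φ) ∈ (sectorMul m).graph ↔ ∀ n, ((φ n : L2n d n) : (Fin n → Sp d) → ℂ) =ᵐ[volume]
      fun k => (m n k : ℂ) * (ψ n : L2n d n) k := by
  rw [sectorMul, Submodule.toLinearPMap_graph_eq]
  · rfl
  · rintro ⟨ψ, φ⟩ h hψ
    simp only at hψ
    subst hψ
    refine lp.ext (funext fun n => Subtype.ext (Lp.ext ?_))
    have h' : ((φ n : L2n d n) : (Fin n → Sp d) → ℂ) =ᵐ[volume]
      fun k => (m n k : ℂ) * (0 : L2n d n) k := h n
    change ((φ n : L2n d n) : (Fin n → Sp d) → ℂ) =ᵐ[volume] (0 : L2n d n)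
    filter_upwards [h', Lp.coeFn_zero ℂ 2 (volume : Measure (Fin n → Sp d))] with x h1 h2
    rw [h1, h2, Pi.zero_apply, mul_zero]

theorem sectorMul_symm {m : ∀ n, (Fin n → Sp d) → ℝ} {ψ φ ψ' φ' : Fock d}
    (h : (ψ, φ) ∈ (sectorMul m).graph) (h' : (ψ', φ') ∈ (sectorMul m).graph) :
    ⟪φ, ψ'⟫_ℂ = ⟪ψ, φ'⟫_ℂ := by
  rw [mem_sectorMul_graph] at h h'
  rw [lp.inner_eq_tsum, lp.inner_eq_tsum]
  refine tsum_congr fun n => ?_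
  change ⟪(φ n : L2n d n), (ψ' n : L2n d n)⟫_ℂ = ⟪(ψ n : L2n d n), (φ' n : L2n d n)⟫_ℂ
  rw [L2.inner_def, L2.inner_def]
  refine integral_congr_ae ?_
  filter_upwards [h n, h' n] with k h1 h2
  rw [h1, h2]
  simp only [RCLike.inner_apply, map_mul, Complex.conj_ofReal]
  ring

/-- Bounded functions with bounded support. -/
def Nice (u : L2n d n) : Prop :=
  ∃ R C : ℝ, ∀ᵐ k, ‖u k‖ ≤ C ∧ ((∃ i, R < ‖k i‖) → u k = 0)

theorem Nice.zero : Nice (0 : L2n d n) := by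
  refine ⟨0, 0, ?_⟩
  filter_upwards [Lp.coeFn_zero ℂ 2 (volume : Measure (Fin n → Sp d))] with k hk
  rw [hk]
  simp

theorem Nice.add {u v : L2n d n} (hu : Nice u) (hv : Nice v) : Nice (u + v) := by
  obtain ⟨R, C, h⟩ := hu
  obtain ⟨R', C', h'⟩ := hv
  refine ⟨max R R', C + C', ?_⟩
  filter_upwards [h, h', Lp.coeFn_add u v] with k h1 h2 h3
  rw [h3, Pi.add_apply]
  refine ⟨norm_add_le_of_le h1.1 h2.1, ?_⟩
  rintro ⟨i, hi⟩
  rw [h1.2 ⟨i, (le_max_left _ _).trans_lt hi⟩, h2.2 ⟨i, (le_max_right _ _).trans_lt hi⟩, add_zero]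

theorem Nice.smul (c : ℂ) {u : L2n d n} (hu : Nice u) : Nice (c • u) := by
  obtain ⟨R, C, h⟩ := hu
  refine ⟨R, ‖c‖ * C, ?_⟩
  filter_upwards [h, Lp.coeFn_smul c u] with k h1 h3
  rw [h3, Pi.smul_apply, norm_smul]
  refine ⟨by gcongr; exact h1.1, fun hi => ?_⟩
  rw [h1.2 hi, smul_zero]

theorem exists_bound_of_mem_testFunctions {f : L2 d ℂ} (hf : f ∈ testFunctions d) :
    ∃ R C : ℝ, ∀ᵐ x, ‖f x‖ ≤ C ∧ (R < ‖x‖ → f x = 0) := by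
  obtain ⟨u, hu, hc, h⟩ := hf
  obtain ⟨C, hC⟩ := hc.exists_bound_of_continuous hu.continuous
  obtain ⟨R, hR⟩ := hc.isCompact.isBounded.exists_norm_le
  refine ⟨R, C, ?_⟩
  filter_upwards [h] with x hx
  rw [hx]
  refine ⟨hC x, fun hx' => ?_⟩
  by_contra h0
  exact absurd (hR x (subset_tsupport u h0)) (not_le.2 hx')

theorem Nice.createN {f : L2 d ℂ} (hf : f ∈ testFunctions d) {u : symL2 d n}
    (hu : Nice (u : L2n d n)) : Nice (createN n f u : L2n d (n + 1)) := by
  obtain ⟨R, C, h⟩ := hu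
  obtain ⟨R', C', h'⟩ := exists_bound_of_mem_testFunctions hf
  have h1 : ∀ᵐ q : Fin (n + 1) → Sp d, ‖tensorFun f (u : L2n d n) q‖ ≤ C' * C ∧
      ((∃ i, max R R' < ‖q i‖) → tensorFun f (u : L2n d n) q = 0) := by
    filter_upwards [(quasi_head d n).ae h', (quasi_tail d n).ae h] with q h2 h3
    refine ⟨?_, ?_⟩
    · rw [tensorFun, norm_mul]
      exact mul_le_mul h2.1 h3.1 (norm_nonneg _) ((norm_nonneg _).trans h2.1)
    · rintro ⟨i, hi⟩
      rw [tensorFun]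
      refine Fin.cases (fun hi => ?_) (fun i hi => ?_) i hi
      · rw [h2.2 ((le_max_right _ _).trans_lt hi), zero_mul]
      · rw [h3.2 ⟨i, (le_max_left _ _).trans_lt hi⟩, mul_zero]
  have h2 : ∀ᵐ q : Fin (n + 1) → Sp d, ∀ σ : Equiv.Perm (Fin (n + 1)),
      ‖tensorFun f (u : L2n d n) (q ∘ σ)‖ ≤ C' * C ∧
      ((∃ i, max R R' < ‖(q ∘ σ) i‖) → tensorFun f (u : L2n d n) (q ∘ σ) = 0) :=
    ae_all_iff.2 fun σ => ae_perm σ h1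
  refine ⟨max R R', ‖createConst n‖ * ∑ _σ : Equiv.Perm (Fin (n + 1)), C' * C, ?_⟩
  filter_upwards [h2, coeFn_createN f u] with q h3 h4
  rw [h4]
  refine ⟨?_, ?_⟩
  · rw [norm_mul]
    gcongr
    exact norm_sum_le_of_le _ fun σ _ => (h3 σ).1
  · rintro ⟨i, hi⟩
    rw [Finset.sum_eq_zero, mul_zero]
    intro σ _
    exact (h3 σ).2 ⟨σ.symm i, by simpa using hi⟩

/-- The vacuum has these properties and creation by a test function preserves them. Bounded support
is what makes local integrability of the dispersion sufficient. -/
theorem nice_of_mem_monoSpan {ψ : FockSeq d} (hψ : ψ ∈ monoSpan d) (n : ℕ) :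
    Nice (ψ n : L2n d n) := by
  refine monoSpan_induction (p := fun ψ => ∀ n, Nice (ψ n : L2n d n)) ?_ ?_ ?_ ?_ ?_ hψ n
  · intro n
    by_cases hn : n = 0
    · subst hn
      rw [vacuum, Pi.single_eq_same]
      refine ⟨0, 1, ?_⟩
      have hv : ((vacuumZero d : L2n d 0) : (Fin 0 → Sp d) → ℂ) =ᵐ[volume] fun _ => (1 : ℂ) :=
        MemLp.coeFn_toLp (haveI := volume_fin_zero d; memLp_const (1 : ℂ) :
          MemLp (fun _ : Fin 0 → Sp d => (1 : ℂ)) 2 volume)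
      filter_upwards [hv] with k hk
      rw [hk]
      exact ⟨by simp, fun ⟨i, _⟩ => i.elim0⟩
    · rw [vacuum, Pi.single_eq_of_ne hn]
      exact Nice.zero
  · intro h hh ψ hψ n
    cases n with
    | zero => exact Nice.zero
    | succ n => exact (hψ n).createN hh
  · exact fun n => Nice.zero
  · exact fun ψ φ h1 h2 n => (h1 n).add (h2 n)
  · exact fun c ψ h n => (h n).smul c

theorem integrableOn_sum_box {w : Sp d → ℝ} (hw : LocallyIntegrable w volume) (R : ℝ) :
    IntegrableOn (fun k : Fin n → Sp d => ∑ i, w (k i))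
      (Set.univ.pi fun _ => Metric.closedBall 0 R) volume := by
  rw [IntegrableOn, volume_pi, Measure.restrict_pi_pi]
  refine integrable_finsetSum _ fun i _ => ?_
  have hf : IsFiniteMeasure ((volume : Measure (Sp d)).restrict (Metric.closedBall 0 R)) :=
    ⟨by
      rw [Measure.restrict_apply_univ]
      exact (isCompact_closedBall (0 : Sp d) R).measure_lt_top⟩
  exact @integrable_comp_eval _ _ _ _ (fun _ : Fin n =>
    (volume : Measure (Sp d)).restrict (Metric.closedBall 0 R)) _ _ (fun _ => hf) i _
    (hw.integrableOn_isCompact (isCompact_closedBall (0 : Sp d) R))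

/-- On the box containing the support, `|m u|² ≤ C² ∑ w(k_i)`, which is integrable there. -/
theorem Nice.memLp_mul {u : L2n d n} (hu : Nice u) {m : (Fin n → Sp d) → ℝ}
    (hm : AEStronglyMeasurable m volume) {w : Sp d → ℝ} (hw : LocallyIntegrable w volume)
    (hmw : ∀ k, m k ^ 2 ≤ ∑ i, w (k i)) :
    MemLp (fun k => (m k : ℂ) * u k) 2 volume := by
  obtain ⟨R, C, h⟩ := hu
  have hs : MeasurableSet (Set.univ.pi fun _ : Fin n => Metric.closedBall (0 : Sp d) R) :=
    MeasurableSet.univ_pi fun _ => measurableSet_closedBall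
  have h1 : MemLp (Set.indicator (Set.univ.pi fun _ : Fin n => Metric.closedBall (0 : Sp d) R)
      fun k => C * m k) 2 volume := by
    rw [memLp_indicator_iff_restrict hs]
    refine MemLp.const_mul ?_ C
    rw [memLp_two_iff_integrable_sq hm.restrict]
    refine (integrableOn_sum_box hw R).mono' (hm.restrict.pow 2) (Eventually.of_forall fun k => ?_)
    rw [Real.norm_of_nonneg (sq_nonneg _)]
    exact hmw k
  refine h1.of_le ((Complex.continuous_ofReal.comp_aestronglyMeasurable hm).mul
    (Lp.aestronglyMeasurable u)) ?_
  filter_upwards [h] with k hk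
  by_cases hk' : k ∈ Set.univ.pi fun _ : Fin n => Metric.closedBall (0 : Sp d) R
  · rw [Set.indicator_of_mem hk', norm_mul, norm_mul, Complex.norm_real, mul_comm]
    gcongr
    exact hk.1.trans (le_abs_self C)
  · have : ∃ i, R < ‖k i‖ := by
      simpa [Set.mem_univ_pi] using hk'
    rw [hk.2 this]
    simp

/-- Supplies domain vectors both for `P_f` and for `H_f^{1/2}`. The majorant `w` may depend on `n`,
since each vector occupies only finitely many sectors. -/
theorem exists_mem_sectorMul_graph {m : ∀ n, (Fin n → Sp d) → ℝ}
    (hm : ∀ n, AEStronglyMeasurable (m n) volume)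
    (hsym : ∀ n (σ : Equiv.Perm (Fin n)) k, m n (k ∘ σ) = m n k) {w : ℕ → Sp d → ℝ}
    (hw : ∀ n, LocallyIntegrable (w n) volume) (hmw : ∀ n k, m n k ^ 2 ≤ ∑ i, w n (k i))
    {ψ : Fock d} (hψ : ψ ∈ fockFin d) : ∃ φ, (ψ, φ) ∈ (sectorMul m).graph := by
  have h1 : ∀ n, MemLp (fun k => (m n k : ℂ) * (ψ n : L2n d n) k) 2 volume := fun n =>
    (nice_of_mem_monoSpan (mem_fockFin.1 hψ) n).memLp_mul (hm n) (hw n) (hmw n)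
  have h2 : ∀ n, (h1 n).toLp _ ∈ symL2 d n := by
    intro n
    refine mem_symL2_of_ae fun σ => ?_
    filter_upwards [(h1 n).coeFn_toLp, ae_perm σ (h1 n).coeFn_toLp, ae_symm (ψ n) σ]
      with k h3 h4 h5
    rw [h3, h4, hsym, h5]
  obtain ⟨N, hN⟩ := finSupp_of_mem (mem_fockFin.1 hψ)
  -- A finite sum of sector vectors, so square summability is automatic; above `N` both `ψ` and the
  -- image vanish.
  refine ⟨∑ n ∈ Finset.range (N + 1), lp.single 2 n ⟨_, h2 n⟩, ?_⟩
  rw [mem_sectorMul_graph]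
  intro n
  by_cases hn : n ∈ Finset.range (N + 1)
  · have : (∑ n ∈ Finset.range (N + 1), lp.single 2 n ⟨_, h2 n⟩ : Fock d) n = ⟨_, h2 n⟩ := by
      rw [lp.coeFn_sum, Finset.sum_apply, Finset.sum_eq_single n]
      · rw [lp.single_apply_self]
      · intro m _ hm
        rw [lp.single_apply_ne _ _ _ (Ne.symm hm)]
      · exact fun h => absurd hn h
    rw [this]
    exact (h1 n).coeFn_toLp
  · have h0 : ψ n = 0 := hN n (by simpa using hn)
    have : (∑ n ∈ Finset.range (N + 1), lp.single 2 n ⟨_, h2 n⟩ : Fock d) n = 0 := by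
      rw [lp.coeFn_sum, Finset.sum_apply]
      refine Finset.sum_eq_zero fun m hm => ?_
      rw [lp.single_apply_ne]
      rintro rfl
      exact hn hm
    rw [this, h0]
    change ((0 : L2n d n) : (Fin n → Sp d) → ℂ) =ᵐ[volume] fun k => (m n k : ℂ) * (0 : L2n d n) k
    filter_upwards [Lp.coeFn_zero ℂ 2 (volume : Measure (Fin n → Sp d))] with k hk
    rw [hk, Pi.zero_apply, mul_zero]

end SectorMul

/-! ### The field momentum -/

section FieldMomentum

variable {d : ℕ}

theorem phaseSum_axis (n : ℕ) (j : Fin d) (t : ℝ) (q : Fin n → Sp d) :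
    phaseSum n (t • EuclideanSpace.single j (1 : ℝ)) q = t * ∑ i, q i j := by
  rw [phaseSum, Finset.mul_sum]
  refine Finset.sum_congr rfl fun i _ => ?_
  rw [real_inner_smul_left, EuclideanSpace.inner_single_left]
  simp

theorem hasDerivAt_symU_iff (n : ℕ) (j : Fin d) (u v : symL2 d n) :
    HasDerivAt (fun t : ℝ => ((symU n (t • EuclideanSpace.single j (1 : ℝ)) u : symL2 d n) :
      L2n d n)) (Complex.I • (v : L2n d n)) 0 ↔
      (v : L2n d n) =ᵐ[volume] fun k => ((∑ i, k i j : ℝ) : ℂ) * (u : L2n d n) k :=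
  hasDerivAt_expMul_iff (m := fun k : Fin n → Sp d => ∑ i, k i j)
    (θ := fun t => phaseSum n (t • EuclideanSpace.single j (1 : ℝ)))
    (fun _ => measurable_phaseSum _) (fun t q => phaseSum_axis n j t q) (u : L2n d n) v

/-- The `n`-particle component, as an element of `L²((ℝ^d)^n)`. -/
def compL (n : ℕ) : Fock d →L[ℂ] L2n d n :=
  (symL2 d n).subtypeL ∘L lp.evalCLM ℂ (fun n => symL2 d n) 2 n

/-- Differentiability in Fock space implies differentiability of each component, and there the
derivative is the multiplication. -/
theorem genGraph_fockU_le (j : Fin d) :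
    genGraph (axis (fockU : Sp d → (Fock d ≃ₗᵢ[ℂ] Fock d)) j) ≤ (fieldMomentum j).graph := by
  rintro ⟨ψ, φ⟩ h
  rw [mem_genGraph, GenRel] at h
  rw [fieldMomentum, mem_sectorMul_graph]
  intro n
  rw [← hasDerivAt_symU_iff]
  have h1 := (compL n).hasDerivAt_comp h
  rwa [_root_.map_smul] at h1

theorem exists_genRel_fockU (j : Fin d) {ψ : Fock d} (hψ : ψ ∈ fockFin d) :
    ∃ φ, GenRel (axis (fockU : Sp d → (Fock d ≃ₗᵢ[ℂ] Fock d)) j) ψ φ := by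
  obtain ⟨φ, hφ⟩ := exists_mem_sectorMul_graph (m := fun n (k : Fin n → Sp d) => ∑ i, k i j)
    -- The majorant comes from Cauchy–Schwarz: the square of a sum of `n` terms is at most `n` times
    -- the sum of squares.
    (w := fun n q => (n : ℝ) * q j ^ 2)
    (fun n => Continuous.aestronglyMeasurable (by fun_prop))
    (fun n σ k => Equiv.sum_comp σ fun i => k i j)
    (fun n => Continuous.locallyIntegrable (by fun_prop))
    (fun n k => by
      rw [← Finset.mul_sum]
      simpa using sq_sum_le_card_mul_sum_sq (s := Finset.univ) (f := fun i => k i j)) hψ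
  rw [mem_sectorMul_graph] at hφ
  obtain ⟨N, hN⟩ := finSupp_of_mem (mem_fockFin.1 hψ)
  refine ⟨∑ n ∈ Finset.range (N + 1), lp.single 2 n (φ n), ?_⟩
  have e : (fun t : ℝ => axis (fockU : Sp d → (Fock d ≃ₗᵢ[ℂ] Fock d)) j t ψ) =
      fun t : ℝ => ∑ n ∈ Finset.range (N + 1),
        singleL n (symU n (t • EuclideanSpace.single j (1 : ℝ)) (ψ n)) := by
    funext t
    conv_lhs => rw [eq_sum_single (ψ := ψ) hN, map_sum]
    exact Finset.sum_congr rfl fun n _ => fockU_single _ _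
  rw [GenRel, e, Finset.smul_sum]
  refine HasDerivAt.fun_sum fun n _ => ?_
  rw [← singleL_apply, ← _root_.map_smul]
  refine (singleL n).hasDerivAt_comp ?_
  have h1 := ((symL2 d n).orthogonalProjectionOnto).hasDerivAt_comp
    ((hasDerivAt_symU_iff n j (ψ n) (φ n)).2 (hφ n))
  simpa using h1

/-- Multiplication by a real function is symmetric and extends the generator of `fockU`; the
generator is self-adjoint and admits no proper symmetric extension. -/
theorem fieldMomentum_graph (j : Fin d) : (fieldMomentum j).graph =
    genGraph (axis (fockU : Sp d → (Fock d ≃ₗᵢ[ℂ] Fock d)) j) :=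
  (isUnitaryRep_fockU.axis j).graph_eq_of_symm dense_fockFin
    (fun _ _ hψ => fockU_mem_fockFin _ hψ) (fun _ hψ => exists_genRel_fockU j hψ)
    (fun _ hx _ hy => sectorMul_symm hx hy) (genGraph_fockU_le j)

theorem isCommutingSelfAdjoint_fieldMomentum :
    IsCommutingSelfAdjoint (fieldMomentum : Fin d → (Fock d →ₗ.[ℂ] Fock d)) :=
  ⟨fun j => (isUnitaryRep_fockU.axis j).isSelfAdjoint dense_fockFin
    (fun _ _ hψ => fockU_mem_fockFin _ hψ) (fun _ hψ => exists_genRel_fockU j hψ)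
    (fieldMomentum_graph j), fockU, isExpI_iff.2 ⟨isUnitaryRep_fockU, fieldMomentum_graph⟩⟩

end FieldMomentum

/-! ### The total momentum -/

section TotalMomentum

variable {d : ℕ} {K : Type*} [NormedAddCommGroup K] [InnerProductSpace ℂ K]

/-- `exp(i k · (p + A))`, where `T k = exp(i k · A)`. -/
def totalU (T : Sp d → (K ≃ₗᵢ[ℂ] K)) (k : Sp d) : L2 d K ≃ₗᵢ[ℂ] L2 d K :=
  (shift k).trans (liftU (T k))

theorem totalU_apply (T : Sp d → (K ≃ₗᵢ[ℂ] K)) (k : Sp d) (Ψ : L2 d K) :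
    totalU T k Ψ = liftU (T k) (shift k Ψ) := rfl

theorem totalU_tensor (T : Sp d → (K ≃ₗᵢ[ℂ] K)) (k : Sp d) (f : L2 d ℂ) (ψ : K) :
    totalU T k (tensor f ψ) = tensor (shift k f) (T k ψ) := by
  rw [totalU_apply, shift_tensor, liftU_tensor]

theorem dense_algTensor_top :
    Dense (algTensor (testFunctions d) (⊤ : Submodule ℂ K) : Set (L2 d K)) :=
  dense_algTensor dense_testFunctions (by simp)

theorem continuous_totalU {T : Sp d → (K ≃ₗᵢ[ℂ] K)} (hT : IsUnitaryRep T) (Ψ : L2 d K) :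
    Continuous fun k => totalU T k Ψ := by
  refine continuous_apply_of_dense (U := fun (k : Sp d) (Ψ : L2 d K) => totalU T k Ψ)
    (fun k => (totalU T k).isometry) dense_algTensor_top ?_ Ψ
  intro Ψ hΨ
  refine Submodule.span_induction ?_ ?_ ?_ ?_ hΨ
  · rintro _ ⟨f, _, ψ, _, rfl⟩
    simp only [totalU_tensor]
    simp only [← tensorB_apply]
    have h1 := continuous_shift f
    have h2 := hT.continuous ψ
    fun_prop
  · simp only [_root_.map_zero]
    exact continuous_const
  · intro x y _ _ hx hy
    simp only [_root_.map_add]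
    exact hx.add hy
  · intro c x _ hx
    simp only [_root_.map_smul]
    exact hx.const_smul c

theorem isUnitaryRep_totalU {T : Sp d → (K ≃ₗᵢ[ℂ] K)} (hT : IsUnitaryRep T) :
    IsUnitaryRep (totalU T) where
  map_zero Ψ := by
    rw [totalU_apply, shift_zero]
    refine Lp.ext ?_
    filter_upwards [coeFn_liftU (T 0) Ψ] with x hx
    rw [hx, hT.map_zero]
  map_add k l Ψ := by
    rw [totalU_apply, totalU_apply, totalU_apply, shift_add, shift_liftU]
    refine Lp.ext ?_
    filter_upwards [coeFn_liftU (T (k + l)) (shift k (shift l Ψ)),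
      coeFn_liftU (T l) (shift k (shift l Ψ)),
      coeFn_liftU (T k) (liftU (T l) (shift k (shift l Ψ)))] with x h1 h2 h3
    rw [h1, h3, h2, hT.map_add]
  continuous := continuous_totalU hT

theorem GenRel.unique {H : Type*} [NormedAddCommGroup H] [InnerProductSpace ℂ H]
    {U : ℝ → (H ≃ₗᵢ[ℂ] H)} {Ψ Φ Φ' : H} (h : GenRel U Ψ Φ) (h' : GenRel U Ψ Φ') : Φ = Φ' :=
  smul_right_injective H Complex.I_ne_zero (HasDerivAt.unique h h')

/-- The Leibniz rule for `t ↦ (shift f) ⊗ (T ψ)`. -/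
theorem genRel_tensor {T : Sp d → (K ≃ₗᵢ[ℂ] K)} (hT : IsUnitaryRep T) {j : Fin d}
    {f f' : L2 d ℂ} {ψ ψ' : K}
    (hf : GenRel (axis (shift : Sp d → (L2 d ℂ ≃ₗᵢ[ℂ] L2 d ℂ)) j) f f')
    (hψ : GenRel (axis T j) ψ ψ') :
    GenRel (axis (totalU T) j) (tensor f ψ) (tensor f' ψ + tensor f ψ') := by
  have h := ContinuousLinearMap.hasDerivAt_of_bilinear
    (B := (tensorB : K →L[ℂ] L2 d ℂ →L[ℂ] L2 d K).bilinearRestrictScalars ℝ)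
    (fun _ => hψ) (fun _ => hf)
  simp only [ContinuousLinearMap.bilinearRestrictScalars_apply_apply, tensorB_apply,
    (hT.axis j).map_zero, (isUnitaryRep_shift.axis j).map_zero, tensor_smul_left,
    tensor_smul_right] at h
  rw [GenRel, smul_add]
  refine h.congr_of_eventuallyEq (Eventually.of_forall fun t => ?_)
  exact totalU_tensor T _ f ψ

variable {T : Sp d → (K ≃ₗᵢ[ℂ] K)} {Pf : Fin d → (K →ₗ.[ℂ] K)}
  {F : Submodule ℂ K}

/-- The relation whose linear span is the graph of `A ⊗ I + I ⊗ C`. -/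
def tensorSumRel (A : L2 d ℂ →ₗ.[ℂ] L2 d ℂ) (C : K →ₗ.[ℂ] K) : Submodule ℂ (L2 d K × L2 d K) :=
  Submodule.span ℂ {ΨΦ | ∃ (f : A.domain) (ψ : C.domain),
      ΨΦ = (tensor (f : L2 d ℂ) (ψ : K), tensor (A f) (ψ : K) + tensor (f : L2 d ℂ) (C ψ))}

theorem tensorSumRel_le (hT : IsUnitaryRep T) {j : Fin d}
    (hPf : (Pf j).graph = genGraph (axis T j)) :
    tensorSumRel (momentum j) (Pf j) ≤ genGraph (axis (totalU T) j) := by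
  refine Submodule.span_le.2 ?_
  rintro _ ⟨f, ψ, rfl⟩
  refine genRel_tensor hT ?_ ?_
  · rw [← mem_genGraph, ← momentum_graph]
    exact LinearPMap.mem_graph _ f
  · rw [← mem_genGraph, ← hPf]
    exact LinearPMap.mem_graph _ ψ

theorem exists_mem_tensorSumRel {j : Fin d}
    (hPf : (Pf j).graph = genGraph (axis T j)) (hF : ∀ ψ ∈ F, ∃ φ, GenRel (axis T j) ψ φ)
    {Ψ : L2 d K} (hΨ : Ψ ∈ algTensor (testFunctions d) F) :
    ∃ Φ, (Ψ, Φ) ∈ tensorSumRel (momentum j) (Pf j) := by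
  refine Submodule.span_induction ?_ ?_ ?_ ?_ hΨ
  · rintro _ ⟨f, hf, ψ, hψ, rfl⟩
    obtain ⟨f', hf'⟩ := exists_genRel_shift hf j
    obtain ⟨ψ', hψ'⟩ := hF ψ hψ
    rw [← mem_genGraph, ← momentum_graph] at hf'
    rw [← mem_genGraph, ← hPf] at hψ'
    have h1 := LinearPMap.mem_domain_of_mem_graph hf'
    have h2 := LinearPMap.mem_domain_of_mem_graph hψ'
    exact ⟨_, Submodule.subset_span ⟨⟨f, h1⟩, ⟨ψ, h2⟩, rfl⟩⟩
  · exact ⟨0, Submodule.zero_mem _⟩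
  · rintro x y _ _ ⟨x', hx⟩ ⟨y', hy⟩
    exact ⟨x' + y', Submodule.add_mem _ hx hy⟩
  · rintro c x _ ⟨x', hx⟩
    exact ⟨c • x', Submodule.smul_mem _ c hx⟩

theorem totalU_mem_algTensor (hinv : ∀ k, ∀ ψ ∈ F, T k ψ ∈ F) (k : Sp d) {Ψ : L2 d K}
    (hΨ : Ψ ∈ algTensor (testFunctions d) F) : totalU T k Ψ ∈ algTensor (testFunctions d) F := by
  refine Submodule.span_induction ?_ ?_ ?_ ?_ hΨ
  · rintro _ ⟨f, hf, ψ, hψ, rfl⟩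
    rw [totalU_tensor]
    exact tensor_mem_algTensor (shift_mem_testFunctions k hf) (hinv k ψ hψ)
  · rw [_root_.map_zero]
    exact Submodule.zero_mem _
  · intro x y _ _ hx hy
    rw [_root_.map_add]
    exact Submodule.add_mem _ hx hy
  · intro c x _ hx
    rw [_root_.map_smul]
    exact Submodule.smul_mem _ c hx

theorem exists_genRel_totalU (hT : IsUnitaryRep T) {j : Fin d}
    (hPf : (Pf j).graph = genGraph (axis T j)) (hF : ∀ ψ ∈ F, ∃ φ, GenRel (axis T j) ψ φ)
    {Ψ : L2 d K} (hΨ : Ψ ∈ algTensor (testFunctions d) F) : ∃ Φ, GenRel (axis (totalU T) j) Ψ Φ :=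
  (exists_mem_tensorSumRel hPf hF hΨ).imp fun _ h => tensorSumRel_le hT hPf h

variable [CompleteSpace K]

/-- The graph of `p_j ⊗ I + I ⊗ Pf_j` lies in that of the generator of `totalU`, and it contains the
generator restricted to the dense invariant space `C_0^∞ ⊗ F`. That space is a core, so the closures
agree; in particular the operator is closable. -/
theorem totalMomentum_graph (hT : IsUnitaryRep T) (hFd : Dense (F : Set K))
    (hinv : ∀ k, ∀ ψ ∈ F, T k ψ ∈ F) {j : Fin d} (hPf : (Pf j).graph = genGraph (axis T j))
    (hF : ∀ ψ ∈ F, ∃ φ, GenRel (axis T j) ψ φ) :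
    (totalMomentum Pf j).graph = genGraph (axis (totalU T) j) := by
  have hW := isUnitaryRep_totalU hT
  have hD := dense_algTensor (dense_testFunctions (d := d)) hFd
  have hfun : ∀ x ∈ genGraph (axis (totalU T) j), x.1 = 0 → x.2 = 0 := by
    rintro ⟨Ψ, Φ⟩ h hΨ
    simp only at hΨ
    subst hΨ
    exact GenRel.unique (mem_genGraph.1 h) (mem_genGraph.1 (Submodule.zero_mem _))
  have hg : (tensorSum (momentum j) (Pf j)).graph = tensorSumRel (momentum j) (Pf j) :=
    Submodule.toLinearPMap_graph_eq _ fun x hx => hfun x (tensorSumRel_le hT hPf hx)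
  have hcl : (tensorSum (momentum j) (Pf j)).graph.topologicalClosure =
      genGraph (axis (totalU T) j) := by
    refine le_antisymm ?_ ?_
    · refine Submodule.topologicalClosure_minimal _ ?_ ?_
      · rw [hg]
        exact tensorSumRel_le hT hPf
      · exact (hW.axis j).isClosed_genGraph hD (fun t Ψ hΨ => totalU_mem_algTensor hinv _ hΨ)
          fun Ψ hΨ => exists_genRel_totalU hT hPf hF hΨ
    · rw [hg]
      refine (hW.axis j).genGraph_le_closure hD (fun t Ψ hΨ => totalU_mem_algTensor hinv _ hΨ)
        (fun Ψ hΨ => exists_genRel_totalU hT hPf hF hΨ) ?_ (tensorSumRel_le hT hPf)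
      intro Ψ hΨ Φ hΦ
      obtain ⟨Φ', h'⟩ := exists_mem_tensorSumRel hPf hF hΨ
      rwa [hΦ.unique (mem_genGraph.1 (tensorSumRel_le hT hPf h'))]
  have hc : (tensorSum (momentum j) (Pf j)).IsClosable :=
    ⟨(genGraph (axis (totalU T) j)).toLinearPMap, by
      rw [hcl, Submodule.toLinearPMap_graph_eq _ hfun]⟩
  rw [totalMomentum, ← hc.graph_closure_eq_closure_graph, hcl]

theorem isExpI_totalU (hT : IsUnitaryRep T) (hFd : Dense (F : Set K))
    (hinv : ∀ k, ∀ ψ ∈ F, T k ψ ∈ F) (hPf : ∀ j, (Pf j).graph = genGraph (axis T j))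
    (hF : ∀ j, ∀ ψ ∈ F, ∃ φ, GenRel (axis T j) ψ φ) :
    IsExpI (totalMomentum Pf) (totalU T) :=
  isExpI_iff.2 ⟨isUnitaryRep_totalU hT, fun j => totalMomentum_graph hT hFd hinv (hPf j) (hF j)⟩

theorem isCommutingSelfAdjoint_totalMomentum (hT : IsUnitaryRep T) (hFd : Dense (F : Set K))
    (hinv : ∀ k, ∀ ψ ∈ F, T k ψ ∈ F) (hPf : ∀ j, (Pf j).graph = genGraph (axis T j))
    (hF : ∀ j, ∀ ψ ∈ F, ∃ φ, GenRel (axis T j) ψ φ) :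
    IsCommutingSelfAdjoint (totalMomentum Pf) :=
  ⟨fun j => ((isUnitaryRep_totalU hT).axis j).isSelfAdjoint
    (dense_algTensor (dense_testFunctions (d := d)) hFd)
    (fun _ _ hΨ => totalU_mem_algTensor hinv _ hΨ)
    (fun _ hΨ => exists_genRel_totalU hT (hPf j) (hF j) hΨ)
    (totalMomentum_graph hT hFd hinv (hPf j) (hF j)),
    totalU T, isExpI_totalU hT hFd hinv hPf hF⟩

/-- (H.2) quantifies over every representation generated by the total momentum; by uniqueness only
`totalU` has to be examined. -/
theorem eq_totalU (hT : IsUnitaryRep T) (hFd : Dense (F : Set K))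
    (hinv : ∀ k, ∀ ψ ∈ F, T k ψ ∈ F) (hPf : ∀ j, (Pf j).graph = genGraph (axis T j))
    (hF : ∀ j, ∀ ψ ∈ F, ∃ φ, GenRel (axis T j) ψ φ) {W : Sp d → (L2 d K ≃ₗᵢ[ℂ] L2 d K)}
    (hW : IsExpI (totalMomentum Pf) W) (k : Sp d) (Ψ : L2 d K) : W k Ψ = totalU T k Ψ := by
  refine eq_of_isExpI hW (isExpI_totalU hT hFd hinv hPf hF) (fun j => ?_) k Ψ
  refine (dense_algTensor (dense_testFunctions (d := d)) hFd).mono fun Ψ hΨ => ?_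
  obtain ⟨Φ, h⟩ := exists_genRel_totalU hT (hPf j) (hF j) hΨ
  rw [← mem_genGraph, ← totalMomentum_graph hT hFd hinv (hPf j) (hF j)] at h
  exact LinearPMap.mem_domain_of_mem_graph h

end TotalMomentum

/-! ### Polynomials of the field operator -/

section Interaction

variable {d : ℕ}

/-- The pairing of two sequences; it is meaningful if one of them has finite support. -/
def pair (φ ψ : FockSeq d) : ℂ := ∑' n, ⟪φ n, ψ n⟫_ℂ

theorem pair_eq_sum_left {φ ψ : FockSeq d} {N : ℕ} (hN : ∀ n, N < n → φ n = 0) {M : ℕ}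
    (hM : N < M) : pair φ ψ = ∑ n ∈ Finset.range M, ⟪φ n, ψ n⟫_ℂ :=
  tsum_eq_sum fun n hn => by
    rw [hN n (by have := Finset.mem_range.not.1 hn; omega), inner_zero_left]

theorem pair_eq_sum_right {φ ψ : FockSeq d} {N : ℕ} (hN : ∀ n, N < n → ψ n = 0) {M : ℕ}
    (hM : N < M) : pair φ ψ = ∑ n ∈ Finset.range M, ⟪φ n, ψ n⟫_ℂ :=
  tsum_eq_sum fun n hn => by
    rw [hN n (by have := Finset.mem_range.not.1 hn; omega), inner_zero_right]

/-- The adjoint relation sector by sector. Finite support of `ψ` makes both sums finite, and the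
index shift drops the zero-particle component, where `a*` vanishes. -/
theorem pair_create {h : L2 d ℂ} {φ ψ : FockSeq d} (hψ : FinSupp ψ) :
    pair φ (create h ψ) = pair (annihilate h φ) ψ := by
  obtain ⟨N, hN⟩ := hψ
  rw [pair_eq_sum_right (create_eq_zero hN) (Nat.lt_succ_self _),
    pair_eq_sum_right hN (Nat.lt_succ_self _), Finset.sum_range_succ']
  have h0 : ⟪φ 0, create h ψ 0⟫_ℂ = 0 := inner_zero_right _
  rw [h0, add_zero]
  refine Finset.sum_congr rfl fun n _ => ?_
  exact (ContinuousLinearMap.adjoint_inner_left (createN n h) (ψ n) (φ (n + 1))).symm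

theorem pair_conj (φ ψ : FockSeq d) : conj (pair φ ψ) = pair ψ φ := by
  rw [pair, Complex.conj_tsum]
  exact tsum_congr fun n => inner_conj_symm _ _

theorem pair_annihilate {h : L2 d ℂ} {φ ψ : FockSeq d} (hφ : FinSupp φ) :
    pair φ (annihilate h ψ) = pair (create h φ) ψ := by
  rw [← pair_conj, ← pair_create hφ, pair_conj]

theorem pair_add_right {φ ψ ψ' : FockSeq d} (hφ : FinSupp φ) :
    pair φ (ψ + ψ') = pair φ ψ + pair φ ψ' := by
  obtain ⟨N, hN⟩ := hφ
  simp only [pair_eq_sum_left hN (Nat.lt_succ_self _), Pi.add_apply, inner_add_right,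
    Finset.sum_add_distrib]

theorem pair_smul_right (c : ℂ) {φ ψ : FockSeq d} (hφ : FinSupp φ) :
    pair φ (c • ψ) = c * pair φ ψ := by
  obtain ⟨N, hN⟩ := hφ
  simp only [pair_eq_sum_left hN (Nat.lt_succ_self _), Pi.smul_apply, inner_smul_right,
    Finset.mul_sum]

theorem pair_add_left {φ φ' ψ : FockSeq d} (hψ : FinSupp ψ) :
    pair (φ + φ') ψ = pair φ ψ + pair φ' ψ := by
  rw [← pair_conj, pair_add_right hψ, _root_.map_add, pair_conj, pair_conj]

theorem pair_smul_left (c : ℂ) {φ ψ : FockSeq d} (hψ : FinSupp ψ) :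
    pair (c • φ) ψ = conj c * pair φ ψ := by
  rw [← pair_conj, pair_smul_right c hψ, map_mul, pair_conj]

/-- Families of symmetric operators on sequences which are measurable, change the number of
particles by a bounded amount, and are locally bounded, uniformly in `x`. -/
structure IsFieldLike (A : Sp d → Module.End ℂ (FockSeq d)) : Prop where
  meas : ∀ Φ : Sp d → FockSeq d, (∀ n, AEStronglyMeasurable (fun x => Φ x n) volume) →
    ∀ n, AEStronglyMeasurable (fun x => A x (Φ x) n) volume
  bound : ∀ n, ∃ C : ℝ, 0 ≤ C ∧ ∃ M : ℕ, ∀ x φ, ‖A x φ n‖ ≤ C * ∑ l ∈ Finset.range M, ‖φ l‖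
  supp : ∃ M : ℕ, ∀ (N : ℕ) x φ, (∀ n, N < n → φ n = 0) → ∀ n, N + M < n → A x φ n = 0
  symm : ∀ x φ ψ, FinSupp φ → FinSupp ψ → pair φ (A x ψ) = pair (A x φ) ψ

namespace IsFieldLike

variable {A A' : Sp d → Module.End ℂ (FockSeq d)}

theorem finSupp (hA : IsFieldLike A) (x : Sp d) {φ : FockSeq d} (hφ : FinSupp φ) :
    FinSupp (A x φ) := by
  obtain ⟨M, hM⟩ := hA.supp
  obtain ⟨N, hN⟩ := hφ
  exact ⟨N + M, hM N x φ hN⟩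

theorem one : IsFieldLike (fun _ : Sp d => (1 : Module.End ℂ (FockSeq d))) where
  meas _ h n := h n
  bound n := by
    refine ⟨1, zero_le_one, n + 1, fun x φ => ?_⟩
    rw [one_mul]
    exact Finset.single_le_sum (f := fun l => ‖φ l‖) (fun _ _ => norm_nonneg _)
      (Finset.self_mem_range_succ n)
  supp := ⟨0, fun N x φ h => h⟩
  symm _ _ _ _ _ := rfl

theorem add (hA : IsFieldLike A) (hA' : IsFieldLike A') : IsFieldLike fun x => A x + A' x where
  meas Φ h n := (hA.meas Φ h n).add (hA'.meas Φ h n)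
  bound n := by
    obtain ⟨C, hC, M, h⟩ := hA.bound n
    obtain ⟨C', hC', M', h'⟩ := hA'.bound n
    refine ⟨C + C', by positivity, max M M', fun x φ => ?_⟩
    rw [add_mul]
    refine norm_add_le_of_le ((h x φ).trans ?_) ((h' x φ).trans ?_)
    · gcongr
      exact le_max_left _ _
    · gcongr
      exact le_max_right _ _
  supp := by
    obtain ⟨M, h⟩ := hA.supp
    obtain ⟨M', h'⟩ := hA'.supp
    refine ⟨M + M', fun N x φ hφ n hn => ?_⟩
    rw [LinearMap.add_apply, Pi.add_apply, h N x φ hφ n (by omega), h' N x φ hφ n (by omega),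
      add_zero]
  symm x φ ψ hφ hψ := by
    rw [LinearMap.add_apply, LinearMap.add_apply, pair_add_right hφ, pair_add_left hψ,
      hA.symm x φ ψ hφ hψ, hA'.symm x φ ψ hφ hψ]

theorem smul (c : ℝ) (hA : IsFieldLike A) : IsFieldLike fun x => (c : ℂ) • A x where
  meas Φ h n := (hA.meas Φ h n).const_smul (c : ℂ)
  bound n := by
    obtain ⟨C, hC, M, h⟩ := hA.bound n
    refine ⟨‖(c : ℂ)‖ * C, by positivity, M, fun x φ => ?_⟩
    rw [LinearMap.smul_apply, Pi.smul_apply, norm_smul, mul_assoc]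
    gcongr
    exact h x φ
  supp := by
    obtain ⟨M, h⟩ := hA.supp
    refine ⟨M, fun N x φ hφ n hn => ?_⟩
    rw [LinearMap.smul_apply, Pi.smul_apply, h N x φ hφ n hn, smul_zero]
  symm x φ ψ hφ hψ := by
    rw [LinearMap.smul_apply, LinearMap.smul_apply, pair_smul_right _ hφ, pair_smul_left _ hψ,
      hA.symm x φ ψ hφ hψ, Complex.conj_ofReal]

/-- Moving both symmetric factors to the left entry reverses their order; commutativity restores it.
-/
theorem mul (hA : IsFieldLike A) (hA' : IsFieldLike A') (hc : ∀ x, Commute (A x) (A' x)) :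
    IsFieldLike fun x => A x * A' x where
  meas Φ h n := hA.meas _ (hA'.meas Φ h) n
  bound n := by
    obtain ⟨C, hC, M, h⟩ := hA.bound n
    choose C' hC' M' h' using hA'.bound
    refine ⟨C * ∑ l ∈ Finset.range M, C' l, mul_nonneg hC (Finset.sum_nonneg fun l _ => hC' l),
      ∑ l ∈ Finset.range M, M' l, fun x φ => ?_⟩
    rw [mul_assoc, Finset.sum_mul]
    refine (h x (A' x φ)).trans ?_
    gcongr with l hl
    refine (h' l x φ).trans ?_
    gcongr
    · exact hC' l
    · exact Finset.single_le_sum (f := M') (fun _ _ => Nat.zero_le _) hl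
  supp := by
    obtain ⟨M, h⟩ := hA.supp
    obtain ⟨M', h'⟩ := hA'.supp
    refine ⟨M' + M, fun N x φ hφ n hn => ?_⟩
    exact h (N + M') x _ (h' N x φ hφ) n (by omega)
  symm x φ ψ hφ hψ := by
    rw [Module.End.mul_apply, hA.symm x _ _ hφ (hA'.finSupp x hψ),
      hA'.symm x _ _ (hA.finSupp x hφ) hψ, ← Module.End.mul_apply, ← (hc x).eq]

end IsFieldLike

theorem norm_adjoint_createN_le (n : ℕ) (h : L2 d ℂ) :
    ‖ContinuousLinearMap.adjoint (createN n h)‖ ≤ √((n : ℝ) + 1) * ‖h‖ := by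
  rw [LinearIsometryEquiv.norm_map]
  exact norm_createN_le h

theorem aestronglyMeasurable_clm_apply {E F : Type*} [NormedAddCommGroup E] [NormedSpace ℂ E]
    [NormedAddCommGroup F] [NormedSpace ℂ F] {L : Sp d → E →L[ℂ] F} (hL : Continuous L)
    {φ : Sp d → E} (hφ : AEStronglyMeasurable φ volume) :
    AEStronglyMeasurable (fun x => L x (φ x)) volume :=
  isBoundedBilinearMap_apply.continuous.comp_aestronglyMeasurable
    (hL.aestronglyMeasurable.prodMk hφ)

theorem isFieldLike_create_add_annihilate (g : L2 d ℂ) :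
    IsFieldLike fun x : Sp d => create (phase (-x) g) + annihilate (phase (-x) g) where
  meas Φ h n := by
    have hp : Continuous fun x : Sp d => phase (-x) g := (continuous_phase g).comp continuous_neg
    refine AEStronglyMeasurable.add ?_ ?_
    · cases n with
      | zero => exact aestronglyMeasurable_const
      | succ n =>
        exact aestronglyMeasurable_clm_apply ((continuous_createN (n := n)).comp hp) (h n)
    · have h1 : Continuous fun x : Sp d =>
          ContinuousLinearMap.adjoint (createN n (phase (-x) g)) :=
        ContinuousLinearMap.adjoint.continuous.comp ((continuous_createN (n := n)).comp hp)
      exact aestronglyMeasurable_clm_apply h1 (h (n + 1))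
  bound n := by
    -- The `n`-th component involves only components `n - 1` and `n + 1` of `φ`, hence the range `n
    -- + 2`. The constant is uniform in `x` because the phase leaves `‖g‖` unchanged.
    refine ⟨2 * (√((n : ℝ) + 1) * ‖g‖), by positivity, n + 2, fun x φ => ?_⟩
    rw [two_mul, add_mul]
    have hs : ∀ l ∈ Finset.range (n + 2), ‖φ l‖ ≤ ∑ l ∈ Finset.range (n + 2), ‖φ l‖ := fun l hl =>
      Finset.single_le_sum (f := fun l => ‖φ l‖) (fun _ _ => norm_nonneg _) hl
    refine norm_add_le_of_le ?_ ?_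
    · cases n with
      | zero =>
        change ‖(0 : symL2 d 0)‖ ≤ _
        rw [norm_zero]
        positivity
      | succ n =>
        refine ((createN n (phase (-x) g)).le_opNorm (φ n)).trans ?_
        refine mul_le_mul ((norm_createN_le _).trans ?_) (hs n (by simp; omega)) (norm_nonneg _)
          (by positivity)
        rw [norm_phase]
        gcongr
        simp
    · refine ((ContinuousLinearMap.adjoint (createN n (phase (-x) g))).le_opNorm
        (φ (n + 1))).trans ?_
      refine mul_le_mul ((norm_adjoint_createN_le n _).trans ?_) (hs (n + 1) (by simp))
        (norm_nonneg _) (by positivity)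
      rw [norm_phase]
  supp := by
    refine ⟨1, fun N x φ hφ n hn => ?_⟩
    rw [LinearMap.add_apply, Pi.add_apply, create_eq_zero hφ n hn,
      annihilate_eq_zero hφ n (by omega), add_zero]
  symm x φ ψ hφ hψ := by
    rw [LinearMap.add_apply, LinearMap.add_apply, pair_add_right hφ, pair_add_left hψ,
      pair_create hψ, pair_annihilate hφ, add_comm]

theorem isFieldLike_fieldOp (g : L2 d ℂ) : IsFieldLike (fieldOp g) := by
  have h := (isFieldLike_create_add_annihilate g).smul (√2)⁻¹
  simp only [Complex.ofReal_inv] at h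
  exact h

/-- The operator `p(φ(x))` on sequences. -/
def polyOp (p : Polynomial ℝ) (g : L2 d ℂ) (x : Sp d) : Module.End ℂ (FockSeq d) :=
  Polynomial.aeval (fieldOp g x) (p.map (algebraMap ℝ ℂ))

theorem polyOp_add (p q : Polynomial ℝ) (g : L2 d ℂ) (x : Sp d) :
    polyOp (p + q) g x = polyOp p g x + polyOp q g x := by
  simp only [polyOp, Polynomial.map_add, _root_.map_add]

theorem polyOp_mul (p q : Polynomial ℝ) (g : L2 d ℂ) (x : Sp d) :
    polyOp (p * q) g x = polyOp p g x * polyOp q g x := by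
  simp only [polyOp, Polynomial.map_mul, map_mul]

theorem polyOp_C (c : ℝ) (g : L2 d ℂ) (x : Sp d) :
    polyOp (Polynomial.C c) g x = (c : ℂ) • 1 := by
  rw [polyOp, Polynomial.map_C, Polynomial.aeval_C, Algebra.algebraMap_eq_smul_one]
  rfl

theorem polyOp_X (g : L2 d ℂ) (x : Sp d) : polyOp Polynomial.X g x = fieldOp g x := by
  simp only [polyOp, Polynomial.map_X, Polynomial.aeval_X]

/-- Built from constants, sums and multiplication by the field; the products are admissible because
polynomials in one operator commute. -/
theorem isFieldLike_polyOp (p : Polynomial ℝ) (g : L2 d ℂ) : IsFieldLike (polyOp p g) := by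
  have hC : ∀ c, IsFieldLike (polyOp (Polynomial.C c) g) := by
    intro c
    have : polyOp (Polynomial.C c) g = fun _ : Sp d => (c : ℂ) • 1 := funext fun x => polyOp_C c g x
    rw [this]
    exact IsFieldLike.one.smul c
  induction p using Polynomial.induction_on with
  | C c => exact hC c
  | add p q hp hq =>
    have : polyOp (p + q) g = fun x => polyOp p g x + polyOp q g x :=
      funext fun x => polyOp_add p q g x
    rw [this]
    exact hp.add hq
  | monomial n c ih =>
    have : polyOp (Polynomial.C c * Polynomial.X ^ (n + 1)) g =
        fun x => polyOp (Polynomial.C c * Polynomial.X ^ n) g x * fieldOp g x := by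
      funext x
      rw [pow_succ, ← mul_assoc, polyOp_mul, polyOp_X]
    rw [this]
    refine ih.mul (isFieldLike_fieldOp g) fun x => ?_
    rw [← polyOp_X, Commute, SemiconjBy, ← polyOp_mul, ← polyOp_mul, mul_comm]

theorem seqU_polyOp (p : Polynomial ℝ) (k : Sp d) (g : L2 d ℂ) (x : Sp d) (ψ : FockSeq d) :
    seqU k (polyOp p g (x + k) ψ) = polyOp p g x (seqU k ψ) := by
  induction p using Polynomial.induction_on generalizing ψ with
  | C c => simp only [polyOp_C, LinearMap.smul_apply, Module.End.one_apply, _root_.map_smul]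
  | add p q hp hq => simp only [polyOp_add, LinearMap.add_apply, _root_.map_add, hp, hq]
  | monomial n c ih =>
    rw [pow_succ, ← mul_assoc]
    simp only [polyOp_mul _ Polynomial.X, polyOp_X, Module.End.mul_apply, ih, seqU_fieldOp]

theorem pair_seqU (k : Sp d) (φ ψ : FockSeq d) : pair (seqU k φ) (seqU k ψ) = pair φ ψ :=
  tsum_congr fun n => (symU n k).inner_map_map (φ n) (ψ n)

end Interaction

/-! ### Integrability of inner products and squared norms in `L²` -/

section InnerIntegrable

variable {α : Type*} [MeasurableSpace α] {μ : Measure α} {K : Type*} [NormedAddCommGroup K]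
  [InnerProductSpace ℂ K]

theorem integrable_inner_of_memLp {f g : α → K} (hf : MemLp f 2 μ) (hg : MemLp g 2 μ) :
    Integrable (fun x => ⟪f x, g x⟫_ℂ) μ := by
  refine (L2.integrable_inner (𝕜 := ℂ) (hf.toLp f) (hg.toLp g)).congr ?_
  filter_upwards [hf.coeFn_toLp, hg.coeFn_toLp] with x h1 h2
  rw [h1, h2]

theorem norm_sq_eq_integral (Ψ : Lp K 2 μ) : ‖Ψ‖ ^ 2 = ∫ x, ‖Ψ x‖ ^ 2 ∂μ := by
  have h : ((‖Ψ‖ ^ 2 : ℝ) : ℂ) = ((∫ x, ‖Ψ x‖ ^ 2 ∂μ : ℝ) : ℂ) := by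
    rw [← integral_complex_ofReal]
    have := inner_self_eq_norm_sq_to_K (𝕜 := ℂ) Ψ
    push_cast
    rw [show ((‖Ψ‖ : ℝ) : ℂ) ^ 2 = ⟪Ψ, Ψ⟫_ℂ from this.symm, L2.inner_def]
    refine integral_congr_ae (Eventually.of_forall fun x => ?_)
    simp only [inner_self_eq_norm_sq_to_K]
    rfl
  exact_mod_cast h

theorem integrable_norm_sq {K : Type*} [NormedAddCommGroup K] (Ψ : Lp K 2 μ) : Integrable (fun x => ‖Ψ x‖ ^ 2) μ :=
  (memLp_two_iff_integrable_sq_norm (Lp.aestronglyMeasurable Ψ)).1 (Lp.memLp Ψ)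

end InnerIntegrable

/-! ### The interaction form -/

section InteractionForm

variable {d : ℕ}

/-- The vectors in `L²(ℝ^d; Fock)` with a bounded number of particles. -/
def BddNumber (Ψ : L2 d (Fock d)) : Prop := ∃ N : ℕ, ∀ᵐ x, ∀ n, N < n → Ψ x n = 0

theorem BddNumber.finSupp {Ψ : L2 d (Fock d)} (h : BddNumber Ψ) :
    ∀ᵐ x, FinSupp (toSeq (Ψ x)) := by
  obtain ⟨N, hN⟩ := h
  filter_upwards [hN] with x hx
  exact ⟨N, hx⟩

theorem aestronglyMeasurable_comp (Ψ : L2 d (Fock d)) (n : ℕ) :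
    AEStronglyMeasurable (fun x => toSeq (Ψ x) n) volume :=
  (lp.evalCLM ℂ (fun n => symL2 d n) 2 n).continuous.comp_aestronglyMeasurable
    (Lp.aestronglyMeasurable Ψ)

theorem norm_comp_le (ψ : Fock d) (n : ℕ) : ‖toSeq ψ n‖ ≤ ‖ψ‖ :=
  lp.norm_apply_le_norm (by norm_num) ψ n

/-- `p(φ(x))` is unbounded on Fock space, but a single component of its output depends on finitely
many input components, with constants uniform in `x`. -/
theorem exists_norm_polyOp_le (p : Polynomial ℝ) (g : L2 d ℂ) (n : ℕ) :
    ∃ C : ℝ, 0 ≤ C ∧ ∀ x (ψ : Fock d), ‖polyOp p g x (toSeq ψ) n‖ ≤ C * ‖ψ‖ := by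
  obtain ⟨C, hC, M, h⟩ := (isFieldLike_polyOp p g).bound n
  refine ⟨C * M, by positivity, fun x ψ => (h x _).trans ?_⟩
  rw [mul_assoc]
  gcongr
  refine (Finset.sum_le_card_nsmul _ _ _ fun l _ => norm_comp_le ψ l).trans ?_
  rw [Finset.card_range, nsmul_eq_mul]

theorem memLp_polyOp (p : Polynomial ℝ) (g : L2 d ℂ) (Ψ : L2 d (Fock d)) (n : ℕ) :
    MemLp (fun x => polyOp p g x (toSeq (Ψ x)) n) 2 volume := by
  obtain ⟨C, _, h⟩ := exists_norm_polyOp_le p g n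
  exact (Lp.memLp Ψ).of_le_mul
    ((isFieldLike_polyOp p g).meas _ (aestronglyMeasurable_comp Ψ) n)
    (Eventually.of_forall fun x => h x _)

theorem memLp_comp (Ψ : L2 d (Fock d)) (n : ℕ) : MemLp (fun x => toSeq (Ψ x) n) 2 volume :=
  (Lp.memLp Ψ).of_le (aestronglyMeasurable_comp Ψ n)
    (Eventually.of_forall fun _ => norm_comp_le _ n)

theorem integrable_pair_polyOp (p : Polynomial ℝ) (g : L2 d ℂ) {Ψ : L2 d (Fock d)}
    (hΨ : BddNumber Ψ) (Φ : L2 d (Fock d)) :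
    Integrable fun x => pair (toSeq (Ψ x)) (polyOp p g x (toSeq (Φ x))) := by
  obtain ⟨N, hN⟩ := hΨ
  have h : Integrable fun x => ∑ n ∈ Finset.range (N + 1),
      ⟪toSeq (Ψ x) n, polyOp p g x (toSeq (Φ x)) n⟫_ℂ :=
    integrable_finsetSum _ fun n _ =>
      integrable_inner_of_memLp (memLp_comp Ψ n) (memLp_polyOp p g Φ n)
  refine h.congr ?_
  filter_upwards [hN] with x hx
  exact (pair_eq_sum_left hx (Nat.lt_succ_self N)).symm

theorem interactionForm_val (p : Polynomial ℝ) (g : L2 d ℂ) (Ψ Φ : L2 d (Fock d)) :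
    (interactionForm p g).val Ψ Φ = ∫ x, pair (toSeq (Ψ x)) (polyOp p g x (toSeq (Φ x))) := rfl

theorem toSeq_add (Ψ Φ : L2 d (Fock d)) :
    ∀ᵐ x, toSeq ((Ψ + Φ : L2 d (Fock d)) x) = toSeq (Ψ x) + toSeq (Φ x) := by
  filter_upwards [Lp.coeFn_add Ψ Φ] with x hx
  rw [hx]
  rfl

theorem toSeq_smul (c : ℂ) (Ψ : L2 d (Fock d)) :
    ∀ᵐ x, toSeq ((c • Ψ : L2 d (Fock d)) x) = c • toSeq (Ψ x) := by
  filter_upwards [Lp.coeFn_smul c Ψ] with x hx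
  rw [hx]
  rfl

theorem interactionForm_isHermitian (p : Polynomial ℝ) (g : L2 d ℂ) :
    (interactionForm p g).IsHermitian where
  add_right Ψ hΨ Φ _ Φ' _ := by
    rw [interactionForm_val, interactionForm_val, interactionForm_val,
      ← integral_add (integrable_pair_polyOp p g hΨ Φ) (integrable_pair_polyOp p g hΨ Φ')]
    refine integral_congr_ae ?_
    filter_upwards [toSeq_add Φ Φ', BddNumber.finSupp hΨ] with x h1 h2
    rw [h1, _root_.map_add, pair_add_right h2]
  smul_right Ψ hΨ Φ _ c := by
    rw [interactionForm_val, interactionForm_val, ← integral_const_mul]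
    refine integral_congr_ae ?_
    filter_upwards [toSeq_smul c Φ, BddNumber.finSupp hΨ] with x h1 h2
    rw [h1, _root_.map_smul, pair_smul_right c h2]
  conj_symm Ψ hΨ Φ hΦ := by
    rw [interactionForm_val, interactionForm_val, ← integral_conj]
    refine integral_congr_ae ?_
    filter_upwards [BddNumber.finSupp hΨ, BddNumber.finSupp hΦ] with x h1 h2
    rw [pair_conj, (isFieldLike_polyOp p g).symm x _ _ h1 h2]

theorem interactionForm_add (p q : Polynomial ℝ) (g : L2 d ℂ) {Ψ : L2 d (Fock d)}
    (hΨ : BddNumber Ψ) (Φ : L2 d (Fock d)) : (interactionForm (p + q) g).val Ψ Φ =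
      (interactionForm p g).val Ψ Φ + (interactionForm q g).val Ψ Φ := by
  rw [interactionForm_val, interactionForm_val, interactionForm_val,
    ← integral_add (integrable_pair_polyOp p g hΨ Φ) (integrable_pair_polyOp q g hΨ Φ)]
  refine integral_congr_ae ?_
  filter_upwards [BddNumber.finSupp hΨ] with x h2
  rw [polyOp_add, LinearMap.add_apply, pair_add_right h2]

theorem interactionForm_C (c : ℝ) (g : L2 d ℂ) {Ψ : L2 d (Fock d)} (hΨ : BddNumber Ψ)
    (Φ : L2 d (Fock d)) : (interactionForm (Polynomial.C c) g).val Ψ Φ = c * ⟪Ψ, Φ⟫_ℂ := by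
  rw [interactionForm_val, L2.inner_def, ← integral_const_mul]
  refine integral_congr_ae ?_
  filter_upwards [BddNumber.finSupp hΨ] with x h2
  rw [polyOp_C, LinearMap.smul_apply, Module.End.one_apply, pair_smul_right _ h2]
  rfl

/-- `∫ ‖(p(φ(x)) Ψ(x))^(n)‖² dx`. -/
def compForm (p : Polynomial ℝ) (g : L2 d ℂ) (n : ℕ) (Ψ : L2 d (Fock d)) : ℝ :=
  ∫ x, ‖polyOp p g x (toSeq (Ψ x)) n‖ ^ 2

theorem compForm_nonneg (p : Polynomial ℝ) (g : L2 d ℂ) (n : ℕ) (Ψ : L2 d (Fock d)) :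
    0 ≤ compForm p g n Ψ := integral_nonneg fun _ => sq_nonneg _

theorem integrable_compForm (p : Polynomial ℝ) (g : L2 d ℂ) (n : ℕ) (Ψ : L2 d (Fock d)) :
    Integrable fun x => ‖polyOp p g x (toSeq (Ψ x)) n‖ ^ 2 :=
  (memLp_two_iff_integrable_sq_norm (memLp_polyOp p g Ψ n).1).1 (memLp_polyOp p g Ψ n)

theorem norm_sq_le_sub {E : Type*} [SeminormedAddCommGroup E] (a b : E) :
    ‖a‖ ^ 2 ≤ 2 * ‖a - b‖ ^ 2 + 2 * ‖b‖ ^ 2 := by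
  have h : ‖a‖ ≤ ‖a - b‖ + ‖b‖ := by simpa using norm_add_le (a - b) b
  nlinarith [norm_nonneg a, sq_nonneg (‖a - b‖ - ‖b‖)]

theorem toSeq_sub (Ψ Φ : L2 d (Fock d)) :
    ∀ᵐ x, toSeq ((Ψ - Φ : L2 d (Fock d)) x) = toSeq (Ψ x) - toSeq (Φ x) := by
  filter_upwards [Lp.coeFn_sub Ψ Φ] with x hx
  rw [hx]
  rfl

theorem compForm_le_sub (p : Polynomial ℝ) (g : L2 d ℂ) (n : ℕ) (Ψ Φ : L2 d (Fock d)) :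
    compForm p g n Ψ ≤ 2 * compForm p g n (Ψ - Φ) + 2 * compForm p g n Φ := by
  rw [compForm, compForm, compForm, ← integral_const_mul, ← integral_const_mul, ← integral_add
    ((integrable_compForm p g n _).const_mul 2) ((integrable_compForm p g n _).const_mul 2)]
  refine integral_mono_ae (integrable_compForm p g n Ψ)
    (((integrable_compForm p g n _).const_mul 2).add ((integrable_compForm p g n _).const_mul 2)) ?_
  filter_upwards [toSeq_sub Ψ Φ] with x hx
  rw [hx, map_sub]
  exact norm_sq_le_sub _ _

theorem exists_compForm_le (p : Polynomial ℝ) (g : L2 d ℂ) (n : ℕ) :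
    ∃ C : ℝ, ∀ Ψ : L2 d (Fock d), compForm p g n Ψ ≤ C * ‖Ψ‖ ^ 2 := by
  obtain ⟨C, hC, h⟩ := exists_norm_polyOp_le p g n
  refine ⟨C ^ 2, fun Ψ => ?_⟩
  rw [norm_sq_eq_integral, ← integral_const_mul]
  refine integral_mono (integrable_compForm p g n Ψ) ((integrable_norm_sq Ψ).const_mul _) fun x => ?_
  rw [← mul_pow]
  gcongr
  exact h x _

/-- By symmetry of `p(φ(x))` the form of its square is `∫ ‖p(φ(x)) Ψ(x)‖² dx`, decomposed by
particle number; boundedly many particles leave only finitely many nonzero terms. -/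
theorem interactionForm_sq (p : Polynomial ℝ) (g : L2 d ℂ) {Ψ : L2 d (Fock d)}
    (hΨ : BddNumber Ψ) : (Summable fun n => compForm p g n Ψ) ∧
      (interactionForm (p ^ 2) g).val Ψ Ψ = ((∑' n, compForm p g n Ψ : ℝ) : ℂ) := by
  obtain ⟨M, hM⟩ := (isFieldLike_polyOp p g).supp
  obtain ⟨N, hN⟩ := id hΨ
  have h0 : ∀ n ∉ Finset.range (N + M + 1), compForm p g n Ψ = 0 := by
    intro n hn
    refine integral_eq_zero_of_ae ?_
    filter_upwards [hN] with x hx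
    rw [hM N x (toSeq (Ψ x)) hx n (by simpa using hn), norm_zero]
    simp
  refine ⟨summable_of_ne_finset_zero h0, ?_⟩
  rw [tsum_eq_sum h0, interactionForm_val, Complex.ofReal_sum]
  simp only [compForm]
  simp_rw [← integral_complex_ofReal]
  rw [← integral_finsetSum _ fun n _ => (integrable_compForm p g n Ψ).ofReal]
  refine integral_congr_ae ?_
  filter_upwards [hN, hΨ.finSupp] with x hx h2
  rw [sq, polyOp_mul, Module.End.mul_apply, (isFieldLike_polyOp p g).symm x _ _ h2
    ((isFieldLike_polyOp p g).finSupp x h2), pair_eq_sum_left (hM N x (toSeq (Ψ x)) hx) (Nat.lt_succ_self _)]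
  refine Finset.sum_congr rfl fun n _ => ?_
  rw [inner_self_eq_norm_sq_to_K]
  push_cast
  rfl

theorem coeFn_totalU {K : Type*} [NormedAddCommGroup K] [InnerProductSpace ℂ K]
    (T : Sp d → (K ≃ₗᵢ[ℂ] K)) (k : Sp d) (Ψ : L2 d K) :
    totalU T k Ψ =ᵐ[volume] fun x => T k (Ψ (x + k)) := by
  filter_upwards [coeFn_liftU (T k) (shift k Ψ), coeFn_shift k Ψ] with x h1 h2
  rw [totalU_apply, h1, h2]

/-- Covariance of the field under `fockU k`, followed by the substitution `x ↦ x + k`. -/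
theorem interactionForm_totalU (p : Polynomial ℝ) (g : L2 d ℂ) (k : Sp d) (Ψ Φ : L2 d (Fock d)) :
    (interactionForm p g).val (totalU fockU k Ψ) (totalU fockU k Φ) =
      (interactionForm p g).val Ψ Φ := by
  rw [interactionForm_val, interactionForm_val, ← integral_add_right_eq_self
    (fun x => pair (toSeq (Ψ x)) (polyOp p g x (toSeq (Φ x)))) k]
  refine integral_congr_ae ?_
  filter_upwards [coeFn_totalU fockU k Ψ, coeFn_totalU fockU k Φ] with x h1 h2
  rw [h1, h2]
  have h3 : ∀ ψ : Fock d, toSeq (fockU k ψ) = seqU k (toSeq ψ) := fun _ => rfl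
  rw [h3, h3, ← seqU_polyOp, pair_seqU]

/-- `P(φ(x))` acts in the fibre over `x` and therefore commutes with multiplication by scalar
functions of `x`. -/
theorem interactionForm_smul (p : Polynomial ℝ) (g : L2 d ℂ) {Ψ Φ : L2 d (Fock d)}
    (hΦ : BddNumber Φ) {c : Sp d → ℂ} (h : Ψ =ᵐ[volume] fun x => c x • Φ x) :
    (interactionForm p g).val Ψ Ψ =
      ∫ x, ((‖c x‖ ^ 2 : ℝ) : ℂ) * pair (toSeq (Φ x)) (polyOp p g x (toSeq (Φ x))) := by
  rw [interactionForm_val]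
  refine integral_congr_ae ?_
  filter_upwards [h, hΦ.finSupp] with x h1 h2
  have h3 : toSeq (Ψ x) = c x • toSeq (Φ x) := by
    rw [h1]
    rfl
  rw [h3, _root_.map_smul, pair_smul_right _ (h2.smul _),
    pair_smul_left _ ((isFieldLike_polyOp p g).finSupp x h2), ← mul_assoc, Complex.mul_conj,
    Complex.normSq_eq_norm_sq]

end InteractionForm

/-! ### Hermitian forms -/

section Hermitian

variable {H : Type*} [NormedAddCommGroup H] [InnerProductSpace ℂ H]

namespace SForm.IsHermitian

variable {q r : SForm H}

theorem sum (hq : q.IsHermitian) (hr : r.IsHermitian) : (q.sum r).IsHermitian where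
  add_right Ψ hΨ Φ hΦ Φ' hΦ' := by
    change q.val _ _ + r.val _ _ = q.val _ _ + r.val _ _ + (q.val _ _ + r.val _ _)
    rw [hq.add_right Ψ hΨ.1 Φ hΦ.1 Φ' hΦ'.1, hr.add_right Ψ hΨ.2 Φ hΦ.2 Φ' hΦ'.2]
    ring
  smul_right Ψ hΨ Φ hΦ c := by
    change q.val _ _ + r.val _ _ = c * (q.val _ _ + r.val _ _)
    rw [hq.smul_right Ψ hΨ.1 Φ hΦ.1 c, hr.smul_right Ψ hΨ.2 Φ hΦ.2 c, mul_add]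
  conj_symm Ψ hΨ Φ hΦ := by
    change conj (q.val _ _ + r.val _ _) = q.val _ _ + r.val _ _
    rw [_root_.map_add, hq.conj_symm Ψ hΨ.1 Φ hΦ.1, hr.conj_symm Ψ hΨ.2 Φ hΦ.2]

theorem add_left (hq : q.IsHermitian) {Ψ Ψ' Φ : H} (hΨ : Ψ ∈ q.dom) (hΨ' : Ψ' ∈ q.dom)
    (hΦ : Φ ∈ q.dom) : q.val (Ψ + Ψ') Φ = q.val Ψ Φ + q.val Ψ' Φ := by
  rw [← hq.conj_symm _ (q.dom.add_mem hΨ hΨ') _ hΦ, hq.add_right Φ hΦ Ψ hΨ Ψ' hΨ', _root_.map_add,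
    hq.conj_symm _ hΨ _ hΦ, hq.conj_symm _ hΨ' _ hΦ]

theorem smul_left (hq : q.IsHermitian) {Ψ Φ : H} (c : ℂ) (hΨ : Ψ ∈ q.dom) (hΦ : Φ ∈ q.dom) :
    q.val (c • Ψ) Φ = conj c * q.val Ψ Φ := by
  rw [← hq.conj_symm _ (q.dom.smul_mem c hΨ) _ hΦ, hq.smul_right Φ hΦ Ψ hΨ c, map_mul,
    hq.conj_symm _ hΨ _ hΦ]

theorem zero_left (hq : q.IsHermitian) {Φ : H} (hΦ : Φ ∈ q.dom) : q.val 0 Φ = 0 := by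
  have := hq.smul_left 0 hΦ hΦ
  simpa using this

theorem zero_right (hq : q.IsHermitian) {Φ : H} (hΦ : Φ ∈ q.dom) : q.val Φ 0 = 0 := by
  have := hq.smul_right Φ hΦ Φ hΦ 0
  simpa using this

theorem val_self (hq : q.IsHermitian) {Ψ : H} (hΨ : Ψ ∈ q.dom) :
    q.val Ψ Ψ = ((q.val Ψ Ψ).re : ℂ) :=
  (Complex.conj_eq_iff_re.1 (hq.conj_symm Ψ hΨ Ψ hΨ)).symm

theorem val_smul_self (hq : q.IsHermitian) (c : ℂ) {Ψ : H} (hΨ : Ψ ∈ q.dom) :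
    (q.val (c • Ψ) (c • Ψ)).re = ‖c‖ ^ 2 * (q.val Ψ Ψ).re := by
  rw [hq.smul_left c hΨ (q.dom.smul_mem c hΨ), hq.smul_right Ψ hΨ Ψ hΨ c, ← mul_assoc,
    mul_comm (conj c), Complex.mul_conj, Complex.normSq_eq_norm_sq, Complex.re_ofReal_mul]

theorem parallelogram (hq : q.IsHermitian) {a b : H} (ha : a ∈ q.dom) (hb : b ∈ q.dom) :
    q.val (a + b) (a + b) + q.val (a - b) (a - b) = 2 * q.val a a + 2 * q.val b b := by
  have hb' := q.dom.smul_mem (-1) hb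
  have e : a - b = a + (-1 : ℂ) • b := by simp [sub_eq_add_neg]
  rw [e, hq.add_left ha hb (q.dom.add_mem ha hb), hq.add_right a ha a ha b hb,
    hq.add_right b hb a ha b hb, hq.add_left ha hb' (q.dom.add_mem ha hb'),
    hq.add_right a ha a ha _ hb', hq.add_right _ hb' a ha _ hb', hq.smul_left _ hb ha,
    hq.smul_left _ hb hb', hq.smul_right _ ha _ hb, hq.smul_right _ hb _ hb]
  simp
  ring

/-- The parallelogram identity for `u - v` and `v`, after dropping the non-negative term at `u -
2v`. -/
theorem re_le_sub (hq : q.IsHermitian) {D : Submodule ℂ H} (hD : D ≤ q.dom)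
    (hnn : ∀ Ψ ∈ D, 0 ≤ (q.val Ψ Ψ).re) {u v : H} (hu : u ∈ D) (hv : v ∈ D) :
    (q.val u u).re ≤ 2 * (q.val (u - v) (u - v)).re + 2 * (q.val v v).re := by
  have hs := D.sub_mem hu hv
  have h := congrArg Complex.re (hq.parallelogram (hD hs) (hD hv))
  simp only [sub_add_cancel, Complex.add_re, Complex.mul_re, Complex.re_ofNat, Complex.im_ofNat,
    zero_mul, sub_zero] at h
  linarith [hnn _ (D.sub_mem hs hv)]

end SForm.IsHermitian

/-- The form `c ⟨Ψ, Φ⟩`. -/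
def innerForm (H : Type*) [NormedAddCommGroup H] [InnerProductSpace ℂ H] (c : ℝ) : SForm H where
  dom := ⊤
  val Ψ Φ := c * ⟪Ψ, Φ⟫_ℂ

theorem innerForm_isHermitian (c : ℝ) : (innerForm H c).IsHermitian where
  add_right Ψ _ Φ _ Φ' _ := by
    simp only [innerForm, inner_add_right, mul_add]
  smul_right Ψ _ Φ _ a := by
    simp only [innerForm, inner_smul_right]
    ring
  conj_symm Ψ _ Φ _ := by
    simp only [innerForm, map_mul, Complex.conj_ofReal, inner_conj_symm]

theorem innerForm_val_self (c : ℝ) (Ψ : H) :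
    (innerForm H c).val Ψ Ψ = ((c * ‖Ψ‖ ^ 2 : ℝ) : ℂ) := by
  simp only [innerForm, inner_self_eq_norm_sq_to_K]
  push_cast
  rfl

/-- A non-negative closable quadratic form. -/
structure NNClosable (D : Submodule ℂ H) (q : H → ℝ) : Prop where
  nonneg : ∀ Ψ ∈ D, 0 ≤ q Ψ
  le_sub : ∀ u ∈ D, ∀ v ∈ D, q u ≤ 2 * q (u - v) + 2 * q v
  closable : QClosable D q

namespace NNClosable

variable {D : Submodule ℂ H}

theorem of_hasSum {ι : Type*} {q : H → ℝ} {qe : ι → H → ℝ} (h : ∀ e, NNClosable D (qe e))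
    (hsum : ∀ Ψ ∈ D, HasSum (fun e => qe e Ψ) (q Ψ)) : NNClosable D q where
  nonneg Ψ hΨ := (hsum Ψ hΨ).nonneg fun e => (h e).nonneg Ψ hΨ
  le_sub u hu v hv := hasSum_le (fun e => (h e).le_sub u hu v hv) (hsum u hu)
    (((hsum _ (D.sub_mem hu hv)).mul_left 2).add ((hsum v hv).mul_left 2))
  closable := qClosable_of_hasSum hsum (fun e => (h e).nonneg) (fun e => (h e).le_sub)
    fun e => (h e).closable

theorem add {q r : H → ℝ} (hq : NNClosable D q) (hr : NNClosable D r) :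
    NNClosable D fun Ψ => q Ψ + r Ψ := by
  refine of_hasSum (qe := fun (b : Bool) => if b then q else r) ?_ ?_
  · rintro (_ | _)
    · exact hr
    · exact hq
  · intro Ψ _
    have h := hasSum_fintype fun b : Bool => (if b then q else r) Ψ
    simpa using h

theorem of_le {q : H → ℝ} (hnn : ∀ Ψ ∈ D, 0 ≤ q Ψ)
    (hsub : ∀ u ∈ D, ∀ v ∈ D, q u ≤ 2 * q (u - v) + 2 * q v) {C : ℝ}
    (hC : ∀ Ψ ∈ D, q Ψ ≤ C * ‖Ψ‖ ^ 2) : NNClosable D q where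
  nonneg := hnn
  le_sub := hsub
  closable Ψ hΨ h0 _ := by
    have h1 : Tendsto (fun n => C * ‖Ψ n‖ ^ 2) atTop (𝓝 0) := by
      simpa using (h0.norm.pow 2).const_mul C
    exact squeeze_zero (fun n => hnn _ (hΨ n)) (fun n => hC _ (hΨ n)) h1

end NNClosable

end Hermitian

/-! ### Multiplication operators in `x` and `p` -/

section Mul

variable {d : ℕ} {K : Type*} [NormedAddCommGroup K] [InnerProductSpace ℂ K]

theorem mem_mulForm_dom {m : Sp d → ℝ} {Ψ : L2 d K} : Ψ ∈ (mulForm m : SForm (L2 d K)).dom ↔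
    MemLp (fun x => ((√|m x| : ℝ) : ℂ) • Ψ x) 2 volume := Iff.rfl

theorem mulForm_val (m : Sp d → ℝ) (Ψ Φ : L2 d K) :
    (mulForm m : SForm (L2 d K)).val Ψ Φ = ∫ x, (m x : ℂ) * ⟪Ψ x, Φ x⟫_ℂ := rfl

theorem integrable_mulForm {m : Sp d → ℝ} (hm : AEStronglyMeasurable m volume) {Ψ Φ : L2 d K}
    (hΨ : Ψ ∈ (mulForm m : SForm (L2 d K)).dom) (hΦ : Φ ∈ (mulForm m : SForm (L2 d K)).dom) :
    Integrable fun x => (m x : ℂ) * ⟪Ψ x, Φ x⟫_ℂ := by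
  refine (integrable_inner_of_memLp (mem_mulForm_dom.1 hΨ) (mem_mulForm_dom.1 hΦ)).mono
    ((Complex.continuous_ofReal.comp_aestronglyMeasurable hm).mul
      (L2.integrable_inner Ψ Φ).aestronglyMeasurable) (Eventually.of_forall fun x => le_of_eq ?_)
  rw [inner_smul_left, inner_smul_right, Complex.conj_ofReal, ← mul_assoc, ← Complex.ofReal_mul,
    Real.mul_self_sqrt (abs_nonneg _), norm_mul, norm_mul, Complex.norm_real, Complex.norm_real,
    Real.norm_eq_abs, Real.norm_eq_abs, abs_abs]

theorem integrable_mul_norm_sq {m : Sp d → ℝ} (hm : AEStronglyMeasurable m volume) {Ψ : L2 d K}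
    (hΨ : Ψ ∈ (mulForm m : SForm (L2 d K)).dom) : Integrable fun x => m x * ‖Ψ x‖ ^ 2 := by
  have h := (integrable_mulForm hm hΨ hΨ).re
  refine h.congr (Eventually.of_forall fun x => ?_)
  simp only [inner_self_eq_norm_sq_to_K]
  change (((m x : ℝ) : ℂ) * ((‖Ψ x‖ : ℝ) : ℂ) ^ 2).re = _
  rw [← Complex.ofReal_pow, ← Complex.ofReal_mul, Complex.ofReal_re]

theorem mulForm_val_self (m : Sp d → ℝ) (Ψ : L2 d K) :
    (mulForm m : SForm (L2 d K)).val Ψ Ψ = ((∫ x, m x * ‖Ψ x‖ ^ 2 : ℝ) : ℂ) := by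
  rw [← integral_complex_ofReal]
  refine integral_congr_ae (Eventually.of_forall fun x => ?_)
  simp only [inner_self_eq_norm_sq_to_K]
  push_cast
  rfl

theorem mulForm_isHermitian {m : Sp d → ℝ} (hm : AEStronglyMeasurable m volume) :
    (mulForm m : SForm (L2 d K)).IsHermitian where
  add_right Ψ hΨ Φ hΦ Φ' hΦ' := by
    rw [mulForm_val, mulForm_val, mulForm_val, ← integral_add (integrable_mulForm hm hΨ hΦ) (integrable_mulForm hm hΨ hΦ')]
    refine integral_congr_ae ?_
    filter_upwards [Lp.coeFn_add Φ Φ'] with x hx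
    rw [hx, Pi.add_apply, inner_add_right, mul_add]
  smul_right Ψ hΨ Φ hΦ c := by
    rw [mulForm_val, mulForm_val, ← integral_const_mul]
    refine integral_congr_ae ?_
    filter_upwards [Lp.coeFn_smul c Φ] with x hx
    rw [hx, Pi.smul_apply, inner_smul_right]
    ring
  conj_symm Ψ hΨ Φ hΦ := by
    rw [mulForm_val, mulForm_val, ← integral_conj]
    refine integral_congr_ae (Eventually.of_forall fun x => ?_)
    simp only [map_mul, Complex.conj_ofReal, inner_conj_symm]

theorem tensor_mem_mulForm_dom {m : Sp d → ℝ} {f : L2 d ℂ}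
    (hf : f ∈ (mulForm m : SForm (L2 d ℂ)).dom) (ψ : K) :
    tensor f ψ ∈ (mulForm m : SForm (L2 d K)).dom := by
  rw [mem_mulForm_dom] at hf ⊢
  refine ((ContinuousLinearMap.toSpanSingleton ℂ ψ).comp_memLp' hf).ae_eq ?_
  filter_upwards [coeFn_tensor f ψ] with x hx
  rw [hx, Function.comp_apply, ContinuousLinearMap.toSpanSingleton_apply, smul_assoc]

theorem mulForm_tensor (m : Sp d → ℝ) (f g : L2 d ℂ) (ψ φ : K) :
    (mulForm m : SForm (L2 d K)).val (tensor f ψ) (tensor g φ) =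
      (mulForm m : SForm (L2 d ℂ)).val f g * ⟪ψ, φ⟫_ℂ := by
  rw [mulForm_val, mulForm_val, ← integral_mul_const]
  refine integral_congr_ae ?_
  filter_upwards [coeFn_tensor f ψ, coeFn_tensor g φ] with x h1 h2
  rw [h1, h2, inner_smul_left, inner_smul_right, RCLike.inner_apply]
  ring

variable [CompleteSpace K]

theorem mem_momentumForm_dom {m : Sp d → ℝ} {Ψ : L2 d K} :
    Ψ ∈ (momentumForm m : SForm (L2 d K)).dom ↔
      FT Ψ ∈ (mulForm fun ξ => m ((2 * Real.pi) • ξ) : SForm (L2 d K)).dom := Iff.rfl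

theorem momentumForm_val (m : Sp d → ℝ) (Ψ Φ : L2 d K) :
    (momentumForm m : SForm (L2 d K)).val Ψ Φ =
      (mulForm fun ξ => m ((2 * Real.pi) • ξ) : SForm (L2 d K)).val (FT Ψ) (FT Φ) := rfl

theorem momentumForm_isHermitian {m : Sp d → ℝ} (hm : Continuous m) :
    (momentumForm m : SForm (L2 d K)).IsHermitian := by
  have hm' : Continuous fun ξ => m ((2 * Real.pi) • ξ) := by fun_prop
  have h := mulForm_isHermitian (K := K) hm'.aestronglyMeasurable
  refine ⟨?_, ?_, ?_⟩
  · intro Ψ hΨ Φ hΦ Φ' hΦ'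
    rw [momentumForm_val, momentumForm_val, momentumForm_val, _root_.map_add]
    exact h.add_right _ hΨ _ hΦ _ hΦ'
  · intro Ψ hΨ Φ hΦ c
    rw [momentumForm_val, momentumForm_val, _root_.map_smul]
    exact h.smul_right _ hΨ _ hΦ c
  · intro Ψ hΨ Φ hΦ
    exact h.conj_symm _ hΨ _ hΦ

theorem tensor_mem_momentumForm_dom {m : Sp d → ℝ} {f : L2 d ℂ}
    (hf : f ∈ (momentumForm m : SForm (L2 d ℂ)).dom) (ψ : K) :
    tensor f ψ ∈ (momentumForm m : SForm (L2 d K)).dom := by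
  rw [mem_momentumForm_dom] at hf ⊢
  rw [FT_tensor]
  exact tensor_mem_mulForm_dom hf ψ

theorem momentumForm_tensor (m : Sp d → ℝ) (f g : L2 d ℂ) (ψ φ : K) :
    (momentumForm m : SForm (L2 d K)).val (tensor f ψ) (tensor g φ) =
      (momentumForm m : SForm (L2 d ℂ)).val f g * ⟪ψ, φ⟫_ℂ := by
  rw [momentumForm_val, FT_tensor, FT_tensor, mulForm_tensor, momentumForm_val]

/-- In Fourier space `totalU` acts by a scalar phase and a unitary on the fibres; neither changes
the integrand. -/
theorem momentumForm_totalU (m : Sp d → ℝ) (T : Sp d → (K ≃ₗᵢ[ℂ] K)) (k : Sp d) (Ψ Φ : L2 d K) :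
    (momentumForm m : SForm (L2 d K)).val (totalU T k Ψ) (totalU T k Φ) =
      (momentumForm m).val Ψ Φ := by
  rw [momentumForm_val, momentumForm_val, totalU_apply, totalU_apply, FT_liftU, FT_liftU, FT_shift,
    FT_shift]
  refine integral_congr_ae ?_
  filter_upwards [coeFn_liftU (T k) (phase ((2 * Real.pi) • k) (FT Ψ)),
    coeFn_liftU (T k) (phase ((2 * Real.pi) • k) (FT Φ)), coeFn_phase ((2 * Real.pi) • k) (FT Ψ),
    coeFn_phase ((2 * Real.pi) • k) (FT Φ)] with ξ h1 h2 h3 h4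
  rw [h1, h2, h3, h4, LinearIsometryEquiv.inner_map_map, inner_smul_left, inner_smul_right,
    ← mul_assoc (conj _), mul_comm (conj _), Complex.mul_conj, Complex.normSq_eq_norm_sq,
    norm_exp_I_mul]
  simp

/-- Local integrability suffices because `|u|²` is continuous with compact support. -/
theorem testFunctions_le_mulForm_dom {V : Sp d → ℝ} (hV : LocallyIntegrable V volume) :
    testFunctions d ≤ (mulForm V : SForm (L2 d ℂ)).dom := by
  rintro f ⟨u, hu, hc, hf⟩
  rw [mem_mulForm_dom]
  have hm : AEStronglyMeasurable (fun x => ((√|V x| : ℝ) : ℂ)) volume :=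
    (Complex.continuous_ofReal.comp (Real.continuous_sqrt.comp continuous_abs)
      ).comp_aestronglyMeasurable hV.aestronglyMeasurable
  refine (memLp_two_iff_integrable_sq_norm (hm.smul (Lp.aestronglyMeasurable f))).2 ?_
  have h1 : Integrable fun x => (‖u x‖ ^ 2) • V x :=
    hV.integrable_smul_left_of_hasCompactSupport (hu.continuous.norm.pow 2)
      (hc.norm.comp_left (g := fun t : ℝ => t ^ 2) (by simp))
  refine h1.norm.congr ?_
  filter_upwards [hf] with x hx
  rw [Pi.smul_apply', hx, norm_smul, norm_smul, Complex.norm_real,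
    Real.norm_of_nonneg (Real.sqrt_nonneg _), mul_pow, Real.sq_sqrt (abs_nonneg _), norm_pow,
    norm_norm, mul_comm, Real.norm_eq_abs]

theorem testFunctions_le_momentumForm_dom {B : ℝ → ℝ} (hB : IsBernstein B) :
    testFunctions d ≤ (momentumForm (fun k => B (‖k‖ ^ 2)) : SForm (L2 d ℂ)).dom := by
  intro f hf
  rw [mem_momentumForm_dom, mem_mulForm_dom]
  obtain ⟨C, hC, h⟩ := hB.exists_linear_bound
  have hc : Continuous fun ξ : Sp d => B (‖(2 * Real.pi) • ξ‖ ^ 2) :=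
    (hB.continuous_norm_sq (E := Sp d)).comp (continuous_const_smul _)
  -- The constant comes from `√t ≤ 1 + t` and `t ≤ C (1 + 4π²|ξ|²)`.
  refine memLp_mul_FT_test hf (C := 1 + C * (1 + (2 * Real.pi) ^ 2))
    (Complex.continuous_ofReal.comp (Real.continuous_sqrt.comp
      (continuous_abs.comp hc))).aestronglyMeasurable fun ξ => ?_
  rw [Complex.norm_real,
    Real.norm_of_nonneg (Real.sqrt_nonneg _),
    abs_of_nonneg (hB.nonneg _ (sq_nonneg _)), norm_smul, Real.norm_of_nonneg (by positivity)]
  set t := B ((2 * Real.pi * ‖ξ‖) ^ 2) with ht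
  have ht0 : 0 ≤ t := hB.nonneg _ (sq_nonneg _)
  have h1 : √t ≤ 1 + t := by
    rw [Real.sqrt_le_left (by positivity)]
    nlinarith
  have h2 : t ≤ C * (1 + (2 * Real.pi * ‖ξ‖) ^ 2) := h _ (sq_nonneg _)
  rw [mul_pow] at h2
  nlinarith [mul_nonneg hC (sq_nonneg ‖ξ‖), mul_nonneg hC (sq_nonneg (2 * Real.pi)),
    sq_nonneg ‖ξ‖]

end Mul

/-! ### Expansion in an orthonormal basis of the second tensor factor -/

section Expansion

variable {d : ℕ} {K : Type*} [NormedAddCommGroup K] [InnerProductSpace ℂ K]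

/-- The partial inner product `x ↦ ⟨e, Ψ(x)⟩`. -/
def bra (e : K) : L2 d K →L[ℂ] L2 d ℂ := ContinuousLinearMap.compLpL 2 volume (innerSL ℂ e)

theorem tensor_scalar (f : L2 d ℂ) (c : ℂ) : tensor f c = c • f := by
  refine Lp.ext ?_
  filter_upwards [coeFn_tensor f c, Lp.coeFn_smul c f] with x h1 h2
  rw [h1, h2, Pi.smul_apply, smul_eq_mul, smul_eq_mul, mul_comm]

theorem bra_tensor (e : K) (f : L2 d ℂ) (ψ : K) : bra e (tensor f ψ) = ⟪e, ψ⟫_ℂ • f := by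
  rw [← tensor_scalar]
  exact compLp_tensor (innerSL ℂ e) f ψ

variable {D : Submodule ℂ (L2 d ℂ)} {F : Submodule ℂ K}

theorem bra_mem (e : K) {Ψ : L2 d K} (hΨ : Ψ ∈ algTensor D F) : bra e Ψ ∈ D := by
  refine Submodule.span_induction ?_ ?_ ?_ ?_ hΨ
  · rintro _ ⟨f, hf, ψ, _, rfl⟩
    rw [bra_tensor]
    exact D.smul_mem _ hf
  · rw [_root_.map_zero]
    exact D.zero_mem
  · intro x y _ _ hx hy
    rw [_root_.map_add]
    exact D.add_mem hx hy
  · intro c x _ hx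
    rw [_root_.map_smul]
    exact D.smul_mem c hx

/-- `(q₀ ⊗ I)(Ψ, Φ) = ∑_e q₀(⟨e, Ψ⟩, ⟨e, Φ⟩)`. -/
theorem hasSum_val_bra {ι : Type*} (b : HilbertBasis ι ℂ K) {q : SForm (L2 d K)}
    {q₀ : SForm (L2 d ℂ)} (hq : q.IsHermitian) (hq₀ : q₀.IsHermitian) (hD : D ≤ q₀.dom)
    (hdom : algTensor D F ≤ q.dom)
    (h : ∀ f ∈ D, ∀ g ∈ D, ∀ ψ φ, q.val (tensor f ψ) (tensor g φ) = q₀.val f g * ⟪ψ, φ⟫_ℂ)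
    {Ψ Φ : L2 d K} (hΨ : Ψ ∈ algTensor D F) (hΦ : Φ ∈ algTensor D F) :
    HasSum (fun i => q₀.val (bra (b i) Ψ) (bra (b i) Φ)) (q.val Ψ Φ) := by
  have hb : ∀ i {Ψ : L2 d K}, Ψ ∈ algTensor D F → bra (b i) Ψ ∈ q₀.dom :=
    fun i Ψ hΨ => hD (bra_mem (b i) hΨ)
  refine Submodule.span_induction (p := fun Ψ _ => HasSum
    (fun i => q₀.val (bra (b i) Ψ) (bra (b i) Φ)) (q.val Ψ Φ)) ?_ ?_ ?_ ?_ hΨ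
  · rintro _ ⟨f, hf, ψ, hψ, rfl⟩
    have hfψ := tensor_mem_algTensor hf hψ
    refine Submodule.span_induction (p := fun Φ _ => HasSum
      (fun i => q₀.val (bra (b i) (tensor f ψ)) (bra (b i) Φ)) (q.val (tensor f ψ) Φ))
      ?_ ?_ ?_ ?_ hΦ
    · rintro _ ⟨g, hg, φ, hφ, rfl⟩
      rw [h f hf g hg]
      -- On product vectors the expansion is Parseval's identity for `⟪ψ, φ⟫`; sesquilinearity
      -- extends it to the span.
      refine ((b.hasSum_inner_mul_inner ψ φ).mul_left (q₀.val f g)).congr_fun ?_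
      intro i
      rw [bra_tensor, bra_tensor, hq₀.smul_left _ (hD hf) (q₀.dom.smul_mem _ (hD hg)),
        hq₀.smul_right _ (hD hf) _ (hD hg), inner_conj_symm]
      ring
    · simp only [_root_.map_zero, hq.zero_right (hdom hfψ), hq₀.zero_right (hb _ hfψ)]
      exact hasSum_zero
    · intro x y hx hy h1 h2
      rw [hq.add_right _ (hdom hfψ) _ (hdom hx) _ (hdom hy)]
      refine (h1.add h2).congr_fun fun i => ?_
      rw [_root_.map_add, hq₀.add_right _ (hb i hfψ) _ (hb i hx) _ (hb i hy)]
    · intro c x hx h1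
      rw [hq.smul_right _ (hdom hfψ) _ (hdom hx)]
      refine (h1.mul_left c).congr_fun fun i => ?_
      rw [_root_.map_smul, hq₀.smul_right _ (hb i hfψ) _ (hb i hx)]
  · simp only [_root_.map_zero, hq.zero_left (hdom hΦ), hq₀.zero_left (hb _ hΦ)]
    exact hasSum_zero
  · intro x y hx hy h1 h2
    rw [hq.add_left (hdom hx) (hdom hy) (hdom hΦ)]
    refine (h1.add h2).congr_fun fun i => ?_
    rw [_root_.map_add, hq₀.add_left (hb i hx) (hb i hy) (hb i hΦ)]
  · intro c x hx h1
    rw [hq.smul_left c (hdom hx) (hdom hΦ)]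
    refine (h1.mul_left _).congr_fun fun i => ?_
    rw [_root_.map_smul, hq₀.smul_left c (hb i hx) (hb i hΦ)]

end Expansion

/-! ### Closability of forms given by the norm of an image vector -/

section Closable

variable {H : Type*} [NormedAddCommGroup H] [InnerProductSpace ℂ H]
  {H' : Type*} [NormedAddCommGroup H'] [InnerProductSpace ℂ H'] {D : Submodule ℂ H}

/-- The form `‖Θ‖²`, where `Θ` is the image of `Ψ` under an operator with densely defined
adjoint, is closable. -/
theorem NNClosable.of_rel [CompleteSpace H'] {R : H → H' → Prop} {q : H → ℝ}
    (hR : ∀ Ψ ∈ D, ∃ Θ, R Ψ Θ)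
    (hsub : ∀ {Ψ Θ Ψ' Θ'}, R Ψ Θ → R Ψ' Θ' → R (Ψ - Ψ') (Θ - Θ'))
    (hq : ∀ {Ψ Θ}, R Ψ Θ → q Ψ = ‖Θ‖ ^ 2) {S : Set H'} (hS : Dense S)
    (hadj : ∀ Ξ ∈ S, ∃ Ξ' : H, ∀ Ψ Θ, R Ψ Θ → ⟪Θ, Ξ⟫_ℂ = ⟪Ψ, Ξ'⟫_ℂ) : NNClosable D q where
  nonneg Ψ hΨ := by
    obtain ⟨Θ, h⟩ := hR Ψ hΨ
    rw [hq h]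
    positivity
  le_sub u hu v hv := by
    obtain ⟨a, ha⟩ := hR u hu
    obtain ⟨b, hb⟩ := hR v hv
    rw [hq ha, hq hb, hq (hsub ha hb)]
    exact norm_sq_le_sub a b
  closable Ψ hΨ h0 hc := by
    choose Θ hΘ using fun n => hR (Ψ n) (hΨ n)
    have hcau : CauchySeq Θ := by
      rw [cauchySeq_iff_tendsto_dist_atTop_0]
      have h1 : Tendsto (fun m : ℕ × ℕ => √(q (Ψ m.1 - Ψ m.2))) atTop (𝓝 0) := by
        simpa using hc.sqrt
      refine h1.congr fun m => ?_
      rw [hq (hsub (hΘ m.1) (hΘ m.2)), Real.sqrt_sq (norm_nonneg _), dist_eq_norm]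
    obtain ⟨Θ', hlim⟩ := cauchySeq_tendsto_of_complete hcau
    -- The images converge by completeness. Moving the operator to the other side against the dense
    -- set `S` forces their limit to vanish, since `Ψ n → 0`.
    have hz : Θ' = 0 := by
      refine hS.eq_zero_of_inner_left ℂ fun Ξ hΞ => ?_
      obtain ⟨Ξ', h⟩ := hadj Ξ hΞ
      have h1 : Tendsto (fun n => ⟪Θ n, Ξ⟫_ℂ) atTop (𝓝 ⟪Θ', Ξ⟫_ℂ) := hlim.inner tendsto_const_nhds
      have h2 : Tendsto (fun n => ⟪Ψ n, Ξ'⟫_ℂ) atTop (𝓝 ⟪(0 : H), Ξ'⟫_ℂ) :=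
        h0.inner tendsto_const_nhds
      rw [inner_zero_left] at h2
      exact tendsto_nhds_unique h1 (h2.congr fun n => (h _ _ (hΘ n)).symm)
    rw [hz] at hlim
    have h3 : Tendsto (fun n => ‖Θ n‖ ^ 2) atTop (𝓝 0) := by simpa using hlim.norm.pow 2
    exact h3.congr fun n => (hq (hΘ n)).symm

theorem NNClosable.comp {D' : Submodule ℂ H'} {q : H' → ℝ} (hq : NNClosable D' q) (L : H →L[ℂ] H')
    (hL : ∀ Ψ ∈ D, L Ψ ∈ D') : NNClosable D fun Ψ => q (L Ψ) where
  nonneg Ψ hΨ := hq.nonneg _ (hL Ψ hΨ)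
  le_sub u hu v hv := by
    rw [map_sub]
    exact hq.le_sub _ (hL u hu) _ (hL v hv)
  closable Ψ hΨ h0 hc := by
    refine hq.closable (fun n => L (Ψ n)) (fun n => hL _ (hΨ n)) ?_ ?_
    · have h1 := (L.continuous.tendsto 0).comp h0
      rw [_root_.map_zero] at h1
      exact h1
    · simpa only [map_sub] using hc

end Closable

/-! ### The free field form -/

section FreeField

variable {d : ℕ}

/-- `Θ = (I ⊗ H_f^{1/2}) Ψ`. -/
def FreeRel (disp : Sp d → ℝ) (Ψ Θ : L2 d (Fock d)) : Prop :=
  ∀ᵐ x, (Ψ x, Θ x) ∈ (sectorMul fun n k => √(∑ i : Fin n, disp (k i))).graph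

variable {disp : Sp d → ℝ}

theorem mem_freeFieldForm_dom {Ψ : L2 d (Fock d)} :
    Ψ ∈ (freeFieldForm disp).dom ↔ ∃ Θ, FreeRel disp Ψ Θ := Iff.rfl

theorem FreeRel.add {Ψ Θ Ψ' Θ' : L2 d (Fock d)} (h : FreeRel disp Ψ Θ) (h' : FreeRel disp Ψ' Θ') :
    FreeRel disp (Ψ + Ψ') (Θ + Θ') := by
  filter_upwards [h, h', Lp.coeFn_add Ψ Ψ', Lp.coeFn_add Θ Θ'] with x h1 h2 h3 h4
  rw [h3, h4]
  exact Submodule.add_mem _ h1 h2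

theorem FreeRel.sub {Ψ Θ Ψ' Θ' : L2 d (Fock d)} (h : FreeRel disp Ψ Θ) (h' : FreeRel disp Ψ' Θ') :
    FreeRel disp (Ψ - Ψ') (Θ - Θ') := by
  filter_upwards [h, h', Lp.coeFn_sub Ψ Ψ', Lp.coeFn_sub Θ Θ'] with x h1 h2 h3 h4
  rw [h3, h4]
  exact Submodule.sub_mem _ h1 h2

theorem FreeRel.smul (c : ℂ) {Ψ Θ : L2 d (Fock d)} (h : FreeRel disp Ψ Θ) :
    FreeRel disp (c • Ψ) (c • Θ) := by
  filter_upwards [h, Lp.coeFn_smul c Ψ, Lp.coeFn_smul c Θ] with x h1 h3 h4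
  rw [h3, h4]
  exact Submodule.smul_mem _ c h1

theorem FreeRel.symm {Ψ Θ Ψ' Θ' : L2 d (Fock d)} (h : FreeRel disp Ψ Θ) (h' : FreeRel disp Ψ' Θ') :
    ⟪Θ, Ψ'⟫_ℂ = ⟪Ψ, Θ'⟫_ℂ := by
  rw [L2.inner_def, L2.inner_def]
  refine integral_congr_ae ?_
  filter_upwards [h, h'] with x h1 h2
  exact sectorMul_symm h1 h2

/-- Splitting the non-negative weight `∑ disp(k_i)` into two square roots gives `(ψ | H_f φ) =
⟪H_f^{1/2} ψ, H_f^{1/2} φ⟫`. -/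
theorem tsum_disp_eq_inner (hdisp : ∀ k, 0 ≤ disp k) {ψ θ φ ξ : Fock d}
    (h : (ψ, θ) ∈ (sectorMul fun n k => √(∑ i : Fin n, disp (k i))).graph)
    (h' : (φ, ξ) ∈ (sectorMul fun n k => √(∑ i : Fin n, disp (k i))).graph) :
    ∑' n : ℕ, ∫ k : Fin n → Sp d, ((∑ i : Fin n, disp (k i) : ℝ) : ℂ) *
      (conj ((ψ n : L2n d n) k) * (φ n : L2n d n) k) = ⟪θ, ξ⟫_ℂ := by
  rw [mem_sectorMul_graph] at h h'
  rw [lp.inner_eq_tsum]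
  refine tsum_congr fun n => ?_
  change _ = ⟪(θ n : L2n d n), (ξ n : L2n d n)⟫_ℂ
  rw [L2.inner_def]
  refine integral_congr_ae ?_
  filter_upwards [h n, h' n] with k h1 h2
  have hs : ((∑ i : Fin n, disp (k i) : ℝ) : ℂ) =
      (√(∑ i : Fin n, disp (k i)) : ℂ) * (√(∑ i : Fin n, disp (k i)) : ℂ) := by
    rw [← Complex.ofReal_mul, Real.mul_self_sqrt (Finset.sum_nonneg fun i _ => hdisp _)]
  rw [h1, h2, RCLike.inner_apply, map_mul, Complex.conj_ofReal, hs]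
  ring

theorem freeFieldForm_val (hdisp : ∀ k, 0 ≤ disp k) {Ψ Θ Φ Ξ : L2 d (Fock d)}
    (h : FreeRel disp Ψ Θ) (h' : FreeRel disp Φ Ξ) :
    (freeFieldForm disp).val Ψ Φ = ⟪Θ, Ξ⟫_ℂ := by
  rw [L2.inner_def]
  refine integral_congr_ae ?_
  filter_upwards [h, h'] with x h1 h2
  exact tsum_disp_eq_inner hdisp h1 h2

theorem freeFieldForm_isHermitian (hdisp : ∀ k, 0 ≤ disp k) :
    (freeFieldForm disp).IsHermitian where
  add_right := by
    rintro Ψ ⟨Θ, h⟩ Φ ⟨Ξ, h'⟩ Φ' ⟨Ξ', h''⟩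
    rw [freeFieldForm_val hdisp h h', freeFieldForm_val hdisp h h'',
      freeFieldForm_val hdisp h (FreeRel.add h' h''), inner_add_right]
  smul_right := by
    rintro Ψ ⟨Θ, h⟩ Φ ⟨Ξ, h'⟩ c
    rw [freeFieldForm_val hdisp h h', freeFieldForm_val hdisp h (FreeRel.smul c h'),
      inner_smul_right]
  conj_symm := by
    rintro Ψ ⟨Θ, h⟩ Φ ⟨Ξ, h'⟩
    rw [freeFieldForm_val hdisp h h', freeFieldForm_val hdisp h' h, inner_conj_symm]

theorem freeFieldForm_val_self (hdisp : ∀ k, 0 ≤ disp k) {Ψ Θ : L2 d (Fock d)}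
    (h : FreeRel disp Ψ Θ) : ((freeFieldForm disp).val Ψ Ψ).re = ‖Θ‖ ^ 2 := by
  rw [freeFieldForm_val hdisp h h]
  exact inner_self_eq_norm_sq (𝕜 := ℂ) Θ

theorem exists_freeRel_tensor (hdisp : ∀ k, 0 ≤ disp k) (hloc : LocallyIntegrable disp volume)
    (f : L2 d ℂ) {ψ : Fock d} (hψ : ψ ∈ fockFin d) : ∃ Θ, FreeRel disp (tensor f ψ) Θ := by
  obtain ⟨φ, hφ⟩ := exists_mem_sectorMul_graph (m := fun n k => √(∑ i : Fin n, disp (k i)))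
    (w := fun _ => disp)
    (fun n => by
      refine Real.continuous_sqrt.comp_aestronglyMeasurable ?_
      refine Finset.aestronglyMeasurable_fun_sum _ fun i _ => ?_
      exact hloc.aestronglyMeasurable.comp_quasiMeasurePreserving
        (Measure.quasiMeasurePreserving_eval _ i))
    (fun n σ k => congrArg Real.sqrt (Equiv.sum_comp σ fun i => disp (k i)))
    (fun _ => hloc)
    (fun n k => (Real.sq_sqrt (Finset.sum_nonneg fun i _ => hdisp _)).le) hψ
  refine ⟨tensor f φ, ?_⟩
  filter_upwards [coeFn_tensor f ψ, coeFn_tensor f φ] with x h1 h2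
  rw [h1, h2]
  exact Submodule.smul_mem _ (f x) hφ

theorem nelsonCore_le_freeFieldForm_dom (hdisp : ∀ k, 0 ≤ disp k)
    (hloc : LocallyIntegrable disp volume) : nelsonCore d ≤ (freeFieldForm disp).dom := by
  refine Submodule.span_le.2 ?_
  rintro _ ⟨f, _, ψ, hψ, rfl⟩
  exact exists_freeRel_tensor hdisp hloc f hψ

theorem dense_nelsonCore : Dense (nelsonCore d : Set (L2 d (Fock d))) :=
  dense_algTensor dense_testFunctions dense_fockFin

/-- `I ⊗ H_f^{1/2}` is symmetric and defined on the dense core, so its adjoint is densely defined.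
-/
theorem nnClosable_freeFieldForm (hdisp : ∀ k, 0 ≤ disp k)
    (hloc : LocallyIntegrable disp volume) :
    NNClosable (nelsonCore d) fun Ψ => ((freeFieldForm disp).val Ψ Ψ).re := by
  refine NNClosable.of_rel (R := FreeRel disp)
    (fun Ψ hΨ => nelsonCore_le_freeFieldForm_dom hdisp hloc hΨ) FreeRel.sub
    (fun h => freeFieldForm_val_self hdisp h) dense_nelsonCore ?_
  intro Ξ hΞ
  obtain ⟨Ξ', h⟩ := nelsonCore_le_freeFieldForm_dom hdisp hloc hΞ
  exact ⟨Ξ', fun Ψ Θ h' => h'.symm h⟩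

theorem sectorMul_fockU {m : ∀ n, (Fin n → Sp d) → ℝ} {ψ φ : Fock d} (k : Sp d)
    (h : (ψ, φ) ∈ (sectorMul m).graph) : (fockU k ψ, fockU k φ) ∈ (sectorMul m).graph := by
  rw [mem_sectorMul_graph] at h ⊢
  intro n
  filter_upwards [h n, coeFn_symU k (ψ n), coeFn_symU k (φ n)] with q h1 h2 h3
  rw [fockU_apply, fockU_apply, h2, h3, h1]
  ring

theorem FreeRel.totalU {Ψ Θ : L2 d (Fock d)} (h : FreeRel disp Ψ Θ) (k : Sp d) :
    FreeRel disp (totalU fockU k Ψ) (totalU fockU k Θ) := by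
  filter_upwards [coeFn_totalU fockU k Ψ, coeFn_totalU fockU k Θ, ae_shift k h] with x h1 h2 h3
  rw [h1, h2]
  exact sectorMul_fockU k h3

theorem freeFieldForm_totalU (hdisp : ∀ k, 0 ≤ disp k) (k : Sp d) {Ψ Φ : L2 d (Fock d)}
    (hΨ : Ψ ∈ (freeFieldForm disp).dom) (hΦ : Φ ∈ (freeFieldForm disp).dom) :
    (freeFieldForm disp).val (totalU fockU k Ψ) (totalU fockU k Φ) =
      (freeFieldForm disp).val Ψ Φ := by
  obtain ⟨Θ, h⟩ := hΨ
  obtain ⟨Ξ, h'⟩ := hΦ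
  rw [freeFieldForm_val hdisp h h', freeFieldForm_val hdisp (FreeRel.totalU h k)
    (FreeRel.totalU h' k), LinearIsometryEquiv.inner_map_map]

theorem freeFieldForm_smul (hdisp : ∀ k, 0 ≤ disp k) {Ψ Φ Θ : L2 d (Fock d)}
    (h : FreeRel disp Φ Θ) {c : Sp d → ℂ} (hΨ : Ψ =ᵐ[volume] fun x => c x • Φ x) :
    (freeFieldForm disp).val Ψ Ψ = ((∫ x, ‖c x‖ ^ 2 * ‖Θ x‖ ^ 2 : ℝ) : ℂ) := by
  rw [← integral_complex_ofReal]
  refine integral_congr_ae ?_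
  filter_upwards [h, hΨ] with x h1 h2
  have h3 := tsum_disp_eq_inner hdisp (Submodule.smul_mem _ (c x) h1)
    (Submodule.smul_mem _ (c x) h1)
  rw [h2]
  refine h3.trans ?_
  rw [inner_self_eq_norm_sq_to_K, norm_smul]
  push_cast
  rw [mul_pow]
  rfl

end FreeField

/-! ### Closability and lower bounds -/

section Particle

variable {d : ℕ} {B : ℝ → ℝ} {V : Sp d → ℝ}

theorem particleForm_isHermitian (hB : IsBernstein B) (hV : LocallyIntegrable V volume) :
    (particleForm B V).IsHermitian :=
  (momentumForm_isHermitian hB.continuous_norm_sq).sum (mulForm_isHermitian hV.aestronglyMeasurable)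

theorem testFunctions_le_particleForm_dom (hB : IsBernstein B) (hV : LocallyIntegrable V volume) :
    testFunctions d ≤ (particleForm B V).dom :=
  le_inf (testFunctions_le_momentumForm_dom hB) (testFunctions_le_mulForm_dom hV)

theorem algTensor_le_momentumForm_dom (hB : IsBernstein B) {K : Type*} [NormedAddCommGroup K]
    [InnerProductSpace ℂ K] [CompleteSpace K] (F : Submodule ℂ K) :
    algTensor (testFunctions d) F ≤
      (momentumForm (fun k => B (‖k‖ ^ 2)) : SForm (L2 d K)).dom := by
  refine Submodule.span_le.2 ?_
  rintro _ ⟨f, hf, ψ, _, rfl⟩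
  exact tensor_mem_momentumForm_dom (testFunctions_le_momentumForm_dom hB hf) ψ

theorem algTensor_le_mulForm_dom (hV : LocallyIntegrable V volume) {K : Type*}
    [NormedAddCommGroup K] [InnerProductSpace ℂ K] (F : Submodule ℂ K) :
    algTensor (testFunctions d) F ≤ (mulForm V : SForm (L2 d K)).dom := by
  refine Submodule.span_le.2 ?_
  rintro _ ⟨f, hf, ψ, _, rfl⟩
  exact tensor_mem_mulForm_dom (testFunctions_le_mulForm_dom hV hf) ψ

/-- The form is `‖√B(p²) f‖²`. In Fourier space the square root is a real multiplication, whose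
adjoint is defined on the transforms of test functions. -/
theorem nnClosable_momentumForm (hB : IsBernstein B) : NNClosable (testFunctions d)
    fun f => ((momentumForm (fun k => B (‖k‖ ^ 2)) : SForm (L2 d ℂ)).val f f).re := by
  have hB0 : ∀ ξ : Sp d, 0 ≤ B (‖(2 * Real.pi) • ξ‖ ^ 2) := fun ξ => hB.nonneg _ (sq_nonneg _)
  have hdom : ∀ f ∈ testFunctions d, ∃ Θ : L2 d ℂ, Θ =ᵐ[volume] fun ξ =>
      ((√|B (‖(2 * Real.pi) • ξ‖ ^ 2)| : ℝ) : ℂ) • FT f ξ := by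
    intro f hf
    have h := mem_mulForm_dom.1 (mem_momentumForm_dom.1 (testFunctions_le_momentumForm_dom hB hf))
    exact ⟨h.toLp _, h.coeFn_toLp⟩
  refine NNClosable.of_rel (R := fun (f Θ : L2 d ℂ) => Θ =ᵐ[volume] fun ξ =>
    ((√|B (‖(2 * Real.pi) • ξ‖ ^ 2)| : ℝ) : ℂ) • FT f ξ) hdom ?_ ?_
    (S := FT '' (testFunctions d : Set (L2 d ℂ)))
    (FT.surjective.denseRange.dense_image FT.continuous dense_testFunctions) ?_
  · intro f Θ f' Θ' h h'
    rw [map_sub]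
    filter_upwards [h, h', Lp.coeFn_sub Θ Θ', Lp.coeFn_sub (FT f) (FT f')] with ξ h1 h2 h3 h4
    rw [h3, h4, Pi.sub_apply, Pi.sub_apply, h1, h2, smul_sub]
  · intro f Θ h
    rw [momentumForm_val, mulForm_val_self, Complex.ofReal_re, norm_sq_eq_integral]
    refine integral_congr_ae ?_
    filter_upwards [h] with ξ h1
    rw [h1, norm_smul ((√|B (‖(2 * Real.pi) • ξ‖ ^ 2)| : ℝ) : ℂ), Complex.norm_real,
      Real.norm_of_nonneg (Real.sqrt_nonneg _), mul_pow, Real.sq_sqrt (abs_nonneg _), abs_of_nonneg (hB0 ξ)]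
  · rintro _ ⟨u, hu, rfl⟩
    obtain ⟨Ξ, hΞ⟩ := hdom u hu
    refine ⟨FT.symm Ξ, fun f Θ h => ?_⟩
    rw [← FT.inner_map_map f, LinearIsometryEquiv.apply_symm_apply, L2.inner_def, L2.inner_def]
    refine integral_congr_ae ?_
    filter_upwards [h, hΞ] with ξ h1 h2
    rw [h1, h2, inner_smul_left, inner_smul_right, Complex.conj_ofReal]

theorem mulForm_zero_val {K : Type*} [NormedAddCommGroup K] [InnerProductSpace ℂ K]
    (Ψ Φ : L2 d K) : (mulForm (0 : Sp d → ℝ) : SForm (L2 d K)).val Ψ Φ = 0 := by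
  simp [mulForm_val]

theorem particleForm_zero_closableOn (hB : IsBernstein B) :
    (particleForm B (0 : Sp d → ℝ)).ClosableOn (testFunctions d) := by
  refine (SForm.closableOn_iff (c := 0) (r := fun f =>
    ((momentumForm (fun k => B (‖k‖ ^ 2)) : SForm (L2 d ℂ)).val f f).re) ?_).2
    (nnClosable_momentumForm hB).closable
  intro f hf
  change _ + (mulForm (0 : Sp d → ℝ) : SForm (L2 d ℂ)).val f f = _
  rw [mulForm_zero_val, add_zero, zero_mul, add_zero]
  exact (momentumForm_isHermitian hB.continuous_norm_sq).val_self
    (testFunctions_le_momentumForm_dom hB hf)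

theorem particleForm_zero_boundedBelowOn (hB : IsBernstein B) :
    (particleForm B (0 : Sp d → ℝ)).BoundedBelowOn (testFunctions d) := by
  refine ⟨0, fun f hf => ?_⟩
  rw [zero_mul]
  change 0 ≤ (_ + (mulForm (0 : Sp d → ℝ) : SForm (L2 d ℂ)).val f f).re
  rw [mulForm_zero_val, add_zero]
  exact (nnClosable_momentumForm hB).nonneg f hf

/-- The form of `(B(p²) + V) ⊗ I + c`. -/
def liftedForm (B : ℝ → ℝ) (V : Sp d → ℝ) (c : ℝ) (K : Type*) [NormedAddCommGroup K]
    [InnerProductSpace ℂ K] [CompleteSpace K] : SForm (L2 d K) :=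
  ((momentumForm fun k => B (‖k‖ ^ 2)).sum (mulForm V)).sum (innerForm _ c)

theorem liftedForm_isHermitian (hB : IsBernstein B) (hV : LocallyIntegrable V volume) (c : ℝ)
    {K : Type*} [NormedAddCommGroup K] [InnerProductSpace ℂ K] [CompleteSpace K] :
    (liftedForm B V c K).IsHermitian :=
  ((momentumForm_isHermitian hB.continuous_norm_sq).sum
    (mulForm_isHermitian hV.aestronglyMeasurable)).sum (innerForm_isHermitian c)

theorem algTensor_le_liftedForm_dom (hB : IsBernstein B) (hV : LocallyIntegrable V volume) (c : ℝ)
    {K : Type*} [NormedAddCommGroup K] [InnerProductSpace ℂ K] [CompleteSpace K]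
    (F : Submodule ℂ K) : algTensor (testFunctions d) F ≤ (liftedForm B V c K).dom :=
  le_inf (le_inf (algTensor_le_momentumForm_dom hB F) (algTensor_le_mulForm_dom hV F)) le_top

theorem liftedForm_tensor (B : ℝ → ℝ) (V : Sp d → ℝ) (c : ℝ)
    {K : Type*} [NormedAddCommGroup K] [InnerProductSpace ℂ K] [CompleteSpace K] (f g : L2 d ℂ)
    (ψ φ : K) : (liftedForm B V c K).val (tensor f ψ) (tensor g φ) =
      (liftedForm B V c ℂ).val f g * ⟪ψ, φ⟫_ℂ := by
  have h1 := momentumForm_tensor (fun k : Sp d => B (‖k‖ ^ 2)) f g ψ φ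
  have h2 := mulForm_tensor V f g ψ φ
  have h3 := inner_tensor f g ψ φ
  simp only [liftedForm, SForm.sum, innerForm, h1, h2, h3]
  ring

/-- Subtracting the lower bound `c` makes `B(p²) + V` non-negative without affecting closability. -/
theorem nnClosable_liftedForm_scalar (hB : IsBernstein B) (hV : LocallyIntegrable V volume)
    {c : ℝ} (hcl : (particleForm B V).ClosableOn (testFunctions d))
    (hc : ∀ f ∈ testFunctions d, c * ‖f‖ ^ 2 ≤ ((particleForm B V).val f f).re) :
    NNClosable (testFunctions d) fun f => ((liftedForm B V (-c) ℂ).val f f).re := by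
  have hval : ∀ f ∈ testFunctions d, (particleForm B V).val f f =
      ((((liftedForm B V (-c) ℂ).val f f).re + c * ‖f‖ ^ 2 : ℝ) : ℂ) := by
    intro f hf
    have h1 := (particleForm_isHermitian hB hV).val_self (testFunctions_le_particleForm_dom hB hV hf)
    have h2 : (liftedForm B V (-c) ℂ).val f f =
        (particleForm B V).val f f + (innerForm _ (-c)).val f f := rfl
    rw [h2, innerForm_val_self, Complex.add_re, Complex.ofReal_re, h1, Complex.ofReal_re]
    congr 1
    ring
  have hnn : ∀ f ∈ testFunctions d, 0 ≤ ((liftedForm B V (-c) ℂ).val f f).re := by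
    intro f hf
    have h1 := hc f hf
    rw [hval f hf, Complex.ofReal_re] at h1
    linarith
  refine ⟨hnn, ?_, (SForm.closableOn_iff hval).1 hcl⟩
  intro u hu v hv
  refine (liftedForm_isHermitian hB hV (-c)).re_le_sub (D := testFunctions d) ?_ hnn hu hv
  exact le_inf (testFunctions_le_particleForm_dom hB hV) le_top

/-- Expansion in a Hilbert basis of `K`, possibly uncountable, writes the form as a sum of scalar
forms evaluated at the partial inner products, which are test functions. This is why closability is
inherited from the particle form for a `V` of either sign. -/
theorem nnClosable_liftedForm (hB : IsBernstein B) (hV : LocallyIntegrable V volume)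
    {c : ℝ} (hcl : (particleForm B V).ClosableOn (testFunctions d))
    (hc : ∀ f ∈ testFunctions d, c * ‖f‖ ^ 2 ≤ ((particleForm B V).val f f).re)
    {K : Type*} [NormedAddCommGroup K] [InnerProductSpace ℂ K] [CompleteSpace K]
    (F : Submodule ℂ K) :
    NNClosable (algTensor (testFunctions d) F) fun Ψ => ((liftedForm B V (-c) K).val Ψ Ψ).re := by
  obtain ⟨w, b, -⟩ := exists_hilbertBasis ℂ K
  refine NNClosable.of_hasSum (qe := fun i Ψ =>
    ((liftedForm B V (-c) ℂ).val (bra (b i) Ψ) (bra (b i) Ψ)).re) ?_ ?_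
  · intro i
    exact (nnClosable_liftedForm_scalar hB hV hcl hc).comp (bra (b i)) fun Ψ hΨ => bra_mem (b i) hΨ
  · intro Ψ hΨ
    have h := hasSum_val_bra b (liftedForm_isHermitian hB hV (-c) (K := K))
      (liftedForm_isHermitian hB hV (-c) (K := ℂ))
      (le_inf (testFunctions_le_particleForm_dom hB hV) le_top)
      (algTensor_le_liftedForm_dom hB hV (-c) F)
      (fun f _ g _ ψ φ => liftedForm_tensor B V (-c) f g ψ φ) hΨ hΨ
    exact Complex.hasSum_re h

end Particle

/-! ### The Hamiltonian -/

section Nelson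

variable {d : ℕ} {B : ℝ → ℝ} {V : Sp d → ℝ} {disp : Sp d → ℝ}

theorem nelsonForm_isHermitian (hB : IsBernstein B) (hdisp : ∀ k, 0 ≤ disp k) (P : Polynomial ℝ)
    (g : L2 d ℂ) : (nelsonForm B disp P g).IsHermitian :=
  ((momentumForm_isHermitian hB.continuous_norm_sq).sum (freeFieldForm_isHermitian hdisp)).sum
    (interactionForm_isHermitian P g)

theorem bddNumber_of_mem {Ψ : L2 d (Fock d)} (hΨ : Ψ ∈ nelsonCore d) : BddNumber Ψ := by
  have h : nelsonCore d ≤ (interactionForm (0 : Polynomial ℝ) (0 : L2 d ℂ)).dom := by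
    refine Submodule.span_le.2 ?_
    rintro _ ⟨f, _, ψ, hψ, rfl⟩
    obtain ⟨N, hN⟩ := finSupp_of_mem (mem_fockFin.1 hψ)
    refine ⟨N, ?_⟩
    filter_upwards [coeFn_tensor f ψ] with x hx n hn
    rw [hx]
    change f x • toSeq ψ n = 0
    rw [hN n hn, smul_zero]
  exact h hΨ

theorem nelsonCore_le_nelsonForm_dom (hB : IsBernstein B) (hdisp : ∀ k, 0 ≤ disp k)
    (hloc : LocallyIntegrable disp volume) (P : Polynomial ℝ) (g : L2 d ℂ) :
    nelsonCore d ≤ (nelsonForm B disp P g).dom :=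
  le_inf (le_inf (algTensor_le_momentumForm_dom hB _) (nelsonCore_le_freeFieldForm_dom hdisp hloc))
    fun _ hΨ => bddNumber_of_mem hΨ

theorem nelsonForm_sum_val (B : ℝ → ℝ) (V disp : Sp d → ℝ) (P : Polynomial ℝ) (g : L2 d ℂ)
    (Ψ Φ : L2 d (Fock d)) : ((nelsonForm B disp P g).sum (mulForm V)).val Ψ Φ =
      (momentumForm fun k => B (‖k‖ ^ 2)).val Ψ Φ + (freeFieldForm disp).val Ψ Φ +
      (interactionForm P g).val Ψ Φ + (mulForm V).val Ψ Φ := rfl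

/-- Each particle number contributes a bounded form, trivially closable; closability survives the
infinite sum even though no uniform bound does. -/
theorem nnClosable_compForm (p : Polynomial ℝ) (g : L2 d ℂ) :
    NNClosable (nelsonCore d) fun Ψ => ∑' n, compForm p g n Ψ := by
  refine NNClosable.of_hasSum (qe := fun n => compForm p g n) (fun n => ?_)
    fun Ψ hΨ => (interactionForm_sq p g (bddNumber_of_mem hΨ)).1.hasSum
  obtain ⟨C, hC⟩ := exists_compForm_le p g n
  exact NNClosable.of_le (fun Ψ _ => compForm_nonneg p g n Ψ)
    (fun u _ v _ => compForm_le_sub p g n u v) fun Ψ _ => hC Ψ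

/-- If `B(p²) + V` is closable and bounded from below, the Hamiltonian is the sum of a
non-negative closable form and a constant. -/
theorem exists_nnClosable_nelsonForm (hB : IsBernstein B) (hdisp : ∀ k, 0 ≤ disp k)
    (hloc : LocallyIntegrable disp volume) (g : L2 d ℂ) {P : Polynomial ℝ}
    (hP : ∃ c : ℝ, ∀ t : ℝ, c ≤ P.eval t) (hV : LocallyIntegrable V volume)
    (hcl : (particleForm B V).ClosableOn (testFunctions d))
    (hbd : (particleForm B V).BoundedBelowOn (testFunctions d)) :
    ∃ (r : L2 d (Fock d) → ℝ) (c : ℝ), NNClosable (nelsonCore d) r ∧ ∀ Ψ ∈ nelsonCore d,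
      ((nelsonForm B disp P g).sum (mulForm V)).val Ψ Ψ = ((r Ψ + c * ‖Ψ‖ ^ 2 : ℝ) : ℂ) := by
  obtain ⟨c, hc⟩ := hbd
  obtain ⟨c', hc'⟩ := hP
  -- `P(φ(x))` becomes a constant plus `p(φ(x))² + q(φ(x))²`, so no spectral calculus for the field
  -- is needed to bound it from below.
  obtain ⟨p, q, rfl⟩ := exists_eq_C_add_sq_add_sq P c' hc'
  refine ⟨_, c + c', (((nnClosable_liftedForm hB hV hcl hc (fockFin d)).add
    (nnClosable_freeFieldForm hdisp hloc)).add (nnClosable_compForm p g)).add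
    (nnClosable_compForm q g), fun Ψ hΨ => ?_⟩
  have hb := bddNumber_of_mem hΨ
  have h1 : (momentumForm fun k => B (‖k‖ ^ 2)).val Ψ Ψ + (mulForm V).val Ψ Ψ =
      (liftedForm B V (-c) (Fock d)).val Ψ Ψ + ((c * ‖Ψ‖ ^ 2 : ℝ) : ℂ) := by
    have h2 : (liftedForm B V (-c) (Fock d)).val Ψ Ψ = (momentumForm fun k => B (‖k‖ ^ 2)).val Ψ Ψ +
      (mulForm V).val Ψ Ψ + (innerForm _ (-c)).val Ψ Ψ := rfl
    rw [h2, innerForm_val_self]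
    push_cast
    ring
  have h3 := (liftedForm_isHermitian hB hV (-c)).val_self
    (algTensor_le_liftedForm_dom hB hV (-c) (fockFin d) hΨ)
  have h4 := (freeFieldForm_isHermitian hdisp).val_self
    (nelsonCore_le_freeFieldForm_dom hdisp hloc hΨ)
  have h5 : ⟪Ψ, Ψ⟫_ℂ = ((‖Ψ‖ ^ 2 : ℝ) : ℂ) := by
    rw [inner_self_eq_norm_sq_to_K]
    push_cast
    rfl
  rw [nelsonForm_sum_val, interactionForm_add _ _ g hb, interactionForm_add _ _ g hb,
    interactionForm_C _ g hb, (interactionForm_sq p g hb).2, (interactionForm_sq q g hb).2, h4, h5]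
  rw [h3] at h1
  push_cast at h1 ⊢
  linear_combination h1

theorem closableOn_and_boundedBelowOn (hB : IsBernstein B) (hdisp : ∀ k, 0 ≤ disp k)
    (hloc : LocallyIntegrable disp volume) (g : L2 d ℂ) {P : Polynomial ℝ}
    (hP : ∃ c : ℝ, ∀ t : ℝ, c ≤ P.eval t) (hV : LocallyIntegrable V volume)
    (hcl : (particleForm B V).ClosableOn (testFunctions d))
    (hbd : (particleForm B V).BoundedBelowOn (testFunctions d)) :
    ((nelsonForm B disp P g).sum (mulForm V)).ClosableOn (nelsonCore d) ∧
      ((nelsonForm B disp P g).sum (mulForm V)).BoundedBelowOn (nelsonCore d) := by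
  obtain ⟨r, c, hr, h⟩ := exists_nnClosable_nelsonForm hB hdisp hloc g hP hV hcl hbd
  refine ⟨(SForm.closableOn_iff h).2 hr.closable, c, fun Ψ hΨ => ?_⟩
  rw [h Ψ hΨ, Complex.ofReal_re]
  linarith [hr.nonneg Ψ hΨ]

theorem locallyIntegrable_zero' : LocallyIntegrable (0 : Sp d → ℝ) volume :=
  (integrable_zero (Sp d) ℝ volume).locallyIntegrable

theorem nelsonForm_sum_zero (B : ℝ → ℝ) (disp : Sp d → ℝ) (P : Polynomial ℝ) (g : L2 d ℂ)
    (Ψ Φ : L2 d (Fock d)) : ((nelsonForm B disp P g).sum (mulForm 0)).val Ψ Φ =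
      (nelsonForm B disp P g).val Ψ Φ := by
  change _ + (mulForm (0 : Sp d → ℝ) : SForm (L2 d (Fock d))).val Ψ Φ = _
  rw [mulForm_zero_val, add_zero]

theorem nelsonForm_closableOn_and_boundedBelowOn (hB : IsBernstein B) (hdisp : ∀ k, 0 ≤ disp k)
    (hloc : LocallyIntegrable disp volume) (g : L2 d ℂ) {P : Polynomial ℝ}
    (hP : ∃ c : ℝ, ∀ t : ℝ, c ≤ P.eval t) :
    (nelsonForm B disp P g).ClosableOn (nelsonCore d) ∧
      (nelsonForm B disp P g).BoundedBelowOn (nelsonCore d) := by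
  have h := closableOn_and_boundedBelowOn hB hdisp hloc g hP locallyIntegrable_zero'
    (particleForm_zero_closableOn hB) (particleForm_zero_boundedBelowOn hB)
  simp only [SForm.ClosableOn, SForm.BoundedBelowOn, nelsonForm_sum_zero] at h ⊢
  exact h

theorem hypH1_of_particleForm (hB : IsBernstein B) (hdisp : ∀ k, 0 ≤ disp k)
    (hloc : LocallyIntegrable disp volume) (g : L2 d ℂ) {P : Polynomial ℝ}
    (hP : ∃ c : ℝ, ∀ t : ℝ, c ≤ P.eval t) (hV : LocallyIntegrable V volume)
    (hcl : (particleForm B V).ClosableOn (testFunctions d))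
    (hbd : (particleForm B V).BoundedBelowOn (testFunctions d)) :
    HypH1 (nelsonForm B disp P g) V (nelsonCore d) where
  hermitian := nelsonForm_isHermitian hB hdisp P g
  dense := dense_nelsonCore
  le_dom := nelsonCore_le_nelsonForm_dom hB hdisp hloc P g
  le_domV := algTensor_le_mulForm_dom hV _
  closable := (nelsonForm_closableOn_and_boundedBelowOn hB hdisp hloc g hP).1
  bddBelow := (nelsonForm_closableOn_and_boundedBelowOn hB hdisp hloc g hP).2
  closableV := (closableOn_and_boundedBelowOn hB hdisp hloc g hP hV hcl hbd).1
  bddBelowV := (closableOn_and_boundedBelowOn hB hdisp hloc g hP hV hcl hbd).2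

/-! ### Product vectors with the vacuum -/

/-- The vacuum as a vector in Fock space. -/
def fockVacuum (d : ℕ) : Fock d := lp.single 2 0 (vacuumZero d)

theorem toSeq_fockVacuum : toSeq (fockVacuum d) = vacuum d :=
  lp.coeFn_single (E := fun n => symL2 d n) 2 0 (vacuumZero d)

theorem fockVacuum_mem : fockVacuum d ∈ fockFin d := by
  rw [mem_fockFin, toSeq_fockVacuum]
  exact vacuum_mem_monoSpan

theorem norm_fockVacuum : ‖fockVacuum d‖ = 1 := by
  rw [fockVacuum, lp.norm_single (by norm_num)]
  change ‖(vacuumZero d : L2n d 0)‖ = 1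
  have h : ‖(vacuumZero d : L2n d 0)‖ ^ 2 = 1 := by
    have hv : ((vacuumZero d : L2n d 0) : (Fin 0 → Sp d) → ℂ) =ᵐ[volume] fun _ => (1 : ℂ) :=
      MemLp.coeFn_toLp (haveI := volume_fin_zero d; memLp_const (1 : ℂ) :
        MemLp (fun _ : Fin 0 → Sp d => (1 : ℂ)) 2 volume)
    have h1 : ∫ k, ‖(vacuumZero d : L2n d 0) k‖ ^ 2 = ∫ _ : Fin 0 → Sp d, (1 : ℝ) := by
      refine integral_congr_ae ?_
      filter_upwards [hv] with k hk
      rw [hk]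
      simp
    rw [norm_sq_eq_integral, h1, volume_pi, Measure.pi_of_empty _ Fin.elim0, integral_dirac]
  exact (pow_eq_one_iff_of_nonneg (norm_nonneg _) two_ne_zero).1 h

/-- `H_f` annihilates the vacuum: the sum over zero particles is empty. -/
theorem freeRel_vacuum (disp : Sp d → ℝ) (f : L2 d ℂ) :
    FreeRel disp (tensor f (fockVacuum d)) 0 := by
  filter_upwards [coeFn_tensor f (fockVacuum d),
    Lp.coeFn_zero (Fock d) 2 (volume : Measure (Sp d))] with x h1 h2
  rw [h1, h2]
  have h3 : (fockVacuum d, (0 : Fock d)) ∈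
      (sectorMul fun n k => √(∑ i : Fin n, disp (k i))).graph := by
    rw [mem_sectorMul_graph]
    intro n
    change ((0 : L2n d n) : (Fin n → Sp d) → ℂ) =ᵐ[volume] _
    cases n with
    | zero =>
      filter_upwards [Lp.coeFn_zero ℂ 2 (volume : Measure (Fin 0 → Sp d))] with k hk
      rw [hk]
      simp
    | succ n =>
      have h0 : fockVacuum d (n + 1) = 0 := lp.single_apply_ne _ _ _ (by omega)
      rw [h0]
      filter_upwards [Lp.coeFn_zero ℂ 2 (volume : Measure (Fin (n + 1) → Sp d))] with k hk
      have h4 : ((0 : symL2 d (n + 1)) : L2n d (n + 1)) k = 0 := hk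
      rw [hk, h4]
      simp
  simpa using Submodule.smul_mem _ (f x) h3

/-- The vacuum is invariant under `e^{ix·P_f}`, which carries `φ(x)` to `φ(0)`. -/
theorem pair_vacuum_polyOp (P : Polynomial ℝ) (g : L2 d ℂ) (x : Sp d) :
    pair (vacuum d) (polyOp P g x (vacuum d)) = pair (vacuum d) (polyOp P g 0 (vacuum d)) := by
  have h := seqU_polyOp P x g 0 (vacuum d)
  rw [zero_add, seqU_vacuum] at h
  rw [← h]
  conv_rhs => rw [← seqU_vacuum x, pair_seqU, seqU_vacuum]

theorem interactionForm_vacuum (P : Polynomial ℝ) (g f : L2 d ℂ) :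
    (interactionForm P g).val (tensor f (fockVacuum d)) (tensor f (fockVacuum d)) =
      pair (vacuum d) (polyOp P g 0 (vacuum d)) * ((‖f‖ ^ 2 : ℝ) : ℂ) := by
  rw [interactionForm_val, norm_sq_eq_integral, ← integral_complex_ofReal, ← integral_const_mul]
  refine integral_congr_ae ?_
  filter_upwards [coeFn_tensor f (fockVacuum d)] with x hx
  have h1 : toSeq (tensor f (fockVacuum d) x) = f x • vacuum d := by
    rw [hx, _root_.map_smul, toSeq_fockVacuum]
  rw [h1, _root_.map_smul, pair_smul_right _ (FinSupp.vacuum.smul _),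
    pair_smul_left _ ((isFieldLike_polyOp P g).finSupp x FinSupp.vacuum), pair_vacuum_polyOp,
    ← mul_assoc, Complex.mul_conj, Complex.normSq_eq_norm_sq, mul_comm]

/-- On `f ⊗ Ω` the free field contributes nothing and the interaction only its vacuum expectation, a
number independent of `x`. -/
theorem nelsonForm_vacuum (hdisp : ∀ k, 0 ≤ disp k) (P : Polynomial ℝ) (g f : L2 d ℂ) :
    ((nelsonForm B disp P g).sum (mulForm V)).val (tensor f (fockVacuum d))
      (tensor f (fockVacuum d)) = (particleForm B V).val f f +
        pair (vacuum d) (polyOp P g 0 (vacuum d)) * ((‖f‖ ^ 2 : ℝ) : ℂ) := by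
  have h1 : ⟪fockVacuum d, fockVacuum d⟫_ℂ = 1 := by
    rw [inner_self_eq_norm_sq_to_K, norm_fockVacuum]
    simp
  rw [nelsonForm_sum_val, interactionForm_vacuum, momentumForm_tensor, mulForm_tensor, h1,
    freeFieldForm_val hdisp (freeRel_vacuum disp f) (freeRel_vacuum disp f), inner_zero_left]
  change _ = (momentumForm _).val f f + (mulForm V).val f f + _
  ring

theorem norm_tensor_fockVacuum (f : L2 d ℂ) : ‖tensor f (fockVacuum d)‖ = ‖f‖ := by
  have h := inner_tensor f f (fockVacuum d) (fockVacuum d)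
  rw [inner_self_eq_norm_sq_to_K, inner_self_eq_norm_sq_to_K, inner_self_eq_norm_sq_to_K,
    norm_fockVacuum] at h
  have h' : (((‖tensor f (fockVacuum d)‖ : ℝ) : ℂ)) ^ 2 = ((‖f‖ : ℝ) : ℂ) ^ 2 := by
    simpa using h
  exact (sq_eq_sq₀ (norm_nonneg _) (norm_nonneg _)).1 (by exact_mod_cast h')

/-- Since `f ↦ f ⊗ Ω` is isometric into the core and transports the form up to a multiple of `‖f‖²`,
closability and a lower bound descend from `H^V` to `h`. -/
theorem particleForm_of_hypH1 (hdisp : ∀ k, 0 ≤ disp k) {P : Polynomial ℝ} {g : L2 d ℂ}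
    (h : HypH1 (nelsonForm B disp P g) V (nelsonCore d)) :
    (particleForm B V).ClosableOn (testFunctions d) ∧
      (particleForm B V).BoundedBelowOn (testFunctions d) := by
  set κ := pair (vacuum d) (polyOp P g 0 (vacuum d)) with hκ
  have hval : ∀ f : L2 d ℂ, ((nelsonForm B disp P g).sum (mulForm V)).val
      (tensor f (fockVacuum d)) (tensor f (fockVacuum d)) =
      (particleForm B V).val f f + κ * ((‖f‖ ^ 2 : ℝ) : ℂ) := nelsonForm_vacuum hdisp P g
  refine ⟨?_, ?_⟩
  · intro f hf h0 hc
    have hn : ∀ {ι : Type} {l : Filter ι} {u : ι → L2 d ℂ}, Tendsto u l (𝓝 0) →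
        Tendsto (fun i => κ * ((‖u i‖ ^ 2 : ℝ) : ℂ)) l (𝓝 0) := by
      intro ι l u hu
      have h1 := ((Complex.continuous_ofReal.tendsto _).comp (hu.norm.pow 2)).const_mul κ
      simpa using h1
    have h1 := h.closableV (fun n => tensor (f n) (fockVacuum d))
      (fun n => tensor_mem_algTensor (hf n) fockVacuum_mem) ?_ ?_
    · simp only [hval] at h1
      simpa using h1.sub (hn h0)
    · have h2 := ((tensorB (fockVacuum d)).continuous.tendsto 0).comp h0
      rw [_root_.map_zero] at h2
      exact h2
    · have e : ∀ m : ℕ × ℕ, tensor (f m.1) (fockVacuum d) - tensor (f m.2) (fockVacuum d) =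
          tensor (f m.1 - f m.2) (fockVacuum d) := by
        intro m
        rw [← tensorB_apply, ← tensorB_apply, ← tensorB_apply, map_sub]
      simp only [e, hval]
      simpa using hc.add (hn (tendsto_sub_pair h0))
  · obtain ⟨c, hc⟩ := h.bddBelowV
    refine ⟨c - κ.re, fun f hf => ?_⟩
    have h1 := hc _ (tensor_mem_algTensor hf fockVacuum_mem)
    rw [hval, norm_tensor_fockVacuum, Complex.add_re, Complex.re_mul_ofReal] at h1
    linarith

end Nelson

section Symmetries

variable {d : ℕ} {B : ℝ → ℝ} {V : Sp d → ℝ} {disp : Sp d → ℝ}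

/-! ### Translation invariance -/

theorem totalU_mem_nelsonCore (k : Sp d) {Ψ : L2 d (Fock d)} (hΨ : Ψ ∈ nelsonCore d) :
    totalU fockU k Ψ ∈ nelsonCore d :=
  totalU_mem_algTensor (fun k _ hψ => fockU_mem_fockFin k hψ) k hΨ

theorem nelsonForm_totalU (hdisp : ∀ k, 0 ≤ disp k) (hloc : LocallyIntegrable disp volume)
    (P : Polynomial ℝ) (g : L2 d ℂ) (k : Sp d) {Ψ Φ : L2 d (Fock d)} (hΨ : Ψ ∈ nelsonCore d)
    (hΦ : Φ ∈ nelsonCore d) : (nelsonForm B disp P g).val (totalU fockU k Ψ) (totalU fockU k Φ) =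
      (nelsonForm B disp P g).val Ψ Φ := by
  change (momentumForm _).val _ _ + (freeFieldForm disp).val _ _ + (interactionForm P g).val _ _ =
    (momentumForm _).val _ _ + (freeFieldForm disp).val _ _ + (interactionForm P g).val _ _
  rw [momentumForm_totalU, interactionForm_totalU, freeFieldForm_totalU hdisp k
    (nelsonCore_le_freeFieldForm_dom hdisp hloc hΨ) (nelsonCore_le_freeFieldForm_dom hdisp hloc hΦ)]

theorem hypH2_nelsonForm (hdisp : ∀ k, 0 ≤ disp k) (hloc : LocallyIntegrable disp volume)
    (P : Polynomial ℝ) (g : L2 d ℂ) :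
    HypH2 (nelsonForm B disp P g) (nelsonCore d) fieldMomentum := by
  have hinv : ∀ k : Sp d, ∀ ψ ∈ fockFin d, fockU k ψ ∈ fockFin d := fun k _ hψ =>
    fockU_mem_fockFin k hψ
  refine ⟨isCommutingSelfAdjoint_fieldMomentum, isCommutingSelfAdjoint_totalMomentum
    isUnitaryRep_fockU dense_fockFin hinv fieldMomentum_graph
    (fun j ψ hψ => exists_genRel_fockU j hψ), ?_⟩
  intro W hW k
  have hWU := eq_totalU isUnitaryRep_fockU dense_fockFin hinv fieldMomentum_graph
    (fun j ψ hψ => exists_genRel_fockU j hψ) hW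
  refine ⟨?_, ?_⟩
  · ext Ψ
    constructor
    · rintro ⟨Φ, hΦ, rfl⟩
      rw [hWU]
      exact totalU_mem_nelsonCore k hΦ
    · intro hΨ
      refine ⟨totalU fockU (-k) Ψ, totalU_mem_nelsonCore (-k) hΨ, ?_⟩
      have hrep := isUnitaryRep_totalU (isUnitaryRep_fockU (d := d))
      rw [hWU, ← hrep.map_add, add_neg_cancel, hrep.map_zero]
  · intro Ψ hΨ Φ hΦ
    rw [hWU, hWU]
    exact nelsonForm_totalU hdisp hloc P g k hΨ hΦ

/-! ### Momentum shifts -/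

theorem phase_mem_algTensor {K : Type*} [NormedAddCommGroup K] [InnerProductSpace ℂ K]
    {F : Submodule ℂ K} (k : Sp d) {Ψ : L2 d K} (hΨ : Ψ ∈ algTensor (testFunctions d) F) :
    phase k Ψ ∈ algTensor (testFunctions d) F := by
  refine Submodule.span_induction (p := fun Ψ _ => phase k Ψ ∈ algTensor (testFunctions d) F)
    ?_ ?_ ?_ ?_ hΨ
  · rintro _ ⟨f, hf, ψ, hψ, rfl⟩
    rw [phase_tensor]
    exact tensor_mem_algTensor (phase_mem_testFunctions k hf) hψ
  · rw [phase_eq, _root_.map_zero]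
    exact Submodule.zero_mem _
  · intro x y _ _ hx hy
    rw [phase_eq, _root_.map_add, ← phase_eq, ← phase_eq]
    exact Submodule.add_mem _ hx hy
  · intro c x _ hx
    rw [phase_eq, _root_.map_smul, ← phase_eq]
    exact Submodule.smul_mem _ c hx

/-- Multiplication by `e^{ik·x}` translates the Fourier transform, and the substitution moves that
translation into the symbol. -/
theorem momentumForm_phase {K : Type*} [NormedAddCommGroup K] [InnerProductSpace ℂ K]
    [CompleteSpace K] (m : Sp d → ℝ) (k : Sp d) (Ψ : L2 d K) :
    ((momentumForm m).val (phase k Ψ) (phase k Ψ)).re =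
      ∫ ξ, m ((2 * Real.pi) • ξ + k) * ‖FT Ψ ξ‖ ^ 2 := by
  rw [momentumForm_val, FT_phase, mulForm_val_self, Complex.ofReal_re,
    ← integral_add_right_eq_self (fun ξ => m ((2 * Real.pi) • ξ + k) * ‖FT Ψ ξ‖ ^ 2)
      (-((2 * Real.pi)⁻¹ • k))]
  refine integral_congr_ae ?_
  filter_upwards [coeFn_shift (-((2 * Real.pi)⁻¹ • k)) (FT Ψ)] with ξ hξ
  rw [hξ]
  have h : (2 * Real.pi) • (ξ + -((2 * Real.pi)⁻¹ • k)) + k = (2 * Real.pi) • ξ := by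
    rw [smul_add, smul_neg, smul_smul, mul_inv_cancel₀ (by positivity), one_smul, neg_add_cancel_right]
  rw [h]

theorem integrable_momentumForm_phase {K : Type*} [NormedAddCommGroup K] [InnerProductSpace ℂ K]
    [CompleteSpace K] {m : Sp d → ℝ} (hm : Continuous m) (k : Sp d) {Ψ : L2 d K}
    (hΨ : phase k Ψ ∈ (momentumForm m : SForm (L2 d K)).dom) :
    Integrable fun ξ => m ((2 * Real.pi) • ξ + k) * ‖FT Ψ ξ‖ ^ 2 := by
  have hm' : Continuous fun ξ => m ((2 * Real.pi) • ξ) := by fun_prop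
  have h1 := integrable_mul_norm_sq hm'.aestronglyMeasurable (mem_momentumForm_dom.1 hΨ)
  have h2 := h1.comp_add_right ((2 * Real.pi)⁻¹ • k)
  refine h2.congr ?_
  have h3 := coeFn_shift (-((2 * Real.pi)⁻¹ • k)) (FT Ψ)
  filter_upwards [ae_shift ((2 * Real.pi)⁻¹ • k) h3] with ξ hξ
  rw [FT_phase, hξ, add_neg_cancel_right, smul_add, smul_smul, mul_inv_cancel₀ (by positivity),
    one_smul]

/-- The pointwise inequality for `B`, integrated against `‖FT Ψ‖²`. -/
theorem momentumForm_phase_le (hB : IsBernstein B) {K : Type*} [NormedAddCommGroup K]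
    [InnerProductSpace ℂ K] [CompleteSpace K] {F : Submodule ℂ K} (k : Sp d) {Ψ : L2 d K}
    (hΨ : Ψ ∈ algTensor (testFunctions d) F) :
    ((momentumForm fun k => B (‖k‖ ^ 2)).val (phase k Ψ) (phase k Ψ)).re +
      ((momentumForm fun k => B (‖k‖ ^ 2)).val (phase (-k) Ψ) (phase (-k) Ψ)).re ≤
      2 * ((momentumForm fun k => B (‖k‖ ^ 2)).val Ψ Ψ).re + 2 * (B (‖k‖ ^ 2) * ‖Ψ‖ ^ 2) := by
  have hc := hB.continuous_norm_sq (E := Sp d)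
  have hInt : ∀ k : Sp d, Integrable fun ξ => B (‖(2 * Real.pi) • ξ + k‖ ^ 2) * ‖FT Ψ ξ‖ ^ 2 :=
    fun k => integrable_momentumForm_phase hc k
      (algTensor_le_momentumForm_dom hB F (phase_mem_algTensor k hΨ))
  have h0 := hInt 0
  simp only [add_zero] at h0
  have e0 : ((momentumForm fun k => B (‖k‖ ^ 2)).val Ψ Ψ).re =
      ∫ ξ, B (‖(2 * Real.pi) • ξ‖ ^ 2) * ‖FT Ψ ξ‖ ^ 2 := by
    rw [momentumForm_val, mulForm_val_self, Complex.ofReal_re]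
  rw [momentumForm_phase, momentumForm_phase, e0, ← FT.norm_map Ψ, norm_sq_eq_integral,
    ← integral_add (hInt k) (hInt (-k)), ← integral_const_mul, ← integral_const_mul,
    ← integral_const_mul, ← integral_add (h0.const_mul 2)
      (((integrable_norm_sq (FT Ψ)).const_mul _).const_mul 2)]
  refine integral_mono ((hInt k).add (hInt (-k))) ((h0.const_mul 2).add
      (((integrable_norm_sq (FT Ψ)).const_mul _).const_mul 2)) fun ξ => ?_
  have h1 := mul_le_mul_of_nonneg_right (hB.norm_sq_add_sub_le ((2 * Real.pi) • ξ) k)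
    (sq_nonneg ‖FT Ψ ξ‖)
  rw [sub_eq_add_neg] at h1
  simp only
  linarith

theorem freeFieldForm_phase (hdisp : ∀ k, 0 ≤ disp k) (k : Sp d) {Ψ : L2 d (Fock d)}
    (hΨ : Ψ ∈ (freeFieldForm disp).dom) :
    (freeFieldForm disp).val (phase k Ψ) (phase k Ψ) = (freeFieldForm disp).val Ψ Ψ := by
  obtain ⟨Θ, h⟩ := hΨ
  rw [freeFieldForm_smul hdisp h (coeFn_phase k Ψ),
    freeFieldForm_smul hdisp h (Eventually.of_forall fun x => (one_smul ℂ (Ψ x)).symm)]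
  simp only [norm_exp_I_mul, norm_one]

theorem interactionForm_phase (P : Polynomial ℝ) (g : L2 d ℂ) (k : Sp d) {Ψ : L2 d (Fock d)}
    (hΨ : BddNumber Ψ) :
    (interactionForm P g).val (phase k Ψ) (phase k Ψ) = (interactionForm P g).val Ψ Ψ := by
  rw [interactionForm_smul P g hΨ (coeFn_phase k Ψ),
    interactionForm_smul P g hΨ (Eventually.of_forall fun x => (one_smul ℂ (Ψ x)).symm)]
  simp only [norm_exp_I_mul, norm_one]

/-- The phase acts fibrewise, so the forms of `H_f` and `P(φ(x))` are unchanged and cancel in the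
second difference, leaving only the kinetic term. -/
theorem hypH3_nelsonForm (hB : IsBernstein B) (hdisp : ∀ k, 0 ≤ disp k)
    (hloc : LocallyIntegrable disp volume) (P : Polynomial ℝ) (g : L2 d ℂ) :
    HypH3 (nelsonForm B disp P g) (nelsonCore d) (fun k => B (‖k‖ ^ 2)) := by
  refine ⟨(hB.continuous_norm_sq (E := Sp d)).measurable, fun k Ψ hΨ => ⟨?_, ?_⟩⟩
  · exact nelsonCore_le_nelsonForm_dom hB hdisp hloc P g (phase_mem_algTensor k hΨ)
  · have hval : ∀ k, ((nelsonForm B disp P g).val (phase k Ψ) (phase k Ψ)).re =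
        ((momentumForm fun k => B (‖k‖ ^ 2)).val (phase k Ψ) (phase k Ψ)).re +
        ((freeFieldForm disp).val Ψ Ψ).re + ((interactionForm P g).val Ψ Ψ).re := by
      intro k
      rw [← freeFieldForm_phase hdisp k (nelsonCore_le_freeFieldForm_dom hdisp hloc hΨ),
        ← interactionForm_phase P g k (bddNumber_of_mem hΨ), ← Complex.add_re, ← Complex.add_re]
      rfl
    have h1 := momentumForm_phase_le hB k hΨ
    rw [hval, hval, hval, phase_zero]
    linarith

/-! ### Multiplication by test functions -/

theorem mul_mem_algTensor {K : Type*} [NormedAddCommGroup K] [InnerProductSpace ℂ K]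
    {F : Submodule ℂ K} {f : L2 d ℂ} (hf : f ∈ testFunctions d) {Ψ : L2 d K}
    (hΨ : Ψ ∈ algTensor (testFunctions d) F) :
    ∃ Θ ∈ algTensor (testFunctions d) F, Θ =ᵐ[volume] fun x => f x • Ψ x := by
  refine Submodule.span_induction (p := fun Ψ _ => ∃ Θ ∈ algTensor (testFunctions d) F,
    Θ =ᵐ[volume] fun x => f x • Ψ x) ?_ ?_ ?_ ?_ hΨ
  · rintro _ ⟨h, ⟨v, hv, hv', hh⟩, ψ, hψ, rfl⟩
    obtain ⟨u, hu, hu', hf⟩ := hf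
    have hc : HasCompactSupport fun x => u x * v x := hu'.mul_right
    have hs : ContDiff ℝ ∞ fun x => u x * v x := hu.mul hv
    have hm : MemLp (fun x => u x * v x) 2 volume := hs.continuous.memLp_of_hasCompactSupport hc
    refine ⟨tensor (hm.toLp _) ψ, tensor_mem_algTensor ⟨_, hs, hc, hm.coeFn_toLp⟩ hψ, ?_⟩
    filter_upwards [coeFn_tensor (hm.toLp _) ψ, hm.coeFn_toLp, coeFn_tensor h ψ, hf, hh]
      with x h1 h2 h3 h4 h5
    rw [h1, h2, h3, h4, h5, smul_smul]
  · refine ⟨0, Submodule.zero_mem _, ?_⟩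
    filter_upwards [Lp.coeFn_zero K 2 (volume : Measure (Sp d))] with x hx
    rw [hx, Pi.zero_apply, smul_zero]
  · rintro Ψ Φ _ _ ⟨Θ, hΘ, h1⟩ ⟨Ξ, hΞ, h2⟩
    refine ⟨Θ + Ξ, Submodule.add_mem _ hΘ hΞ, ?_⟩
    filter_upwards [h1, h2, Lp.coeFn_add Θ Ξ, Lp.coeFn_add Ψ Φ] with x h1 h2 h3 h4
    rw [h3, h4, Pi.add_apply, Pi.add_apply, h1, h2, smul_add]
  · rintro c Ψ _ ⟨Θ, hΘ, h1⟩
    refine ⟨c • Θ, Submodule.smul_mem _ c hΘ, ?_⟩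
    filter_upwards [h1, Lp.coeFn_smul c Θ, Lp.coeFn_smul c Ψ] with x h1 h3 h4
    rw [h3, h4, Pi.smul_apply, Pi.smul_apply, h1, smul_comm]

theorem conj_mem_testFunctions {f : L2 d ℂ} (hf : f ∈ testFunctions d) :
    ∃ g ∈ testFunctions d, g =ᵐ[volume] fun x => conj (f x) := by
  obtain ⟨u, hu, hc, hf⟩ := hf
  have hs : ContDiff ℝ ∞ fun x => conj (u x) := Complex.conjCLE.contDiff.comp hu
  have hc' : HasCompactSupport fun x => conj (u x) := hc.comp_left (g := conj) (by simp)
  have hm : MemLp (fun x => conj (u x)) 2 volume := hs.continuous.memLp_of_hasCompactSupport hc'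
  refine ⟨hm.toLp _, ⟨_, hs, hc', hm.coeFn_toLp⟩, ?_⟩
  filter_upwards [hm.coeFn_toLp, hf] with x h1 h2
  rw [h1, h2]

theorem hypH4_nelson (hB : IsBernstein B) (hV : LocallyIntegrable V volume) :
    HypH4 V (fun k => B (‖k‖ ^ 2)) (nelsonCore d) (testFunctions d) where
  nontrivial := testFunctions_ne_bot
  le_domK := testFunctions_le_momentumForm_dom hB
  le_domV := testFunctions_le_mulForm_dom hV
  mul_mem _ hf _ hΨ := mul_mem_algTensor hf hΨ
  conj_mem _ hf := conj_mem_testFunctions hf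

end Symmetries

/-! ### Averages over translations -/

section Average

open scoped Convolution

variable {d : ℕ} {K : Type*} [NormedAddCommGroup K] [InnerProductSpace ℂ K]

/-- The correlation is a convolution with a reflected function. It produces the factorization of the
averages over `y`, including for the signed densities of `V` and of the interaction. -/
theorem integrable_correlation {a b : Sp d → ℝ} (ha : Integrable a) (hb : Integrable b) :
    (Integrable fun y => ∫ x, a (x - y) * b x) ∧
      ∫ y, ∫ x, a (x - y) * b x = (∫ x, a x) * ∫ x, b x := by
  have e : (fun y => ∫ x, a (x - y) * b x) =
      b ⋆[ContinuousLinearMap.mul ℝ ℝ, volume] fun z => a (-z) := by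
    funext y
    refine integral_congr_ae (Eventually.of_forall fun x => ?_)
    simp [mul_comm]
  rw [e]
  refine ⟨hb.integrable_convolution _ ha.comp_neg, ?_⟩
  rw [integral_convolution _ hb ha.comp_neg, integral_neg_eq_self]
  exact mul_comm _ _

theorem exists_contDiff_of_mem_algTensor {F : Submodule ℂ K} {Ψ : L2 d K}
    (hΨ : Ψ ∈ algTensor (testFunctions d) F) :
    ∃ G : Sp d → K, ContDiff ℝ ∞ G ∧ HasCompactSupport G ∧ Ψ =ᵐ[volume] G := by
  refine Submodule.span_induction (p := fun (Ψ : L2 d K) _ => ∃ G : Sp d → K, ContDiff ℝ ∞ G ∧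
    HasCompactSupport G ∧ Ψ =ᵐ[volume] G) ?_ ?_ ?_ ?_ hΨ
  · rintro _ ⟨f, ⟨u, hu, hc, hf⟩, ψ, _, rfl⟩
    refine ⟨fun x => u x • ψ, hu.smul contDiff_const, hc.smul_right, ?_⟩
    filter_upwards [coeFn_tensor f ψ, hf] with x h1 h2
    rw [h1, h2]
  · exact ⟨0, contDiff_const, HasCompactSupport.zero, Lp.coeFn_zero _ _ _⟩
  · rintro Ψ Φ _ _ ⟨G, h1, h2, h3⟩ ⟨G', h1', h2', h3'⟩
    exact ⟨G + G', h1.add h1', h2.add h2', (Lp.coeFn_add Ψ Φ).trans (h3.add h3')⟩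
  · rintro c Ψ _ ⟨G, h1, h2, h3⟩
    exact ⟨c • G, contDiff_const.smul h1, h2.smul_left (f := fun _ => c),
      (Lp.coeFn_smul c Ψ).trans (h3.const_smul c)⟩

theorem lintegral_enorm_sq {K : Type*} [NormedAddCommGroup K] (f : L2 d K) :
    ∫⁻ x, ‖f x‖ₑ ^ 2 = ‖f‖ₑ ^ 2 := by
  have h := eLpNorm_nnreal_pow_eq_lintegral (f := f) (μ := (volume : Measure (Sp d)))
    (p := 2) two_ne_zero
  rw [Lp.enorm_def]
  simpa using h.symm

theorem measurable_enorm_fourier_translate {u : Sp d → ℂ} (hu : Continuous u) {G : Sp d → K}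
    (hG : Continuous G) :
    Measurable fun p : Sp d × Sp d => ‖𝓕 (fun x => u (x - p.1) • G x) p.2‖ₑ := by
  have h : StronglyMeasurable fun p : Sp d × Sp d =>
      𝓕 (fun x => u (x - p.1) • G x) p.2 := by
    simp only [Real.fourier_eq']
    refine StronglyMeasurable.integral_prod_right
      (f := fun (p : Sp d × Sp d) x => Complex.exp (↑(-2 * Real.pi * ⟪x, p.2⟫_ℝ) * Complex.I) •
        u (x - p.1) • G x) (Continuous.stronglyMeasurable ?_)
    simp only [Function.uncurry_def]
    fun_prop
  exact h.enorm

theorem measurable_enorm_fourier {G : Sp d → K} (hG : Continuous G) :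
    Measurable fun ξ : Sp d => ‖𝓕 G ξ‖ₑ := by
  have h : StronglyMeasurable fun ξ : Sp d => 𝓕 G ξ := by
    simp only [Real.fourier_eq']
    refine StronglyMeasurable.integral_prod_right
      (f := fun (ξ : Sp d) x => Complex.exp (↑(-2 * Real.pi * ⟪x, ξ⟫_ℝ) * Complex.I) • G x)
      (Continuous.stronglyMeasurable ?_)
    simp only [Function.uncurry_def]
    fun_prop
  exact h.enorm

variable [CompleteSpace K]

theorem lintegral_enorm_sq_fourier {a : Sp d → K} (ha : ContDiff ℝ ∞ a)
    (hc : HasCompactSupport a) : ∫⁻ ξ, ‖𝓕 a ξ‖ₑ ^ 2 = ∫⁻ x, ‖a x‖ₑ ^ 2 := by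
  have hm : MemLp a 2 volume := ha.continuous.memLp_of_hasCompactSupport hc
  have h1 := lintegral_enorm_sq (FT (hm.toLp a))
  have h2 := lintegral_enorm_sq (hm.toLp a)
  have h3 : ‖FT (hm.toLp a)‖ₑ = ‖hm.toLp a‖ₑ := by
    rw [← ofReal_norm, ← ofReal_norm, LinearIsometryEquiv.norm_map]
  rw [h3, ← h2] at h1
  rw [← lintegral_congr_ae (show (fun x => ‖hm.toLp a x‖ₑ ^ 2) =ᵐ[volume] fun x => ‖a x‖ₑ ^ 2 by
    filter_upwards [hm.coeFn_toLp] with x hx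
    rw [hx]), ← h1]
  refine lintegral_congr_ae ?_
  filter_upwards [coeFn_FT ha hc hm.coeFn_toLp] with ξ hξ
  rw [hξ]

/-- Plancherel's theorem for the cross-correlation of `u` and `e^{-2πi ξ · x} G`. -/
theorem lintegral_fourier_translate {u : Sp d → ℂ} (hu : ContDiff ℝ ∞ u)
    (huc : HasCompactSupport u) {G : Sp d → K} (hG : ContDiff ℝ ∞ G) (hGc : HasCompactSupport G)
    (ξ : Sp d) :
    ∫⁻ y, ‖𝓕 (fun x => u (x - y) • G x) ξ‖ₑ ^ 2 =
      ∫⁻ q, ‖𝓕 u q‖ₑ ^ 2 * ‖𝓕 G (ξ - q)‖ₑ ^ 2 := by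
  set h : Sp d → K := fun x =>
    Complex.exp (Complex.I * (⟪-((2 * Real.pi) • ξ), x⟫_ℝ : ℂ)) • G x with hh
  have hhs : ContDiff ℝ ∞ h := by
    refine ContDiff.smul ?_ hG
    refine Complex.contDiff_exp.comp (contDiff_const.mul ?_)
    exact Complex.ofRealCLM.contDiff.comp (contDiff_const.inner ℝ contDiff_id)
  have hhc : HasCompactSupport h := hGc.smul_left
  have hus : ContDiff ℝ ∞ fun z => u (-z) := hu.comp contDiff_neg
  have hunc : HasCompactSupport fun z => u (-z) := huc.comp_homeomorph (Homeomorph.neg _)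
  have hui : Integrable fun z => u (-z) := hus.continuous.integrable_of_hasCompactSupport hunc
  have hhi : Integrable h := hhs.continuous.integrable_of_hasCompactSupport hhc
  -- As a function of `y` the transform at a fixed `ξ` is a smooth compactly supported convolution,
  -- so Plancherel applies in the variable `y`.
  have e : (fun y => 𝓕 (fun x => u (x - y) • G x) ξ) =
      (fun z => u (-z)) ⋆[ContinuousLinearMap.lsmul ℂ ℂ, volume] h := by
    funext y
    rw [Real.fourier_eq', convolution_def, ← integral_sub_left_eq_self _ volume y]
    refine integral_congr_ae (Eventually.of_forall fun t => ?_)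
    simp only [hh, ContinuousLinearMap.lsmul_apply, sub_sub_cancel_left]
    rw [smul_comm]
    congr 3
    rw [inner_neg_left, real_inner_smul_left, real_inner_comm]
    push_cast
    ring
  have hcs : ContDiff ℝ ∞ ((fun z => u (-z)) ⋆[ContinuousLinearMap.lsmul ℂ ℂ, volume] h) := by
    change ContDiff ℝ ∞ (_ ⋆[(ContinuousLinearMap.lsmul ℂ ℂ).bilinearRestrictScalars ℝ, volume] h)
    exact hhc.contDiff_convolution_right _ hui.locallyIntegrable hhs
  have hcc : HasCompactSupport ((fun z => u (-z)) ⋆[ContinuousLinearMap.lsmul ℂ ℂ, volume] h) :=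
    hunc.convolution _ hhc
  have h1 := lintegral_enorm_sq_fourier hcs hcc
  rw [← e] at h1
  rw [← h1, e, ← lintegral_neg_eq_self]
  refine lintegral_congr fun q => ?_
  rw [Real.fourier_smul_convolution_eq hui hhi, enorm_smul, mul_pow]
  have h2 : 𝓕 (fun z => u (-z)) (-q) = 𝓕 u q := by
    have := Real.fourier_comp_linearIsometry (LinearIsometryEquiv.neg ℝ (E := Sp d)) u (-q)
    simpa [Function.comp_def] using this
  have h3 : 𝓕 h (-q) = 𝓕 G (ξ - q) := by
    rw [hh, fourier_exp_mul]
    rw [smul_neg, neg_neg, smul_smul, inv_mul_cancel₀ (by positivity), one_smul,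
      neg_add_eq_sub]
  rw [h2, h3]

/-- The average over `y` removes all interference: the squared transform of the product becomes the
convolution of the two momentum densities, and `ξ` is then replaced by `ξ + q`. Working in `[0, ∞]`
makes Tonelli free of integrability conditions. -/
theorem lintegral_weight_translate {u : Sp d → ℂ} (hu : ContDiff ℝ ∞ u)
    (huc : HasCompactSupport u) {G : Sp d → K} (hG : ContDiff ℝ ∞ G) (hGc : HasCompactSupport G)
    {w : Sp d → ℝ≥0∞} (hw : Measurable w) :
    ∫⁻ y, ∫⁻ ξ, w ξ * ‖𝓕 (fun x => u (x - y) • G x) ξ‖ₑ ^ 2 =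
      ∫⁻ q, ∫⁻ ξ, ‖𝓕 u q‖ₑ ^ 2 * (w (ξ + q) * ‖𝓕 G ξ‖ₑ ^ 2) := by
  have hA := measurable_enorm_fourier_translate hu.continuous hG.continuous
  have hmu := measurable_enorm_fourier hu.continuous
  have hmG := measurable_enorm_fourier hG.continuous
  have h1 : ∀ ξ, ∫⁻ y, w ξ * ‖𝓕 (fun x => u (x - y) • G x) ξ‖ₑ ^ 2 =
      ∫⁻ q, w ξ * (‖𝓕 u q‖ₑ ^ 2 * ‖𝓕 G (ξ - q)‖ₑ ^ 2) := by
    intro ξ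
    rw [lintegral_const_mul, lintegral_const_mul, lintegral_fourier_translate hu huc hG hGc ξ]
    · have := hmG.comp (measurable_const.sub measurable_id : Measurable fun q : Sp d => ξ - q)
      exact (hmu.pow_const 2).mul (this.pow_const 2)
    · exact (hA.comp (measurable_id.prodMk measurable_const)).pow_const 2
  rw [lintegral_lintegral_swap, lintegral_congr h1, lintegral_lintegral_swap]
  · refine lintegral_congr fun q => ?_
    rw [← lintegral_add_right_eq_self _ q]
    refine lintegral_congr fun ξ => ?_
    rw [add_sub_cancel_right]
    ring
  · have h2 := hmG.comp (measurable_fst.sub measurable_snd : Measurable fun p : Sp d × Sp d => p.1 - p.2)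
    exact ((hw.comp measurable_fst).mul (((hmu.comp measurable_snd).pow_const 2).mul
      (h2.pow_const 2))).aemeasurable
  · exact ((hw.comp measurable_snd).mul (hA.pow_const 2)).aemeasurable

/-- Conjugating `u` reflects its momentum density. This produces the term with `ξ - q` needed to
symmetrize. -/
theorem enorm_fourier_conj (u : Sp d → ℂ) (q : Sp d) :
    ‖𝓕 (fun x => conj (u x)) q‖ₑ = ‖𝓕 u (-q)‖ₑ := by
  have h : 𝓕 (fun x => conj (u x)) q = conj (𝓕 u (-q)) := by
    rw [Real.fourier_eq', Real.fourier_eq', ← integral_conj]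
    refine integral_congr_ae (Eventually.of_forall fun x => ?_)
    simp only [smul_eq_mul, map_mul, ← Complex.exp_conj, Complex.conj_ofReal, Complex.conj_I,
      inner_neg_right]
    congr 2
    push_cast
    ring
  rw [h, ← ofReal_norm, ← ofReal_norm, RCLike.norm_conj]

theorem lintegral_weight_add_sub_le {a c w : Sp d → ℝ≥0∞} (ha : Measurable a) (hc : Measurable c)
    (hw : Measurable w) (hle : ∀ ξ q, w (ξ + q) + w (ξ - q) ≤ 2 * w ξ + 2 * w q) :
    (∫⁻ q, ∫⁻ ξ, a q * (w (ξ + q) * c ξ)) + ∫⁻ q, ∫⁻ ξ, a q * (w (ξ - q) * c ξ) ≤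
      2 * ((∫⁻ q, a q) * ∫⁻ ξ, w ξ * c ξ) + 2 * ((∫⁻ q, w q * a q) * ∫⁻ ξ, c ξ) := by
  have hm1 : Measurable fun p : Sp d × Sp d => a p.1 * (w (p.2 + p.1) * c p.2) := by fun_prop
  have hm4 : Measurable fun q => ∫⁻ ξ, a q * (w (ξ + q) * c ξ) := hm1.lintegral_prod_right'
  rw [← lintegral_add_left hm4]
  have h1 : ∀ q, (∫⁻ ξ, a q * (w (ξ + q) * c ξ)) + ∫⁻ ξ, a q * (w (ξ - q) * c ξ) ≤
      2 * (a q * ∫⁻ ξ, w ξ * c ξ) + 2 * (w q * a q * ∫⁻ ξ, c ξ) := by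
    intro q
    rw [← lintegral_add_left (by fun_prop), ← lintegral_const_mul _ (by fun_prop),
      ← lintegral_const_mul _ hc, ← lintegral_const_mul _ (by fun_prop),
      ← lintegral_const_mul _ (by fun_prop), ← lintegral_add_left (by fun_prop)]
    refine lintegral_mono fun ξ => ?_
    calc a q * (w (ξ + q) * c ξ) + a q * (w (ξ - q) * c ξ)
        = a q * c ξ * (w (ξ + q) + w (ξ - q)) := by ring
      _ ≤ a q * c ξ * (2 * w ξ + 2 * w q) := mul_le_mul_right (hle ξ q) _
      _ = _ := by ring
  refine (lintegral_mono h1).trans (le_of_eq ?_)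
  rw [lintegral_add_left (by fun_prop), lintegral_const_mul _ (by fun_prop),
    lintegral_mul_const _ ha, lintegral_const_mul _ (by fun_prop),
    lintegral_mul_const _ (by fun_prop)]

/-- Adding the averages for `u` and its conjugate brings in `w (ξ + q) + w (ξ - q)`, to which the
hypothesis on `w` applies; individually the two averages obey no such bound. -/
theorem lintegral_weight_translate_add_le {u : Sp d → ℂ} (hu : ContDiff ℝ ∞ u)
    (huc : HasCompactSupport u) {G : Sp d → K} (hG : ContDiff ℝ ∞ G) (hGc : HasCompactSupport G)
    {w : Sp d → ℝ≥0∞} (hw : Measurable w)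
    (hle : ∀ ξ q, w (ξ + q) + w (ξ - q) ≤ 2 * w ξ + 2 * w q) :
    (∫⁻ y, ∫⁻ ξ, w ξ * ‖𝓕 (fun x => u (x - y) • G x) ξ‖ₑ ^ 2) +
      ∫⁻ y, ∫⁻ ξ, w ξ * ‖𝓕 (fun x => conj (u (x - y)) • G x) ξ‖ₑ ^ 2 ≤
    2 * ((∫⁻ q, ‖𝓕 u q‖ₑ ^ 2) * ∫⁻ ξ, w ξ * ‖𝓕 G ξ‖ₑ ^ 2) +
      2 * ((∫⁻ q, w q * ‖𝓕 u q‖ₑ ^ 2) * ∫⁻ ξ, ‖𝓕 G ξ‖ₑ ^ 2) := by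
  have hus : ContDiff ℝ ∞ fun x => conj (u x) := Complex.conjCLE.contDiff.comp hu
  have huc' : HasCompactSupport fun x => conj (u x) := huc.comp_left (g := conj) (by simp)
  have h2 : (∫⁻ y, ∫⁻ ξ, w ξ * ‖𝓕 (fun x => conj (u (x - y)) • G x) ξ‖ₑ ^ 2) =
      ∫⁻ q, ∫⁻ ξ, ‖𝓕 u q‖ₑ ^ 2 * (w (ξ - q) * ‖𝓕 G ξ‖ₑ ^ 2) := by
    rw [lintegral_weight_translate (u := fun x => conj (u x)) hus huc' hG hGc hw,
      ← lintegral_neg_eq_self]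
    simp only [enorm_fourier_conj, neg_neg, ← sub_eq_add_neg]
  rw [h2, lintegral_weight_translate hu huc hG hGc hw]
  exact lintegral_weight_add_sub_le ((measurable_enorm_fourier hu.continuous).pow_const 2)
    ((measurable_enorm_fourier hG.continuous).pow_const 2) hw hle

end Average

/-! ### The binding inequality -/

section Binding

variable {d : ℕ} {B : ℝ → ℝ} {V disp : Sp d → ℝ}

/-- Converts the kinetic energy of a smooth vector into a `[0, ∞]`-valued integral, the setting of
the averaging argument. -/
theorem ofReal_momentumForm_val (hB : IsBernstein B) {K : Type*} [NormedAddCommGroup K]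
    [InnerProductSpace ℂ K] [CompleteSpace K] {Φ : L2 d K}
    (hΦ : Φ ∈ (momentumForm fun k => B (‖k‖ ^ 2) : SForm (L2 d K)).dom) {G : Sp d → K}
    (hG : ContDiff ℝ ∞ G) (hGc : HasCompactSupport G) (h : Φ =ᵐ[volume] G) :
    ENNReal.ofReal ((momentumForm fun k => B (‖k‖ ^ 2)).val Φ Φ).re =
      ∫⁻ ξ, ENNReal.ofReal (B (‖(2 * Real.pi) • ξ‖ ^ 2)) * ‖𝓕 G ξ‖ₑ ^ 2 := by
  have hc : Continuous fun ξ : Sp d => B (‖(2 * Real.pi) • ξ‖ ^ 2) :=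
    hB.continuousOn.comp_continuous (by fun_prop) fun ξ => sq_nonneg ‖(2 * Real.pi) • ξ‖
  have hn (ξ : Sp d) : 0 ≤ B (‖(2 * Real.pi) • ξ‖ ^ 2) :=
    hB.nonneg _ (sq_nonneg ‖(2 * Real.pi) • ξ‖)
  rw [mem_momentumForm_dom] at hΦ
  have hi := integrable_mul_norm_sq hc.aestronglyMeasurable hΦ
  rw [momentumForm_val, mulForm_val_self, Complex.ofReal_re, ofReal_integral_eq_lintegral_ofReal]
  · refine lintegral_congr_ae ?_
    filter_upwards [coeFn_FT hG hGc h] with ξ hξ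
    rw [hξ, ENNReal.ofReal_mul (hn ξ), ENNReal.ofReal_pow (norm_nonneg (𝓕 G ξ)),
      ofReal_norm]
  · exact hi
  · exact Eventually.of_forall fun ξ => mul_nonneg (hn ξ) (sq_nonneg ‖FT Φ ξ‖)

theorem momentumForm_nonneg (hB : IsBernstein B) {K : Type*} [NormedAddCommGroup K]
    [InnerProductSpace ℂ K] [CompleteSpace K] (Φ : L2 d K) :
    0 ≤ ((momentumForm fun k => B (‖k‖ ^ 2)).val Φ Φ).re := by
  rw [momentumForm_val, mulForm_val_self, Complex.ofReal_re]
  exact integral_nonneg fun ξ => mul_nonneg (hB.nonneg _ (sq_nonneg ‖(2 * Real.pi) • ξ‖))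
    (sq_nonneg ‖FT Φ ξ‖)

theorem lintegral_enorm_sq_of_ae {K : Type*} [NormedAddCommGroup K] {Φ : L2 d K} {G : Sp d → K}
    (h : Φ =ᵐ[volume] G) : ∫⁻ x, ‖G x‖ₑ ^ 2 = ENNReal.ofReal (‖Φ‖ ^ 2) := by
  rw [ENNReal.ofReal_pow (norm_nonneg Φ), ofReal_norm, ← lintegral_enorm_sq]
  refine lintegral_congr_ae ?_
  filter_upwards [h] with x hx
  rw [hx]

theorem integral_const_mul_sub_sub_sub {α : Type*} [MeasurableSpace α] {μ : Measure α}
    {a₁ a₂ a₃ a₄ : α → ℝ} (c : ℝ) (h₁ : Integrable a₁ μ) (h₂ : Integrable a₂ μ)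
    (h₃ : Integrable a₃ μ) (h₄ : Integrable a₄ μ) :
    Integrable (fun x => c * a₁ x - a₂ x - a₃ x - a₄ x) μ ∧
      ∫ x, (c * a₁ x - a₂ x - a₃ x - a₄ x) ∂μ =
        c * (∫ x, a₁ x ∂μ) - (∫ x, a₂ x ∂μ) - (∫ x, a₃ x ∂μ) - ∫ x, a₄ x ∂μ := by
  have i₂ : Integrable (fun x => c * a₁ x - a₂ x) μ := (h₁.const_mul c).sub h₂
  have i₃ : Integrable (fun x => c * a₁ x - a₂ x - a₃ x) μ := i₂.sub h₃
  refine ⟨i₃.sub h₄, ?_⟩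
  rw [integral_sub i₃ h₄, integral_sub i₂ h₃, integral_sub (h₁.const_mul c) h₂, integral_const_mul]

/-- The trial states are the translates, by the total momentum, of `f(x - y) Ψ(x)`. -/
theorem ofReal_trial_le (hB : IsBernstein B) (hdisp : ∀ k, 0 ≤ disp k)
    (hloc : LocallyIntegrable disp volume) (P : Polynomial ℝ) (g : L2 d ℂ) {c : ℝ}
    (hc : ∀ Φ ∈ nelsonCore d,
      c * ‖Φ‖ ^ 2 ≤ (((nelsonForm B disp P g).sum (mulForm V)).val Φ Φ).re)
    {u : Sp d → ℂ} (hu : ContDiff ℝ ∞ u) (huc : HasCompactSupport u)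
    {Ψ Θ : L2 d (Fock d)} (hΨ : Ψ ∈ nelsonCore d) (hΘ : FreeRel disp Ψ Θ)
    {G : Sp d → Fock d} (hG : ContDiff ℝ ∞ G) (hΨG : Ψ =ᵐ[volume] G) (y : Sp d) :
    ENNReal.ofReal (c * (∫ x, ‖u (x - y)‖ ^ 2 * ‖Ψ x‖ ^ 2) - (∫ x, ‖u (x - y)‖ ^ 2 * ‖Θ x‖ ^ 2) -
        (∫ x, ‖u (x - y)‖ ^ 2 * (pair (toSeq (Ψ x)) (polyOp P g x (toSeq (Ψ x)))).re) -
        ∫ x, V (x - y) * ‖u (x - y)‖ ^ 2 * ‖Ψ x‖ ^ 2) ≤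
      ∫⁻ ξ, ENNReal.ofReal (B (‖(2 * Real.pi) • ξ‖ ^ 2)) *
        ‖𝓕 (fun x => u (x - y) • G x) ξ‖ₑ ^ 2 := by
  have hus : ContDiff ℝ ∞ fun x => u (x - y) := hu.comp (contDiff_id.sub contDiff_const)
  have husc : HasCompactSupport fun x => u (x - y) :=
    huc.comp_homeomorph (Homeomorph.subRight y)
  have hm : MemLp (fun x => u (x - y)) 2 (volume : Measure (Sp d)) :=
    hus.continuous.memLp_of_hasCompactSupport husc
  have hf : hm.toLp _ ∈ testFunctions d := ⟨_, hus, husc, hm.coeFn_toLp⟩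
  obtain ⟨Φ, hΦ, hΦe⟩ := mul_mem_algTensor hf hΨ
  have hΦu : Φ =ᵐ[volume] fun x => u (x - y) • Ψ x := by
    filter_upwards [hΦe, hm.coeFn_toLp] with x h1 h2
    rw [h1, h2]
  have hΦG : Φ =ᵐ[volume] fun x => u (x - y) • G x := by
    filter_upwards [hΦu, hΨG] with x h1 h2
    rw [h1, h2]
  rw [← ofReal_momentumForm_val (G := fun x => u (x - y) • G x) hB
    (algTensor_le_momentumForm_dom hB _ hΦ) (hus.smul hG) husc.smul_right hΦG]
  refine ENNReal.ofReal_le_ofReal ?_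
  -- The lower bound is applied to the translated vector. The norm and `H^0` ignore the translation
  -- by the total momentum, while the potential is evaluated at `x - y`, next to `u (x - y)`.
  have h := hc _ (totalU_mem_nelsonCore y hΦ)
  rw [LinearIsometryEquiv.norm_map] at h
  change _ ≤ ((nelsonForm B disp P g).val _ _ + (mulForm V).val _ _).re at h
  rw [nelsonForm_totalU hdisp hloc P g y hΦ hΦ] at h
  change _ ≤ ((momentumForm fun k => B (‖k‖ ^ 2)).val Φ Φ + (freeFieldForm disp).val Φ Φ +
      (interactionForm P g).val Φ Φ + (mulForm V).val _ _).re at h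
  have hN : ‖Φ‖ ^ 2 = ∫ x, ‖u (x - y)‖ ^ 2 * ‖Ψ x‖ ^ 2 := by
    rw [norm_sq_eq_integral]
    refine integral_congr_ae ?_
    filter_upwards [hΦu] with x hx
    rw [hx, norm_smul, mul_pow]
  have hI : ((interactionForm P g).val Φ Φ).re =
      ∫ x, ‖u (x - y)‖ ^ 2 * (pair (toSeq (Ψ x)) (polyOp P g x (toSeq (Ψ x)))).re := by
    have hi := integrable_pair_polyOp P g (bddNumber_of_mem hΨ) Ψ
    obtain ⟨C, hC⟩ := husc.exists_bound_of_continuous hus.continuous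
    have hb : ∀ x, ‖((‖u (x - y)‖ ^ 2 : ℝ) : ℂ)‖ ≤ C ^ 2 := fun x => by
      rw [Complex.norm_real, norm_pow, norm_norm]
      exact pow_le_pow_left₀ (norm_nonneg _) (hC x) 2
    have hus' : Continuous fun x => ((‖u (x - y)‖ ^ 2 : ℝ) : ℂ) :=
      Complex.continuous_ofReal.comp (hus.continuous.norm.pow 2)
    rw [interactionForm_smul P g (bddNumber_of_mem hΨ) hΦu]
    refine (Complex.reCLM.integral_comp_comm
      (hi.bdd_mul hus'.aestronglyMeasurable (Eventually.of_forall hb))).symm.trans ?_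
    refine integral_congr_ae (Eventually.of_forall fun x => ?_)
    exact Complex.re_ofReal_mul _ _
  have hVv : ((mulForm V).val (totalU fockU y Φ) (totalU fockU y Φ)).re =
      ∫ x, V (x - y) * ‖u (x - y)‖ ^ 2 * ‖Ψ x‖ ^ 2 := by
    rw [mulForm_val_self, Complex.ofReal_re,
      ← integral_add_right_eq_self (fun x => V (x - y) * ‖u (x - y)‖ ^ 2 * ‖Ψ x‖ ^ 2) y]
    refine integral_congr_ae ?_
    filter_upwards [coeFn_totalU fockU y Φ, ae_shift y hΦu] with x h1 h2
    rw [h1, LinearIsometryEquiv.norm_map, h2, norm_smul, mul_pow, add_sub_cancel_right, mul_assoc]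
  rw [freeFieldForm_smul hdisp hΘ hΦu] at h
  simp only [Complex.add_re, Complex.ofReal_re] at h
  rw [hI, hVv, hN] at h
  linarith

theorem ofReal_bernstein_add_sub_le (hB : IsBernstein B) (ξ q : Sp d) :
    ENNReal.ofReal (B (‖(2 * Real.pi) • (ξ + q)‖ ^ 2)) +
        ENNReal.ofReal (B (‖(2 * Real.pi) • (ξ - q)‖ ^ 2)) ≤
      2 * ENNReal.ofReal (B (‖(2 * Real.pi) • ξ‖ ^ 2)) +
        2 * ENNReal.ofReal (B (‖(2 * Real.pi) • q‖ ^ 2)) := by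
  have hn (ξ : Sp d) : 0 ≤ B (‖(2 * Real.pi) • ξ‖ ^ 2) :=
    hB.nonneg _ (sq_nonneg ‖(2 * Real.pi) • ξ‖)
  have h := hB.norm_sq_add_sub_le ((2 * Real.pi) • ξ) ((2 * Real.pi) • q)
  rw [← smul_add, ← smul_sub] at h
  have h' := ENNReal.ofReal_le_ofReal h
  rwa [ENNReal.ofReal_mul zero_le_two, ENNReal.ofReal_add (hn _) (hn _),
    ENNReal.ofReal_add (hn _) (hn _), ENNReal.ofReal_ofNat, mul_add] at h'

/-- The averaged trial inequality. The norm averages to `‖f‖² ‖Ψ‖²`, `H_f` and the interaction to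
`‖f‖²` times their values at `Ψ`, and `V` to its value at `f` times `‖Ψ‖²`. The kinetic average,
symmetrized over `f` and its conjugate, is at most the sum of both kinetic energies with these
weights. -/
theorem mul_norm_sq_le_nelsonForm_add_particleForm (hB : IsBernstein B) (hdisp : ∀ k, 0 ≤ disp k)
    (hloc : LocallyIntegrable disp volume) (P : Polynomial ℝ) (g : L2 d ℂ)
    (hV : LocallyIntegrable V volume) {c : ℝ}
    (hc : ∀ Φ ∈ nelsonCore d,
      c * ‖Φ‖ ^ 2 ≤ (((nelsonForm B disp P g).sum (mulForm V)).val Φ Φ).re)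
    {f : L2 d ℂ} (hf : f ∈ testFunctions d) {Ψ : L2 d (Fock d)} (hΨ : Ψ ∈ nelsonCore d) :
    c * (‖f‖ ^ 2 * ‖Ψ‖ ^ 2) ≤ ‖f‖ ^ 2 * ((nelsonForm B disp P g).val Ψ Ψ).re +
      ((particleForm B V).val f f).re * ‖Ψ‖ ^ 2 := by
  have hfV := testFunctions_le_mulForm_dom hV hf
  have hfB := testFunctions_le_momentumForm_dom hB hf
  have hΨB := algTensor_le_momentumForm_dom hB _ hΨ
  obtain ⟨u, hu, huc, hfu⟩ := id hf
  obtain ⟨G, hG, hGc, hΨG⟩ := exists_contDiff_of_mem_algTensor hΨ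
  obtain ⟨Θ, hΘ⟩ := mem_freeFieldForm_dom.1 (nelsonCore_le_freeFieldForm_dom hdisp hloc hΨ)
  have hus : ContDiff ℝ ∞ fun x => conj (u x) := Complex.conjCLE.contDiff.comp hu
  have huc' : HasCompactSupport fun x => conj (u x) := huc.comp_left (g := conj) (by simp)
  have hfa : (fun x => ‖f x‖ ^ 2) =ᵐ[volume] fun x => ‖u x‖ ^ 2 := by
    filter_upwards [hfu] with x hx
    rw [hx]
  have hfa' : (fun x => V x * ‖f x‖ ^ 2) =ᵐ[volume] fun x => V x * ‖u x‖ ^ 2 := by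
    filter_upwards [hfu] with x hx
    rw [hx]
  have ia : Integrable fun x => ‖u x‖ ^ 2 := (integrable_norm_sq f).congr hfa
  have iV : Integrable fun x => V x * ‖u x‖ ^ 2 :=
    (integrable_mul_norm_sq hV.aestronglyMeasurable hfV).congr hfa'
  have iρ := integrable_pair_polyOp P g (bddNumber_of_mem hΨ) Ψ
  obtain ⟨iN, eN⟩ := integrable_correlation ia (integrable_norm_sq Ψ)
  obtain ⟨iF, eF⟩ := integrable_correlation ia (integrable_norm_sq Θ)
  obtain ⟨iI, eI⟩ := integrable_correlation ia iρ.re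
  obtain ⟨iW, eW⟩ := integrable_correlation iV (integrable_norm_sq Ψ)
  -- `L y` collects the terms that factorize under the average over `y`. Its positive part is a
  -- lower bound for the kinetic energy of the trial vector.
  set L : Sp d → ℝ := fun y => c * (∫ x, ‖u (x - y)‖ ^ 2 * ‖Ψ x‖ ^ 2) -
    (∫ x, ‖u (x - y)‖ ^ 2 * ‖Θ x‖ ^ 2) -
    (∫ x, ‖u (x - y)‖ ^ 2 * RCLike.re (pair (toSeq (Ψ x)) (polyOp P g x (toSeq (Ψ x))))) -
    ∫ x, V (x - y) * ‖u (x - y)‖ ^ 2 * ‖Ψ x‖ ^ 2 with hL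
  obtain ⟨iL, eL'⟩ := integral_const_mul_sub_sub_sub c iN iF iI iW
  have eL : ∫ y, L y = c * (‖f‖ ^ 2 * ‖Ψ‖ ^ 2) - ‖f‖ ^ 2 * ((freeFieldForm disp).val Ψ Ψ).re -
      ‖f‖ ^ 2 * ((interactionForm P g).val Ψ Ψ).re - ((mulForm V).val f f).re * ‖Ψ‖ ^ 2 := by
    have hI : ((interactionForm P g).val Ψ Ψ).re =
        ∫ x, RCLike.re (pair (toSeq (Ψ x)) (polyOp P g x (toSeq (Ψ x)))) := by
      rw [interactionForm_val]
      exact (Complex.reCLM.integral_comp_comm iρ).symm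
    rw [freeFieldForm_val_self hdisp hΘ, hI, mulForm_val_self, Complex.ofReal_re,
      norm_sq_eq_integral f, norm_sq_eq_integral Ψ, norm_sq_eq_integral Θ, integral_congr_ae hfa,
      integral_congr_ae hfa', ← eN, ← eF, ← eI, ← eW]
    exact eL'
  have key : ∫⁻ y, ENNReal.ofReal (L y) ≤ ENNReal.ofReal
      (‖f‖ ^ 2 * ((momentumForm fun k => B (‖k‖ ^ 2)).val Ψ Ψ).re +
        ((momentumForm fun k => B (‖k‖ ^ 2)).val f f).re * ‖Ψ‖ ^ 2) := by
    have hw : Measurable fun ξ : Sp d => ENNReal.ofReal (B (‖(2 * Real.pi) • ξ‖ ^ 2)) := by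
      have hBc : Continuous fun ξ : Sp d => B (‖(2 * Real.pi) • ξ‖ ^ 2) :=
        hB.continuousOn.comp_continuous (by fun_prop) fun ξ => sq_nonneg ‖(2 * Real.pi) • ξ‖
      exact hBc.measurable.ennreal_ofReal
    have h := lintegral_weight_translate_add_le hu huc hG hGc hw (ofReal_bernstein_add_sub_le hB)
    have h1 := ofReal_trial_le hB hdisp hloc P g hc hu huc hΨ hΘ hG hΨG
    -- The same lower bound `L` serves the conjugate, because only `‖u‖` enters it.
    have h2 := ofReal_trial_le hB hdisp hloc P g hc hus huc' hΨ hΘ hG hΨG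
    simp only [RCLike.norm_conj] at h2
    have h3 := (add_le_add (lintegral_mono h1) (lintegral_mono h2)).trans h
    rw [← two_mul, ← mul_add, ENNReal.mul_le_mul_iff_right two_ne_zero ENNReal.ofNat_ne_top,
      lintegral_enorm_sq_fourier hu huc, lintegral_enorm_sq_fourier hG hGc,
      ← ofReal_momentumForm_val hB hfB hu huc hfu, ← ofReal_momentumForm_val hB hΨB hG hGc hΨG,
      lintegral_enorm_sq_of_ae hfu, lintegral_enorm_sq_of_ae hΨG,
      ← ENNReal.ofReal_mul (sq_nonneg _), ← ENNReal.ofReal_mul (momentumForm_nonneg hB f),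
      ← ENNReal.ofReal_add (mul_nonneg (sq_nonneg _) (momentumForm_nonneg hB Ψ))
        (mul_nonneg (momentumForm_nonneg hB f) (sq_nonneg _))] at h3
    exact h3
  have hnn : 0 ≤ ‖f‖ ^ 2 * ((momentumForm fun k => B (‖k‖ ^ 2)).val Ψ Ψ).re +
        ((momentumForm fun k => B (‖k‖ ^ 2)).val f f).re * ‖Ψ‖ ^ 2 :=
    add_nonneg (mul_nonneg (sq_nonneg _) (momentumForm_nonneg hB Ψ))
      (mul_nonneg (momentumForm_nonneg hB f) (sq_nonneg _))
  -- `L` may take negative values, but only its positive part is needed for an upper bound on its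
  -- integral.
  have h1 := integral_eq_lintegral_pos_part_sub_lintegral_neg_part iL
  have h2 := ENNReal.toReal_le_of_le_ofReal hnn key
  have h3 := h1.le.trans ((sub_le_self _ ENNReal.toReal_nonneg).trans h2)
  have h4 := eL.symm.le.trans h3
  change _ ≤ ‖f‖ ^ 2 * ((momentumForm fun k => B (‖k‖ ^ 2)).val Ψ Ψ + (freeFieldForm disp).val Ψ Ψ +
      (interactionForm P g).val Ψ Ψ).re +
    ((momentumForm fun k => B (‖k‖ ^ 2)).val f f + (mulForm V).val f f).re * ‖Ψ‖ ^ 2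
  simp only [Complex.add_re]
  linarith

end Binding

/-! ### Infima of forms -/

section Infimum

variable {H : Type*} [NormedAddCommGroup H] [InnerProductSpace ℂ H] {q : SForm H}
  {D : Submodule ℂ H}

theorem SForm.infOn_le {Ψ : H} (hΨ : Ψ ∈ D) (h1 : ‖Ψ‖ = 1) :
    q.infOn D ≤ (((q.val Ψ Ψ).re : ℝ) : EReal) :=
  iInf₂_le Ψ ⟨hΨ, h1⟩

theorem SForm.le_infOn {a : EReal}
    (h : ∀ Ψ ∈ D, ‖Ψ‖ = 1 → a ≤ (((q.val Ψ Ψ).re : ℝ) : EReal)) : a ≤ q.infOn D :=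
  le_iInf₂ fun Ψ hΨ => h Ψ hΨ.1 hΨ.2

theorem exists_norm_eq_one_of_ne_bot (hD : D ≠ ⊥) : ∃ Ψ ∈ D, ‖Ψ‖ = 1 := by
  obtain ⟨Ψ, hΨ, h0⟩ := Submodule.exists_mem_ne_zero_of_ne_bot hD
  exact ⟨((‖Ψ‖ : ℂ))⁻¹ • Ψ, D.smul_mem _ hΨ, norm_smul_inv_norm h0⟩

theorem SForm.infOn_ne_top (hD : D ≠ ⊥) : q.infOn D ≠ ⊤ := by
  obtain ⟨Ψ, hΨ, h1⟩ := exists_norm_eq_one_of_ne_bot hD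
  exact ((SForm.infOn_le hΨ h1).trans_lt (EReal.coe_lt_top _)).ne

theorem SForm.IsHermitian.mul_norm_sq_le (hq : q.IsHermitian) (hD : D ≤ q.dom) {c : ℝ}
    (hc : (c : EReal) ≤ q.infOn D) {Φ : H} (hΦ : Φ ∈ D) : c * ‖Φ‖ ^ 2 ≤ (q.val Φ Φ).re := by
  rcases eq_or_ne Φ 0 with rfl | h0
  · rw [hq.zero_right (Submodule.zero_mem _)]
    simp
  · have h := EReal.coe_le_coe_iff.1 (hc.trans
      (SForm.infOn_le (D.smul_mem ((‖Φ‖ : ℂ))⁻¹ hΦ) (norm_smul_inv_norm h0)))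
    rw [hq.val_smul_self _ (hD hΦ), norm_inv, Complex.norm_real, norm_norm, inv_pow,
      inv_mul_eq_div, le_div_iff₀ (by positivity)] at h
    exact h

end Infimum

/-! ### Ground state energies and the binding energy -/

section BindingEnergy

variable {d : ℕ} {B : ℝ → ℝ} {V disp : Sp d → ℝ}

theorem nelsonCore_ne_bot : nelsonCore d ≠ ⊥ := by
  obtain ⟨f, hf, h1⟩ := exists_norm_eq_one_of_ne_bot (testFunctions_ne_bot (d := d))
  refine Submodule.ne_bot_iff _ |>.2 ⟨tensor f (fockVacuum d),
    tensor_mem_algTensor hf fockVacuum_mem, ?_⟩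
  rw [← norm_ne_zero_iff, norm_tensor_fockVacuum, h1]
  exact one_ne_zero

theorem exists_infOn_nelsonForm_eq (hB : IsBernstein B) (hdisp : ∀ k, 0 ≤ disp k)
    (hloc : LocallyIntegrable disp volume) (g : L2 d ℂ) {P : Polynomial ℝ}
    (hP : ∃ c : ℝ, ∀ t : ℝ, c ≤ P.eval t) :
    ∃ E : ℝ, (nelsonForm B disp P g).infOn (nelsonCore d) = (E : EReal) := by
  obtain ⟨c, hc⟩ := (nelsonForm_closableOn_and_boundedBelowOn hB hdisp hloc g hP).2
  have h : (c : EReal) ≤ (nelsonForm B disp P g).infOn (nelsonCore d) := by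
    refine SForm.le_infOn fun Ψ hΨ h1 => EReal.coe_le_coe_iff.2 ?_
    have := hc Ψ hΨ
    rwa [h1, one_pow, mul_one] at this
  refine ⟨_, (EReal.coe_toReal (SForm.infOn_ne_top nelsonCore_ne_bot) ?_).symm⟩
  exact ((EReal.bot_lt_coe c).trans_le h).ne'

theorem infOn_nelsonForm_sum_le (hB : IsBernstein B) (hdisp : ∀ k, 0 ≤ disp k)
    (hloc : LocallyIntegrable disp volume) (g : L2 d ℂ) {P : Polynomial ℝ}
    (hP : ∃ c : ℝ, ∀ t : ℝ, c ≤ P.eval t) (hV : LocallyIntegrable V volume) :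
    ((nelsonForm B disp P g).sum (mulForm V)).infOn (nelsonCore d) ≤
      (nelsonForm B disp P g).infOn (nelsonCore d) +
        (particleForm B V).infOn (testFunctions d) := by
  obtain ⟨E, hE⟩ := exists_infOn_nelsonForm_eq hB hdisp hloc g hP
  have hH : ((nelsonForm B disp P g).sum (mulForm V)).IsHermitian :=
    (nelsonForm_isHermitian hB hdisp P g).sum (mulForm_isHermitian hV.aestronglyMeasurable)
  have hD : nelsonCore d ≤ ((nelsonForm B disp P g).sum (mulForm V)).dom :=
    le_inf (nelsonCore_le_nelsonForm_dom hB hdisp hloc P g) (algTensor_le_mulForm_dom hV _)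
  have htop := SForm.infOn_ne_top (q := (nelsonForm B disp P g).sum (mulForm V))
    (nelsonCore_ne_bot (d := d))
  have hle := fun c => hH.mul_norm_sq_le hD (c := c)
  -- If the infimum of `H^V` is `-∞` nothing remains to be shown; `+∞` is excluded by a unit vector
  -- in the core. A finite value is itself an admissible constant `c`, and the infima over `Ψ` and
  -- over `f` are then taken one after the other.
  generalize ((nelsonForm B disp P g).sum (mulForm V)).infOn (nelsonCore d) = EV at *
  induction EV with
  | bot => exact bot_le
  | top => exact absurd rfl htop
  | coe c =>
    have h (f) (hf : f ∈ testFunctions d) (hf1 : ‖f‖ = 1) :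
        c - ((particleForm B V).val f f).re ≤ E := by
      rw [← EReal.coe_le_coe_iff, ← hE]
      refine SForm.le_infOn fun Ψ hΨ h1 => EReal.coe_le_coe_iff.2 ?_
      have := mul_norm_sq_le_nelsonForm_add_particleForm hB hdisp hloc P g hV
        (fun Φ hΦ => hle c le_rfl hΦ) hf hΨ
      rw [hf1, h1, one_pow, mul_one, mul_one, one_mul, mul_one] at this
      linarith
    have h' : ((c - E : ℝ) : EReal) ≤ (particleForm B V).infOn (testFunctions d) :=
      SForm.le_infOn fun f hf hf1 => EReal.coe_le_coe_iff.2 (by linarith [h f hf hf1])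
    rw [hE]
    calc (c : EReal) = (E : EReal) + ((c - E : ℝ) : EReal) := by
          rw [← EReal.coe_add, add_sub_cancel]
      _ ≤ _ := by gcongr

/-- Finiteness of `a` and `b ≠ ⊤` keep the extended subtraction meaningful; `b = ⊥` is allowed and
makes the difference `⊤`. -/
theorem neg_le_sub_and_pos_of_le_add {a b e : EReal} (ha : ∃ r : ℝ, a = (r : EReal)) (hb : b ≠ ⊤)
    (h : b ≤ a + e) (he : e < 0) : -e ≤ a - b ∧ 0 < a - b := by
  obtain ⟨r, rfl⟩ := ha
  have h0 : 0 < -e := by simpa using he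
  suffices h1 : -e ≤ r - b from ⟨h1, h0.trans_le h1⟩
  induction b with
  | bot => simp
  | top => exact absurd rfl hb
  | coe b =>
    induction e with
    | bot => simp at h
    | top => simp at he
    | coe e =>
      have h2 : b ≤ r + e := by exact_mod_cast h
      have h3 : -e ≤ r - b := by linarith
      exact_mod_cast h3

end BindingEnergy

end NelsonModel

end

/-! ### Assembly of the main theorem -/

theorem mainTheorem3 (d : ℕ)
    (B : ℝ → ℝ) (hB : IsBernstein B)
    (disp : Sp d → ℝ) (hdisp : ∀ k, 0 ≤ disp k) (hdisp_loc : LocallyIntegrable disp volume)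
    (g : L2 d ℂ)
    (P : Polynomial ℝ) (hP : ∃ c : ℝ, ∀ t : ℝ, c ≤ P.eval t)
    (V : Sp d → ℝ) (hV : LocallyIntegrable V volume) :
    -- (H.1): everything concerning `H^0`, and `D₀ ⊆ Q(V)`, for every `V ∈ L¹_loc`
    HypH1 (nelsonForm B disp P g) 0 (nelsonCore d) ∧
    nelsonCore d ≤ (mulForm V : SForm (L2 d (Fock d))).dom ∧
    -- (H.1) in full, exactly when the particle form `B(p²) + V` is closable and bounded from below
    (HypH1 (nelsonForm B disp P g) V (nelsonCore d) ↔
      (particleForm B V).ClosableOn (testFunctions d) ∧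
      (particleForm B V).BoundedBelowOn (testFunctions d)) ∧
    -- (H.2)
    HypH2 (nelsonForm B disp P g) (nelsonCore d) fieldMomentum ∧
    -- (H.3) and (H.4), with `K(k) = B(k²)` and `D₁ = C_0^∞(ℝ^d)`
    HypH3 (nelsonForm B disp P g) (nelsonCore d) (fun k => B (‖k‖ ^ 2)) ∧
    HypH4 V (fun k => B (‖k‖ ^ 2)) (nelsonCore d) (testFunctions d) ∧
    -- `E^0` is finite and `E^V ≤ E^0 + e_0`
    (∃ E : ℝ, (nelsonForm B disp P g).infOn (nelsonCore d) = (E : EReal)) ∧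
    ((nelsonForm B disp P g).sum (mulForm V)).infOn (nelsonCore d) ≤
      (nelsonForm B disp P g).infOn (nelsonCore d) + (particleForm B V).infOn (testFunctions d) ∧
    -- if `e_0 < 0`, the binding energy satisfies `E^0 - E^V ≥ -e_0 > 0`
    ((particleForm B V).infOn (testFunctions d) < 0 →
      -(particleForm B V).infOn (testFunctions d) ≤
        (nelsonForm B disp P g).infOn (nelsonCore d) -
          ((nelsonForm B disp P g).sum (mulForm V)).infOn (nelsonCore d) ∧
      0 < (nelsonForm B disp P g).infOn (nelsonCore d) -
        ((nelsonForm B disp P g).sum (mulForm V)).infOn (nelsonCore d)) := by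
  refine ⟨?_, algTensor_le_mulForm_dom hV _, ⟨particleForm_of_hypH1 hdisp, fun h =>
    hypH1_of_particleForm hB hdisp hdisp_loc g hP hV h.1 h.2⟩,
    hypH2_nelsonForm hdisp hdisp_loc P g, hypH3_nelsonForm hB hdisp hdisp_loc P g,
    hypH4_nelson hB hV, exists_infOn_nelsonForm_eq hB hdisp hdisp_loc g hP,
    infOn_nelsonForm_sum_le hB hdisp hdisp_loc g hP hV, fun he =>
    neg_le_sub_and_pos_of_le_add (exists_infOn_nelsonForm_eq hB hdisp hdisp_loc g hP)
      (SForm.infOn_ne_top nelsonCore_ne_bot)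
      (infOn_nelsonForm_sum_le hB hdisp hdisp_loc g hP hV) he⟩
  exact hypH1_of_particleForm hB hdisp hdisp_loc g hP locallyIntegrable_zero'
    (particleForm_zero_closableOn hB) (particleForm_zero_boundedBelowOn hB)
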